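/- All graphs are finite, undirected and simple. A connected graph $\Gamma$ with diameter $D$ is distance-regular if there are integers $b_i, c_i$ ($0\le i\le D$) such that for any vertices $x,y$ at distance $i$ there are precisely $b_i$ neighbours of $y$ at distance $i+1$ from $x$ and precisely $c_i$ neighbours of $y$ at distance $i-1$ from $x$; its valency is $k=b_0$, and $a_i:=k-b_i-c_i$. A connected non-complete strongly regular graph is the same as a distance-regular graph of diameter two; thus $a_1$ is the number of common neighbours of two adjacent vertices and $c_2$ the number of common neighbours of two non-adjacent distinct vertices. A Terwilliger graph is a connected non-complete graph for which there is a $\mu\ge 1$ such that the common neighbours of any two vertices at distance two form a clique of size $\mu$. Then the following hold. (i) Let $\Gamma$ be a connected non-complete strongly regular graph with valency $k$. If $c_2=1$ and $k<7(a_1+1)$, then $\Gamma$ is either the pentagon or the Petersen graph. (ii) Let $\Gamma$ be a connected non-complete strongly regular Terwilliger graph with $v$ vertices and valency $k$. If $v\le 7k$, then $\Gamma$ is either the pentagon or the Petersen graph. (iii) Let $\Gamma$ be a distance-regular Terwilliger graph with valency $k$. If $k\le\left(6+\frac{8}{57}\right)(a_1+1)$ and $c_2\ge 2$, then $\Gamma$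 is the icosahedron, the Doro graph or the Conway–Smith graph. Here the Doro graph is the graph with 65 vertices and intersection array $\{10,6,4;1,2,5\}$ whose vertices are the points $\langle x\rangle$ of $PG(3,5)$ with $Q(x)\in\{1,-1\}$, where $Q(x)=x_0^2+x_1^2+x_2^2+2x_3^2$, two points being adjacent when they are orthogonal with respect to $Q$. The Conway–Smith graph is the graph with 63 vertices and intersection array $\{10,6,4,1;1,2,6,10\}$ whose vertices are the 18 vectors of weight $1$ in $\mathbb F_4^6$ and the 45 words of weight $4$ of the hexacode $\{(a,b,f(0),f(1),f(\omega),f(\omega^2)) : f(x)=ax^2+bx+c,\ a,b,c\in\mathbb F_4\}$, where $\omega$ generates $\mathbb F_4^\times$, two distinct vertices being adjacent when their supports meet and they agree on the common support. -/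

import Mathlib

/-! ### Distance-regular graphs and Terwilliger graphs -/

/-- A connected graph is distance-regular with intersection numbers `b i`, `c i` if, for all
vertices `x`, `y` at distance `i`, the vertex `y` has precisely `b i` neighbours at distance
`i + 1` from `x` and precisely `c i` neighbours at distance `i - 1` from `x`.
The values `b i`, `c i` for `i` beyond the diameter are irrelevant. -/
structure SimpleGraph.IsDistanceRegularWith {V : Type*} (G : SimpleGraph V) (b c : ℕ → ℕ) :
    Prop where
  connected : G.Connected
  card_succ : ∀ x y : V,
    {z : V | G.Adj y z ∧ G.dist x z = G.dist x y + 1}.ncard = b (G.dist x y)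
  card_pred : ∀ x y : V,
    {z : V | G.Adj y z ∧ G.dist x z + 1 = G.dist x y}.ncard = c (G.dist x y)

/-- The intersection number `a i = k - b i - c i`, where `k = b 0` is the valency. -/
def intersectionA (b c : ℕ → ℕ) (i : ℕ) : ℤ := (b 0 : ℤ) - (b i : ℤ) - (c i : ℤ)

/-- A Terwilliger graph: a connected non-complete graph such that the common neighbours of any
two vertices at distance two form a clique of size `μ`, for a fixed `μ ≥ 1`. -/
def SimpleGraph.IsTerwilliger {V : Type*} (G : SimpleGraph V) : Prop :=
  G.Connected ∧ G ≠ ⊤ ∧ ∃ μ : ℕ, 1 ≤ μ ∧ ∀ u v : V, G.dist u v = 2 →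
    G.IsClique (G.commonNeighbors u v) ∧ (G.commonNeighbors u v).ncard = μ

/-! ### The pentagon and the Petersen graph -/

/-- The pentagon: the cycle of length five. -/
abbrev pentagon : SimpleGraph (Fin 5) := SimpleGraph.cycleGraph 5

/-- The Petersen graph: the `2`-subsets of a `5`-set, adjacent when disjoint. -/
def petersenGraph : SimpleGraph {s : Finset (Fin 5) // s.card = 2} where
  Adj s t := Disjoint s.1 t.1
  symm := ⟨fun _ _ h => h.symm⟩
  loopless := ⟨fun s h => by
    have h1 : s.1 = ∅ := disjoint_self.mp h
    have h2 := s.2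
    rw [h1] at h2
    exact absurd h2 (by decide)⟩

/-! ### The icosahedron -/

/-- Adjacency in the icosahedron, seen as a pentagonal antiprism with two apexes.
`(t, none)` is the apex on side `t`, and `(t, some i)`, for `i` modulo five, is the pentagon
next to that apex. -/
def icosahedronAdj : Bool × Option (ZMod 5) → Bool × Option (ZMod 5) → Prop
  | (_, none), (_, none) => False
  | (s, none), (t, some _) => s = t
  | (s, some _), (t, none) => s = t
  | (true, some i), (true, some j) => j = i + 1 ∨ i = j + 1
  | (false, some i), (false, some j) => j = i + 1 ∨ i = j + 1
  | (true, some i), (false, some j) => j = i ∨ j = i + 1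
  | (false, some j), (true, some i) => j = i ∨ j = i + 1

/-- The (skeleton of the) icosahedron. -/
def icosahedron : SimpleGraph (Bool × Option (ZMod 5)) where
  Adj := icosahedronAdj
  symm := ⟨by
    rintro ⟨_ | _, _ | i⟩ ⟨_ | _, _ | j⟩ h <;> simp only [icosahedronAdj] at h ⊢ <;>
      first | exact h | exact h.symm⟩
  loopless := ⟨by
    rintro ⟨_ | _, _ | i⟩ h <;> simp only [icosahedronAdj] at h <;>
      revert i <;> decide⟩

/-! ### The Doro graph on 65 vertices -/

/-- The bilinear form `x₀ y₀ + x₁ y₁ + x₂ y₂ + 2 x₃ y₃` on `𝔽₅⁴`. Its discriminant `2` is not a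
square, so (as `5 ≡ 1` modulo `4`) the quadric `x ⬝ x = 0` in `PG(3, 5)` is elliptic. -/
def ellipticForm (x y : Fin 4 → ZMod 5) : ZMod 5 :=
  x 0 * y 0 + x 1 * y 1 + x 2 * y 2 + 2 * (x 3 * y 3)

/-- The standard representatives of the points of `PG(3, 5)`: the vectors whose first nonzero
coordinate is `1`. -/
def IsNormalized (x : Fin 4 → ZMod 5) : Prop :=
  ∃ i : Fin 4, x i = 1 ∧ ∀ j : Fin 4, j < i → x j = 0

/-- The Doro graph with intersection array `{10, 6, 4; 1, 2, 5}`: its vertices are the 65 points of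
`PG(3, 5)` at which the elliptic quadratic form takes a nonzero square value (`1` or `-1`; scaling
the vector by `2` exchanges the two), and two of them are adjacent when they are orthogonal. -/
def doroGraph : SimpleGraph
    {x : Fin 4 → ZMod 5 // IsNormalized x ∧ (ellipticForm x x = 1 ∨ ellipticForm x x = -1)} where
  Adj x y := ellipticForm x.1 y.1 = 0
  symm := ⟨fun x y h => by
    rw [← h]; unfold ellipticForm; ring⟩
  loopless := ⟨fun x h => by
    rcases x.2.2 with h1 | h1 <;> rw [h] at h1 <;> revert h1 <;> decide⟩

/-! ### The Conway–Smith graph on 63 vertices -/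

/-- The field with four elements `0`, `1`, `ω`, `ω² = ω + 1`. -/
inductive GF4 : Type
  | zero | one | w | w2
  deriving DecidableEq

namespace GF4

instance : Fintype GF4 where
  elems := {zero, one, w, w2}
  complete x := by cases x <;> decide

/-- Addition: `x + x = 0`, and the sum of two distinct nonzero elements is the third one. -/
def add : GF4 → GF4 → GF4
  | zero, y => y
  | x, zero => x
  | one, one => zero
  | one, w => w2
  | one, w2 => w
  | w, one => w2
  | w, w => zero
  | w, w2 => one
  | w2, one => w
  | w2, w => one
  | w2, w2 => zero

/-- Multiplication: the nonzero elements are the powers of `ω`, and `ω³ = 1`. -/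
def mul : GF4 → GF4 → GF4
  | zero, _ => zero
  | _, zero => zero
  | one, y => y
  | x, one => x
  | w, w => w2
  | w, w2 => one
  | w2, w => one
  | w2, w2 => w

/-- Inversion, with `0⁻¹ = 0`. -/
def inv : GF4 → GF4
  | zero => zero
  | one => one
  | w => w2
  | w2 => w

instance : Zero GF4 := ⟨zero⟩
instance : One GF4 := ⟨one⟩
instance : Add GF4 := ⟨add⟩
instance : Mul GF4 := ⟨mul⟩
instance : Neg GF4 := ⟨fun x => x⟩
instance : Inv GF4 := ⟨inv⟩

instance : CommRing GF4 where
  add_assoc := by decide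
  zero_add := by decide
  add_zero := by decide
  add_comm := by decide
  neg_add_cancel := by decide
  left_distrib := by decide
  right_distrib := by decide
  zero_mul := by decide
  mul_zero := by decide
  mul_assoc := by decide
  one_mul := by decide
  mul_one := by decide
  mul_comm := by decide
  nsmul := nsmulRec
  zsmul := zsmulRec

instance : Field GF4 where
  exists_pair_ne := ⟨zero, one, by decide⟩
  mul_inv_cancel := by decide
  inv_zero := by decide
  nnqsmul := _
  nnqsmul_def := fun _ _ => rfl
  qsmul := _
  qsmul_def := fun _ _ => rfl

end GF4

/-- The hexacode word `(a, b, f(0), f(1), f(ω), f(ω²))`, where `f(x) = a x² + b x + c`. -/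
def hexacodeWord (a b c : GF4) : Fin 6 → GF4 :=
  ![a, b, c, a + b + c, a * GF4.w ^ 2 + b * GF4.w + c, a * GF4.w2 ^ 2 + b * GF4.w2 + c]

/-- The number of nonzero coordinates of a vector. -/
def hexWeight (x : Fin 6 → GF4) : ℕ := (Finset.univ.filter fun i => x i ≠ 0).card

/-- The vertices of the Conway–Smith graph: the 18 vectors of weight `1` in `𝔽₄⁶` and the
45 hexacode words of weight `4`. -/
def IsConwaySmithVertex (x : Fin 6 → GF4) : Prop :=
  hexWeight x = 1 ∨ (hexWeight x = 4 ∧ ∃ a b c : GF4, x = hexacodeWord a b c)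

/-- The Conway–Smith graph, with intersection array `{10, 6, 4, 1; 1, 2, 6, 10}`: two distinct
vertices are adjacent when their supports meet and they agree on the common support. -/
def conwaySmithGraph : SimpleGraph {x : Fin 6 → GF4 // IsConwaySmithVertex x} where
  Adj x y := x ≠ y ∧ (∃ i, x.1 i ≠ 0 ∧ y.1 i ≠ 0) ∧ ∀ i, x.1 i ≠ 0 → y.1 i ≠ 0 → x.1 i = y.1 i
  symm := ⟨fun _ _ ⟨hne, ⟨i, hx, hy⟩, h⟩ =>
    ⟨hne.symm, ⟨i, hy, hx⟩, fun j h1 h2 => (h j h2 h1).symm⟩⟩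
  loopless := ⟨fun _ h => h.1 rfl⟩

/-!
The proof has three parts.

*Structure of strongly regular Terwilliger graphs.* In a graph in which any two non-adjacent
vertices have `m ≥ 1` common neighbours, forming a clique, identifying vertices with the same closed
neighbourhood ("twins") gives a strongly regular Terwilliger graph
(`SimpleGraph.IsCliqueRegular.exists_quotient`). For `m ≥ 2` this applies to the local graphs of a
strongly regular Terwilliger graph, or of an amply regular one, and makes an induction on `m`
possible: the number of vertices exceeds `7k` unless `m = 1`
(`SimpleGraph.IsTerwilligerSRG.eq_of_card_le`). For `m = 1` the closed neighbourhoods of a vertex are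
unions of lines of size `l + 2`, so the hypothesis on `k` leaves finitely many parameters, and the
integrality of the eigenvalue multiplicities (`SimpleGraph.IsSRGWith.exists_sq_mul_discr`) leaves
those of the pentagon and of the Petersen graph (`SimpleGraph.IsTerwilligerSRG.eq_of_mu_one`), which
determine the graph. For a distance-regular Terwilliger graph with `c₂ ≥ 2` the same results, applied
to the quotient of a local graph, show that all local graphs are pentagons or Petersen graphs and
that `c₂ = 2` (`SimpleGraph.IsAmplyTerwilliger.params`).

*Uniqueness of locally Petersen graphs.* A graph that is locally a pentagon is the icosahedron by a
direct construction. If all local graphs are Petersen graphs, fix a vertex `x` and identify its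
neighbours with the vertices `a` of the Petersen graph. Over each edge `ab` lie two vertices
`u a b i`, `i ∈ ℤ/2`, at distance two from `x`. Vertices over disjoint edges are not adjacent
(`SimpleGraph.IsLocallyMoore.not_isCrossEdge`), and for a path `abc` the adjacencies between the
vertices over `ab` and `bc` are given by a sign `σ a b c`. The neighbours at distance two of a vertex
at distance three form an induced cycle of valency two in a Petersen graph, hence a pentagon or a
hexagon; in a distance-regular graph their number `c₃` is `5` or `6`. They lie over a pentagon or a
hexagon of the Petersen graph, and following them around shows that the signs along the pentagons
have sum `0` for `c₃ = 5` and sum `1` for `c₃ = 6`. As the pentagons generate the cycle space of the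
Petersen graph, this determines `σ` up to a change of coordinates
(`SimpleGraph.PetersenChart.exists_sigma_eq`). With coordinates chosen such that the signs agree, two
graphs with the same `c₃` are matched one distance after the other
(`SimpleGraph.IsLocallyMoore.nonempty_iso`): a vertex at distance three is determined by its
neighbours at distance two, and one at distance four by its neighbours at distance three.

*The two examples.* That the Doro graph and the Conway–Smith graph satisfy the hypotheses of the
uniqueness theorem, with `c₃ = 5` and `c₃ = 6`, is checked by computation on their adjacency
matrices.
-/

universe u

/-! ### Graph homomorphisms between regular graphs -/

/-- A homomorphism between finite regular graphs of the same valency that is injective on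
neighbourhoods is onto, when the target is connected: its range is closed under adjacency. -/
theorem SimpleGraph.surjective_of_locally_injective {V W : Type*} [Finite V]
    {T : SimpleGraph W} {G : SimpleGraph V} [Nonempty W] (φ : W → V)
    (hom : ∀ i j, T.Adj i j → G.Adj (φ i) (φ j))
    (hloc : ∀ i, Set.InjOn φ (T.neighborSet i)) {d : ℕ}
    (hT : ∀ i, (T.neighborSet i).ncard = d) (hG : ∀ v, (G.neighborSet v).ncard = d)
    (hc : G.Connected) : Function.Surjective φ := by
  have key : ∀ i, φ '' T.neighborSet i = G.neighborSet (φ i) := by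
    intro i
    apply Set.eq_of_subset_of_ncard_le
    · rintro _ ⟨j, hj, rfl⟩
      exact hom i j hj
    · rw [(hloc i).ncard_image, hT, hG]
    · exact Set.toFinite _
  obtain ⟨i₀⟩ := ‹Nonempty W›
  intro v
  obtain ⟨p⟩ := hc.preconnected (φ i₀) v
  have : ∀ {a b : V} (_ : G.Walk a b), (∃ i, φ i = a) → ∃ i, φ i = b := by
    intro a b p
    induction p with
    | nil => exact id
    | cons h _ ih =>
      rintro ⟨i, rfl⟩
      apply ih
      have : _ ∈ G.neighborSet (φ i) := h
      rw [← key] at this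
      obtain ⟨j, -, hj⟩ := this
      exact ⟨j, hj⟩
  exact this p ⟨i₀, rfl⟩

/-- An injective homomorphism between finite regular graphs of the same valency is an isomorphism
when the target is connected. -/
theorem SimpleGraph.nonempty_iso_of_injective {V W : Type*} [Finite V]
    {T : SimpleGraph W} {G : SimpleGraph V} [Nonempty W] (φ : W → V)
    (hom : ∀ i j, T.Adj i j → G.Adj (φ i) (φ j)) (hinj : Function.Injective φ) {d : ℕ}
    (hT : ∀ i, (T.neighborSet i).ncard = d) (hG : ∀ v, (G.neighborSet v).ncard = d)
    (hc : G.Connected) : Nonempty (G ≃g T) := by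
  have hs := SimpleGraph.surjective_of_locally_injective φ hom (fun i => hinj.injOn) hT hG hc
  have hb : Function.Bijective φ := ⟨hinj, hs⟩
  refine ⟨(SimpleGraph.Iso.symm ⟨Equiv.ofBijective φ hb, ?_⟩)⟩
  intro i j
  show G.Adj (φ i) (φ j) ↔ T.Adj i j
  refine ⟨fun h => ?_, hom i j⟩
  have key : φ '' T.neighborSet i = G.neighborSet (φ i) := by
    apply Set.eq_of_subset_of_ncard_le
    · rintro _ ⟨j, hj, rfl⟩
      exact hom i j hj
    · rw [hinj.injOn.ncard_image, hT, hG]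
    · exact Set.toFinite _
  have h' : φ j ∈ G.neighborSet (φ i) := h
  rw [← key] at h'
  obtain ⟨j', hj', e⟩ := h'
  exact hinj e ▸ hj'

/-- A locally injective homomorphism between finite regular graphs of the same valency and the same
order is an isomorphism when the target is connected. -/
theorem SimpleGraph.nonempty_iso_of_locally_injective {V W : Type*} [Finite V] [Finite W]
    {T : SimpleGraph W} {G : SimpleGraph V} [Nonempty W] (φ : W → V)
    (hom : ∀ i j, T.Adj i j → G.Adj (φ i) (φ j))
    (hloc : ∀ i, Set.InjOn φ (T.neighborSet i)) {d : ℕ}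
    (hT : ∀ i, (T.neighborSet i).ncard = d) (hG : ∀ v, (G.neighborSet v).ncard = d)
    (hc : G.Connected) (hcard : Nat.card W = Nat.card V) : Nonempty (G ≃g T) := by
  have hs := SimpleGraph.surjective_of_locally_injective φ hom hloc hT hG hc
  exact SimpleGraph.nonempty_iso_of_injective φ hom
    ((Nat.bijective_iff_surjective_and_card φ).2 ⟨hs, hcard⟩).1 hT hG hc

/-! ### Integrality of the eigenvalue multiplicities of a strongly regular graph -/

/-- The trace of an idempotent matrix is its rank, so a natural number. -/
theorem Matrix.exists_nat_trace_eq_of_isIdempotentElem {V : Type*} [Fintype V] [DecidableEq V]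
    {E : Matrix V V ℝ} (hE : E * E = E) : ∃ f : ℕ, E.trace = f := by
  have h : IsIdempotentElem (Matrix.toLin' E) := by
    show Matrix.toLin' E * Matrix.toLin' E = _
    rw [Module.End.mul_eq_comp, ← Matrix.toLin'_mul, hE]
  exact ⟨_, by
    rw [← Matrix.trace_toLin'_eq, (LinearMap.IsIdempotentElem.isProj_range _ h).trace]⟩

open Matrix in
/-- The integrality condition: with `D` the discriminant of the quadratic equation satisfied by the
two restricted eigenvalues and `z` the difference of their multiplicities, the vanishing of the
trace of the adjacency matrix reads `z √D = ± (2k + (n - 1)(l - m))`. The two multiplicities are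
ranks of idempotents, hence integers. -/
theorem SimpleGraph.IsSRGWith.exists_sq_mul_discr {V : Type*} [Fintype V] {G : SimpleGraph V}
    [DecidableRel G.Adj] {n k l m : ℕ} (h : G.IsSRGWith n k l m) (hn : 0 < n)
    (hD : 0 < ((l : ℤ) - m) ^ 2 + 4 * (k - m)) :
    ∃ z : ℤ, z ^ 2 * (((l : ℤ) - m) ^ 2 + 4 * (k - m)) = (2 * k + (n - 1) * (l - m)) ^ 2 := by
  classical
  set A : Matrix V V ℝ := G.adjMatrix ℝ with hA
  set J : Matrix V V ℝ := Matrix.of fun _ _ => 1 with hJ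
  have hc : Gᶜ.adjMatrix ℝ = J - 1 - A := by
    ext v w
    simp only [hA, hJ, SimpleGraph.adjMatrix_apply, SimpleGraph.compl_adj, Matrix.sub_apply,
      Matrix.one_apply, Matrix.of_apply]
    by_cases hvw : v = w
    · subst hvw; simp
    · by_cases ha : G.Adj v w <;> simp [hvw, ha]
  have hA2 : A * A = ((k : ℝ) - m) • (1 : Matrix V V ℝ) + ((l : ℝ) - m) • A + (m : ℝ) • J := by
    have := h.matrix_eq (α := ℝ)
    rw [hc, sq] at this
    rw [hA, this, ← hA]
    simp only [← Nat.cast_smul_eq_nsmul ℝ]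
    module
  have hAJ : A * J = (k : ℝ) • J := by
    ext v w
    simp [hA, hJ, SimpleGraph.adjMatrix_mul_apply, h.regular.degree_eq]
  have hJA : J * A = (k : ℝ) • J := by
    ext v w
    simp [hA, hJ, SimpleGraph.mul_adjMatrix_apply, h.regular.degree_eq]
  have hJJ : J * J = (n : ℝ) • J := by
    ext v w
    simp [hJ, Matrix.mul_apply, h.card]
  have hn' : (0 : ℝ) < n := by exact_mod_cast hn
  obtain ⟨v₀⟩ : Nonempty V := Fintype.card_pos_iff.1 (h.card ▸ hn)
  have hk2 : (k : ℝ) ^ 2 = (k - m) + (l - m) * k + m * n := by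
    have h1 : A * A * J = ((k : ℝ) * k) • J := by
      rw [Matrix.mul_assoc, hAJ, Matrix.mul_smul, hAJ, smul_smul]
    rw [hA2, Matrix.add_mul, Matrix.add_mul, Matrix.smul_mul, Matrix.smul_mul, Matrix.smul_mul,
      hAJ, hJJ, Matrix.one_mul] at h1
    have h2 := congrFun (congrFun h1 v₀) v₀
    simp [hJ] at h2
    linarith
  set D : ℝ := ((l : ℝ) - m) ^ 2 + 4 * (k - m) with hDdef
  have hD' : 0 < D := by
    have : (0 : ℝ) < ((((l : ℤ) - m) ^ 2 + 4 * (k - m) : ℤ) : ℝ) := by exact_mod_cast hD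
    push_cast at this
    exact this
  set r := Real.sqrt D with hr
  have hr0 : 0 < r := Real.sqrt_pos.2 hD'
  have hrr : r * r = D := Real.mul_self_sqrt hD'.le
  -- `α A + β 1 + γ J` is the projection on the eigenspace of the larger restricted eigenvalue.
  set α : ℝ := 1 / r with hα
  set β : ℝ := (1 - (l - m) / r) / 2 with hβ
  set γ : ℝ := -(1 + (2 * k - (l - m)) / r) / (2 * n) with hγ
  have h1 : α * α * (k - m) + β * β = β := by
    rw [hα, hβ]; field_simp
    have : r ^ 2 = D := by rw [sq, hrr]
    rw [hDdef] at this
    linear_combination -this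
  have h2 : α * α * (l - m) + 2 * α * β = α := by
    rw [hα, hβ]; field_simp; ring
  have h3 : α * α * m + 2 * α * γ * k + 2 * β * γ + γ * γ * n = γ := by
    rw [hα, hβ, hγ]; field_simp
    have : r ^ 2 = D := by rw [sq, hrr]
    rw [hDdef] at this
    linear_combination this - 4 * hk2
  have hE : (α • A + β • (1 : Matrix V V ℝ) + γ • J) * (α • A + β • (1 : Matrix V V ℝ) + γ • J)
      = α • A + β • (1 : Matrix V V ℝ) + γ • J := by
    have e : (α • A + β • (1 : Matrix V V ℝ) + γ • J) * (α • A + β • (1 : Matrix V V ℝ) + γ • J)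
      = (α * α) • (A * A) + (2 * α * β) • A + (β * β) • (1 : Matrix V V ℝ)
        + (α * γ) • (A * J) + (α * γ) • (J * A) + (2 * β * γ) • J + (γ * γ) • (J * J) := by
      simp only [Matrix.add_mul, Matrix.mul_add, Matrix.smul_mul, Matrix.mul_smul, Matrix.one_mul,
        Matrix.mul_one]
      module
    rw [e, hA2, hAJ, hJA, hJJ]
    have : (α * α * (l - m) + 2 * α * β) • A + (α * α * (k - m) + β * β) • (1 : Matrix V V ℝ)
      + (α * α * m + 2 * α * γ * k + 2 * β * γ + γ * γ * n) • J
      = α • A + β • (1 : Matrix V V ℝ) + γ • J := by rw [h1, h2, h3]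
    rw [← this]
    module
  obtain ⟨f, hf⟩ := Matrix.exists_nat_trace_eq_of_isIdempotentElem hE
  have htr : α * 0 + β * n + γ * n = f := by
    rw [← hf, Matrix.trace_add, Matrix.trace_add, Matrix.trace_smul, Matrix.trace_smul,
      Matrix.trace_smul, hA, SimpleGraph.trace_adjMatrix, Matrix.trace_one]
    simp [hJ, Matrix.trace, h.card]
  refine ⟨(n : ℤ) - 1 - 2 * f, ?_⟩
  have h4 : ((n : ℝ) - 1 - 2 * f) * r = 2 * k + (n - 1) * (l - m) := by
    rw [← htr, hβ, hγ]; field_simp; ring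
  have h5 : ((n : ℝ) - 1 - 2 * f) ^ 2 * D = (2 * k + (n - 1) * (l - m)) ^ 2 := by
    rw [← h4, ← hrr]; ring
  rw [hDdef] at h5
  exact_mod_cast h5

/-! ### Graphs whose `μ`-graphs are cliques, and their reduced quotients -/

namespace SimpleGraph

/-- A finite regular non-complete graph of valency `k` in which any two distinct non-adjacent
vertices have exactly `m ≥ 1` common neighbours, and these form a clique. No condition is put on
adjacent pairs: this is what the local graphs of a Terwilliger graph satisfy. -/
structure IsCliqueRegular {V : Type*} (G : SimpleGraph V) (k m : ℕ) : Prop where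
  ncard_neighborSet : ∀ x, (G.neighborSet x).ncard = k
  isClique : ∀ x y, x ≠ y → ¬G.Adj x y → G.IsClique (G.commonNeighbors x y)
  ncard_of_not_adj : ∀ x y, x ≠ y → ¬G.Adj x y → (G.commonNeighbors x y).ncard = m
  pos : 1 ≤ m
  ne_top : G ≠ ⊤

/-- A strongly regular Terwilliger graph with parameters `(n, k, l, m)`. -/
structure IsTerwilligerSRG {V : Type*} (G : SimpleGraph V) (n k l m : ℕ) : Prop
    extends G.IsCliqueRegular k m where
  card : Nat.card V = n
  ncard_of_adj : ∀ x y, G.Adj x y → (G.commonNeighbors x y).ncard = l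

/-- Two vertices are twins if their closed neighbourhoods coincide. -/
def Twin {V : Type*} (G : SimpleGraph V) (a b : V) : Prop :=
  ∀ c, (c = a ∨ G.Adj a c) ↔ (c = b ∨ G.Adj b c)

section Twin

variable {V : Type*} {G : SimpleGraph V} {a b c : V}

theorem Twin.refl (G : SimpleGraph V) (a : V) : G.Twin a a := fun _ => Iff.rfl

theorem Twin.symm (h : G.Twin a b) : G.Twin b a := fun c => (h c).symm

theorem Twin.trans (h : G.Twin a b) (h' : G.Twin b c) : G.Twin a c :=
  fun d => (h d).trans (h' d)

theorem Twin.adj (h : G.Twin a b) (hab : a ≠ b) : G.Adj a b := by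
  rcases (h b).2 (Or.inl rfl) with h1 | h1
  · exact absurd h1.symm hab
  · exact h1

theorem Twin.adj_right (h : G.Twin a b) (hac : G.Adj a c) (hcb : c ≠ b) : G.Adj b c :=
  ((h c).1 (Or.inr hac)).resolve_left hcb

end Twin

end SimpleGraph

theorem Set.ncard_setOf_eq {V : Type*} [Fintype V] (p : V → Prop) [DecidablePred p] :
    {x | p x}.ncard = (Finset.univ.filter p).card := by
  rw [← Set.ncard_coe_finset]; simp

/-- A set all of whose fibres have size `s`. -/
theorem Set.ncard_preimage_eq_mul {V W : Type*} [Finite V] [Finite W] {π : V → W} {s : ℕ}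
    (h : ∀ w, (π ⁻¹' {w}).ncard = s) (S : Set W) : (π ⁻¹' S).ncard = s * S.ncard := by
  classical
  have := Fintype.ofFinite V
  have := Fintype.ofFinite W
  have h1 : (π ⁻¹' S).ncard = (Finset.univ.filter fun a => π a ∈ S).card := Set.ncard_setOf_eq _
  have h2 : S.ncard = (Finset.univ.filter fun w => w ∈ S).card := Set.ncard_setOf_eq (· ∈ S)
  rw [h1, h2, Finset.card_eq_sum_card_fiberwise (t := Finset.univ.filter fun w => w ∈ S) (f := π)]
  · rw [Finset.sum_const_nat (m := s), mul_comm]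
    intro w hw
    rw [← h w, Finset.filter_filter]
    have h3 : (π ⁻¹' {w}).ncard = (Finset.univ.filter fun a => π a = w).card :=
      Set.ncard_setOf_eq (fun a => π a = w)
    rw [h3]
    congr 1
    ext a
    simp only [Finset.mem_filter, Finset.mem_univ, true_and] at hw ⊢
    constructor
    · exact fun h => h.2
    · rintro rfl; exact ⟨hw, rfl⟩
  · intro a ha
    simpa using ha

namespace SimpleGraph.IsCliqueRegular

variable {V : Type*} {G : SimpleGraph V} {k m : ℕ}

theorem exists_mem_commonNeighbors (h : G.IsCliqueRegular k m) {x y : V} (hxy : x ≠ y)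
    (hn : ¬G.Adj x y) : ∃ w, G.Adj x w ∧ G.Adj y w := by
  have h1 := h.ncard_of_not_adj x y hxy hn
  have h2 := h.pos
  obtain ⟨w, hw⟩ := Set.nonempty_of_ncard_ne_zero (s := G.commonNeighbors x y) (by omega)
  exact ⟨w, hw⟩

theorem exists_not_adj (h : G.IsCliqueRegular k m) : ∃ a c, a ≠ c ∧ ¬G.Adj a c := by
  by_contra! hc
  apply h.ne_top
  ext a c
  simp only [top_adj]
  exact ⟨fun h => h.ne, fun h => hc a c h⟩

variable [Finite V]

/-- Let `a`, `c` be non-adjacent with common neighbours `M`. If `b ∈ Γ(a) \ M` and `d ∈ Γ(c) \ M`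
are adjacent, then they have the same neighbours in `M`, because the common neighbours of `b`, `c`
and those of `a`, `d` form cliques. Counting these edges `bd`, each with weight
`1 / (m - |Γ(b) ∩ M|)`, shows that as many `b` as `d` are non-adjacent to a given `z ∈ M`. -/
theorem ncard_commonNeighbors_eq (h : G.IsCliqueRegular k m) {a c z : V} (hac : a ≠ c)
    (hn : ¬G.Adj a c) (hza : G.Adj a z) (hzc : G.Adj c z) :
    (G.commonNeighbors a z).ncard = (G.commonNeighbors c z).ncard := by
  classical
  have := Fintype.ofFinite V
  let S : V → Finset V := fun b => Finset.univ.filter fun y => G.Adj b y ∧ G.Adj a y ∧ G.Adj c y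
  let B : Finset V := Finset.univ.filter fun b => G.Adj a b ∧ ¬G.Adj c b ∧ ¬G.Adj b z
  let D : Finset V := Finset.univ.filter fun b => G.Adj c b ∧ ¬G.Adj a b ∧ ¬G.Adj b z
  have hS : ∀ b d, G.Adj a b → ¬G.Adj c b → G.Adj c d → ¬G.Adj a d → G.Adj b d → S b = S d := by
    intro b d hab hcb hcd had hbd
    ext y
    simp only [S, Finset.mem_filter, Finset.mem_univ, true_and]
    constructor
    · rintro ⟨h1, h2, h3⟩
      refine ⟨?_, h2, h3⟩
      have hbc : b ≠ c := by rintro rfl; exact hn hab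
      refine h.isClique b c hbc (fun h => hcb h.symm) ⟨hbd, hcd⟩ ⟨h1, h3⟩ ?_
      rintro rfl; exact had h2
    · rintro ⟨h1, h2, h3⟩
      refine ⟨?_, h2, h3⟩
      have had' : a ≠ d := by rintro rfl; exact hn hcd.symm
      refine h.isClique a d had' had ⟨hab, hbd.symm⟩ ⟨h2, h1⟩ ?_
      rintro rfl; exact hcb h3
  -- The weighted count of edges, seen from one of the two sides.
  have key : ∀ a c : V, a ≠ c → ¬G.Adj a c → G.Adj a z → G.Adj c z →
      (∀ b d, G.Adj a b → ¬G.Adj c b → G.Adj c d → ¬G.Adj a d → G.Adj b d →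
        (Finset.univ.filter fun y => G.Adj b y ∧ G.Adj a y ∧ G.Adj c y) =
        (Finset.univ.filter fun y => G.Adj d y ∧ G.Adj a y ∧ G.Adj c y)) →
      ∀ b, G.Adj a b → ¬G.Adj c b → ¬G.Adj b z →
      (∑ d ∈ Finset.univ.filter (fun d => G.Adj c d ∧ ¬G.Adj a d ∧ ¬G.Adj d z),
        if G.Adj b d then (1 : ℚ) /
          (m - (Finset.univ.filter fun y => G.Adj b y ∧ G.Adj a y ∧ G.Adj c y).card) else 0)
        = 1 := by
    intro a c hac hn hza hzc hS b hab hcb hbz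
    rw [← Finset.sum_filter, Finset.sum_const, nsmul_eq_mul, Finset.filter_filter]
    have hbc : b ≠ c := by rintro rfl; exact hn hab
    have h1 := h.ncard_of_not_adj b c hbc (fun h => hcb h.symm)
    have h1' : (Finset.univ.filter fun y => G.Adj b y ∧ G.Adj c y).card = m := by
      rw [← h1, ← Set.ncard_setOf_eq]; rfl
    have h2 : (Finset.univ.filter fun y => G.Adj b y ∧ G.Adj c y) =
        (Finset.univ.filter fun y => G.Adj b y ∧ G.Adj a y ∧ G.Adj c y) ∪
        (Finset.univ.filter fun d => (G.Adj c d ∧ ¬G.Adj a d ∧ ¬G.Adj d z) ∧ G.Adj b d) := by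
      ext y
      simp only [Finset.mem_filter, Finset.mem_univ, true_and, Finset.mem_union]
      constructor
      · rintro ⟨h3, h4⟩
        by_cases hay : G.Adj a y
        · exact Or.inl ⟨h3, hay, h4⟩
        · refine Or.inr ⟨⟨h4, hay, fun hyz => ?_⟩, h3⟩
          have h5 := hS b y hab hcb h4 hay h3
          have h6 : z ∈ Finset.univ.filter fun x => G.Adj y x ∧ G.Adj a x ∧ G.Adj c x := by
            simp [hyz, hza, hzc]
          rw [← h5] at h6
          simp at h6
          exact hbz h6.1
      · rintro (⟨h3, -, h4⟩ | ⟨⟨h3, -, -⟩, h4⟩)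
        · exact ⟨h3, h4⟩
        · exact ⟨h4, h3⟩
    have h3 : Disjoint (Finset.univ.filter fun y => G.Adj b y ∧ G.Adj a y ∧ G.Adj c y)
        (Finset.univ.filter fun d => (G.Adj c d ∧ ¬G.Adj a d ∧ ¬G.Adj d z) ∧ G.Adj b d) := by
      rw [Finset.disjoint_left]
      intro y hy hy'
      simp only [Finset.mem_filter, Finset.mem_univ, true_and] at hy hy'
      exact hy'.1.2.1 hy.2.1
    rw [h2, Finset.card_union_of_disjoint h3] at h1'
    -- `z` is a common neighbour of `a` and `c` that `b` misses.
    have h4 : (Finset.univ.filter fun y => G.Adj b y ∧ G.Adj a y ∧ G.Adj c y).card < m := by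
      have h5 := h.ncard_of_not_adj a c hac hn
      have h6 : (Finset.univ.filter fun y => G.Adj a y ∧ G.Adj c y).card = m := by
        rw [← h5, ← Set.ncard_setOf_eq]; rfl
      rw [← h6]
      apply Finset.card_lt_card
      rw [Finset.ssubset_iff_of_subset]
      · exact ⟨z, by simp [hza, hzc], by simp [hbz]⟩
      · intro y; simp only [Finset.mem_filter, Finset.mem_univ, true_and]; tauto
    have h5 : ((Finset.univ.filter fun d =>
        (G.Adj c d ∧ ¬G.Adj a d ∧ ¬G.Adj d z) ∧ G.Adj b d).card : ℚ) =
        m - (Finset.univ.filter fun y => G.Adj b y ∧ G.Adj a y ∧ G.Adj c y).card := by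
      rw [eq_sub_iff_add_eq, add_comm]; exact_mod_cast h1'
    rw [h5, mul_one_div_cancel]
    have : ((Finset.univ.filter fun y => G.Adj b y ∧ G.Adj a y ∧ G.Adj c y).card : ℚ) < m := by
      exact_mod_cast h4
    linarith
  have hBD : B.card = D.card := by
    have e1 : (B.card : ℚ) = ∑ b ∈ B, ∑ d ∈ D,
        if G.Adj b d then (1 : ℚ) / (m - (S b).card) else 0 := by
      rw [Finset.sum_congr rfl (g := fun _ => (1 : ℚ))]
      · simp
      · intro b hb
        simp only [B, Finset.mem_filter, Finset.mem_univ, true_and] at hb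
        exact key a c hac hn hza hzc hS b hb.1 hb.2.1 hb.2.2
    have e2 : (D.card : ℚ) = ∑ d ∈ D, ∑ b ∈ B,
        if G.Adj b d then (1 : ℚ) / (m - (S b).card) else 0 := by
      rw [Finset.sum_congr rfl (g := fun _ => (1 : ℚ))]
      · simp
      · intro d hd
        simp only [D, Finset.mem_filter, Finset.mem_univ, true_and] at hd
        have hS' : ∀ d : V,
            (Finset.univ.filter fun y => G.Adj d y ∧ G.Adj c y ∧ G.Adj a y) = S d := by
          intro d; ext y; simp only [S, Finset.mem_filter, Finset.mem_univ, true_and]; tauto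
        have := key c a hac.symm (fun h => hn h.symm) hzc hza (by
          intro b d h1 h2 h3 h4 h5
          rw [hS', hS', hS d b h3 h4 h1 h2 h5.symm]) d hd.1 hd.2.1 hd.2.2
        refine Eq.trans (Finset.sum_congr rfl ?_) this
        intro b hb
        simp only [B, Finset.mem_filter, Finset.mem_univ, true_and] at hb
        by_cases hbd : G.Adj b d
        · rw [if_pos hbd, if_pos hbd.symm, hS', hS b d hb.1 hb.2.1 hd.1 hd.2.1 hbd]
        · rw [if_neg hbd, if_neg (fun h => hbd h.symm)]
    have : (B.card : ℚ) = D.card := by rw [e1, e2, Finset.sum_comm]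
    exact_mod_cast this
  -- The neighbours of `a` are `z`, those adjacent to `z`, and the set `B`.
  have count : ∀ a c : V, a ≠ c → ¬G.Adj a c → G.Adj a z → G.Adj c z →
      (G.commonNeighbors a z).ncard +
        (Finset.univ.filter fun b => G.Adj a b ∧ ¬G.Adj c b ∧ ¬G.Adj b z).card + 1 = k := by
    intro a c hac hn hza hzc
    have h1 : (G.commonNeighbors a z).ncard =
        (Finset.univ.filter fun y => G.Adj a y ∧ G.Adj z y).card :=
      Set.ncard_setOf_eq fun y => G.Adj a y ∧ G.Adj z y
    have h2 : (Finset.univ.filter fun y => G.Adj a y).card = k := by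
      rw [← h.ncard_neighborSet a, ← Set.ncard_setOf_eq]; rfl
    have h3 : (Finset.univ.filter fun y => G.Adj a y) =
        insert z ((Finset.univ.filter fun y => G.Adj a y ∧ G.Adj z y) ∪
        (Finset.univ.filter fun b => G.Adj a b ∧ ¬G.Adj c b ∧ ¬G.Adj b z)) := by
      ext y
      simp only [Finset.mem_filter, Finset.mem_univ, true_and, Finset.mem_insert, Finset.mem_union]
      constructor
      · intro hay
        by_cases hyz : y = z
        · exact Or.inl hyz
        · by_cases hz : G.Adj z y
          · exact Or.inr (Or.inl ⟨hay, hz⟩)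
          · refine Or.inr (Or.inr ⟨hay, fun hcy => hz ?_, fun h => hz h.symm⟩)
            exact h.isClique a c hac hn ⟨hza, hzc⟩ ⟨hay, hcy⟩ (Ne.symm hyz)
      · rintro (rfl | ⟨h, -⟩ | ⟨h, -⟩)
        · exact hza
        · exact h
        · exact h
    rw [h1, ← h2, h3, Finset.card_insert_of_notMem, Finset.card_union_of_disjoint]
    · rw [Finset.disjoint_left]
      intro y hy hy'
      simp only [Finset.mem_filter, Finset.mem_univ, true_and] at hy hy'
      exact hy'.2.2 hy.2.symm
    · simp [hzc]
  have c1 := count a c hac hn hza hzc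
  have c2 := count c a hac.symm (fun h => hn h.symm) hzc hza
  change _ + B.card + 1 = k at c1
  change _ + D.card + 1 = k at c2
  omega

theorem exists_not_adj_of_adj (h : G.IsCliqueRegular k m) {z y : V} (hzy : G.Adj z y)
    (ht : ¬G.Twin z y) : ∃ a, G.Adj z a ∧ a ≠ y ∧ ¬G.Adj y a := by
  by_contra! hc
  apply ht
  have key : insert z (G.neighborSet z) = insert y (G.neighborSet y) := by
    apply Set.eq_of_subset_of_ncard_le
    · rintro a (rfl | ha)
      · exact Or.inr hzy.symm
      · by_cases hay : a = y
        · exact Or.inl hay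
        · exact Or.inr (hc a ha hay)
    · rw [Set.ncard_insert_of_notMem (by simp), Set.ncard_insert_of_notMem (by simp),
        h.ncard_neighborSet, h.ncard_neighborSet]
    · exact Set.toFinite _
  intro c
  have := Set.ext_iff.1 key c
  simpa using this

/-- In the complement of `Γ(z)` the neighbours of `z` that are not twins of `z` form a single
component, as there is no induced quadrangle. -/
theorem ncard_commonNeighbors_eq_of_not_twin (h : G.IsCliqueRegular k m) {z y₁ y₂ : V}
    (h₁ : G.Adj z y₁) (h₂ : G.Adj z y₂) (t₁ : ¬G.Twin z y₁) (t₂ : ¬G.Twin z y₂) :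
    (G.commonNeighbors z y₁).ncard = (G.commonNeighbors z y₂).ncard := by
  obtain ⟨a₁, ha₁, hne₁, hn₁⟩ := h.exists_not_adj_of_adj h₁ t₁
  obtain ⟨a₂, ha₂, hne₂, hn₂⟩ := h.exists_not_adj_of_adj h₂ t₂
  have key : ∀ a c, G.Adj z a → G.Adj z c → ¬G.Adj a c →
      (G.commonNeighbors z a).ncard = (G.commonNeighbors z c).ncard := by
    intro a c ha hc hac
    by_cases e : a = c
    · rw [e]
    · rw [G.commonNeighbors_symm z a, G.commonNeighbors_symm z c]
      exact h.ncard_commonNeighbors_eq e hac ha.symm hc.symm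
  by_cases c1 : G.Adj y₁ y₂
  · by_cases c2 : G.Adj y₁ a₂
    · by_cases c3 : G.Adj a₁ y₂
      · by_cases c4 : G.Adj a₁ a₂
        · exact absurd (h.isClique y₁ a₁ hne₁.symm hn₁ ⟨c1, c3⟩ ⟨c2, c4⟩ hne₂.symm) hn₂
        · rw [key _ _ h₁ ha₁ hn₁, key _ _ ha₁ ha₂ c4, key _ _ h₂ ha₂ hn₂]
      · rw [key _ _ h₁ ha₁ hn₁, key _ _ ha₁ h₂ c3]
    · rw [key _ _ h₁ ha₂ c2, key _ _ h₂ ha₂ hn₂]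
  · exact key _ _ h₁ h₂ c1

theorem exists_ncard_commonNeighbors (h : G.IsCliqueRegular k m) :
    ∃ L, ∀ z y, G.Adj z y → ¬G.Twin z y → (G.commonNeighbors z y).ncard = L := by
  have key : ∀ z y z' y', G.Adj z y → ¬G.Twin z y → G.Adj z' y' → ¬G.Twin z' y' →
      (G.commonNeighbors z y).ncard = (G.commonNeighbors z' y').ncard := by
    intro z y z' y' h1 t1 h2 t2
    by_cases ht : G.Twin z z'
    · by_cases hzz : z = z'
      · subst hzz
        exact h.ncard_commonNeighbors_eq_of_not_twin h1 h2 t1 t2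
      · have hy : y ≠ z' := by rintro rfl; exact t1 ht
        have h3 := ht.adj_right h1 hy
        have t3 : ¬G.Twin z' y := fun t => t1 (ht.trans t)
        rw [G.commonNeighbors_symm z y,
          h.ncard_commonNeighbors_eq_of_not_twin h1.symm h3.symm (fun t => t1 t.symm)
            (fun t => t3 t.symm), G.commonNeighbors_symm y z']
        exact h.ncard_commonNeighbors_eq_of_not_twin h3 h2 t3 t2
    · by_cases hzz : G.Adj z z'
      · rw [h.ncard_commonNeighbors_eq_of_not_twin h1 hzz t1 ht, G.commonNeighbors_symm z z']
        exact h.ncard_commonNeighbors_eq_of_not_twin hzz.symm h2 (fun t => ht t.symm) t2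
      · have hne : z ≠ z' := by rintro rfl; exact ht (Twin.refl _ _)
        obtain ⟨w, hw, hw'⟩ := h.exists_mem_commonNeighbors hne hzz
        have tw : ¬G.Twin z w := fun t => hzz (t.symm.adj_right hw'.symm hne.symm)
        have tw' : ¬G.Twin z' w := fun t => hzz (t.symm.adj_right hw.symm hne).symm
        rw [h.ncard_commonNeighbors_eq_of_not_twin h1 hw t1 tw, G.commonNeighbors_symm z w,
          h.ncard_commonNeighbors_eq_of_not_twin hw.symm hw'.symm (fun t => tw t.symm)
            (fun t => tw' t.symm), G.commonNeighbors_symm w z']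
        exact h.ncard_commonNeighbors_eq_of_not_twin hw' h2 tw' t2
  by_cases hex : ∃ z y, G.Adj z y ∧ ¬G.Twin z y
  · obtain ⟨z, y, h1, h2⟩ := hex
    exact ⟨_, fun z' y' h3 h4 => key z' y' z y h3 h4 h1 h2⟩
  · push Not at hex
    exact ⟨0, fun z y h1 h2 => absurd (hex z y h1) h2⟩

end SimpleGraph.IsCliqueRegular

namespace SimpleGraph.IsCliqueRegular

/-- All twin classes have the same size. Count the pairs of a neighbour `y` of `z` that is not a
twin of `z` and a non-neighbour of `z` adjacent to `y`. -/
theorem exists_ncard_twin {V : Type*} [Finite V] {G : SimpleGraph V} {k m : ℕ}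
    (h : G.IsCliqueRegular k m) : ∃ s, ∀ z, {y | G.Twin z y}.ncard = s := by
  classical
  have := Fintype.ofFinite V
  obtain ⟨L, hL⟩ := h.exists_ncard_commonNeighbors
  have hdeg : ∀ z, (Finset.univ.filter fun y => G.Adj z y).card = k := by
    intro z
    rw [← h.ncard_neighborSet z, ← Set.ncard_setOf_eq]; rfl
  have hfar : ∀ z, (Finset.univ.filter fun w => w ≠ z ∧ ¬G.Adj z w).card + (k + 1)
      = Fintype.card V := by
    intro z
    have h1 : (Finset.univ.filter fun w => ¬(w ≠ z ∧ ¬G.Adj z w)).card = k + 1 := by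
      rw [← hdeg z, ← Finset.card_insert_of_notMem (a := z)]
      · congr 1; ext w; simp only [Finset.mem_filter, Finset.mem_univ, true_and,
          Finset.mem_insert]; tauto
      · simp
    rw [← h1, Finset.card_filter_add_card_filter_not, Finset.card_univ]
  have htwin : ∀ z, (Finset.univ.filter fun y => G.Adj z y ∧ ¬G.Twin z y).card +
      {y | G.Twin z y}.ncard = k + 1 := by
    intro z
    have h1 : (Finset.univ.filter fun y => y = z ∨ G.Adj z y).card = k + 1 := by
      rw [← hdeg z, ← Finset.card_insert_of_notMem (a := z)]
      · congr 1; ext w; simp only [Finset.mem_filter, Finset.mem_univ, true_and,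
          Finset.mem_insert]
      · simp
    rw [← h1, Set.ncard_setOf_eq fun y => G.Twin z y, ← Finset.card_union_of_disjoint]
    · congr 1
      ext y
      simp only [Finset.mem_filter, Finset.mem_univ, true_and, Finset.mem_union]
      constructor
      · rintro (⟨h1, -⟩ | h1)
        · exact Or.inr h1
        · by_cases e : y = z
          · exact Or.inl e
          · exact Or.inr (h1.adj (Ne.symm e))
      · rintro (rfl | h1)
        · exact Or.inr (Twin.refl _ _)
        · by_cases t : G.Twin z y
          · exact Or.inr t
          · exact Or.inl ⟨h1, t⟩
    · rw [Finset.disjoint_left]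
      intro y hy hy'
      simp only [Finset.mem_filter, Finset.mem_univ, true_and] at hy hy'
      exact hy.2 hy'
  have hcount : ∀ z, (Finset.univ.filter fun y => G.Adj z y ∧ ¬G.Twin z y).card * (k - 1 - L) =
      (Finset.univ.filter fun w => w ≠ z ∧ ¬G.Adj z w).card * m := by
    intro z
    apply Finset.card_mul_eq_card_mul G.Adj
    · intro y hy
      simp only [Finset.mem_filter, Finset.mem_univ, true_and] at hy
      rw [Finset.bipartiteAbove, Finset.filter_filter]
      have h1 := hL z y hy.1 hy.2
      have h2 : (G.commonNeighbors z y).ncard =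
        (Finset.univ.filter fun w => G.Adj z w ∧ G.Adj y w).card :=
        Set.ncard_setOf_eq fun w => G.Adj z w ∧ G.Adj y w
      have h3 : (Finset.univ.filter fun w => G.Adj y w) =
          insert z ((Finset.univ.filter fun w => G.Adj z w ∧ G.Adj y w) ∪
          (Finset.univ.filter fun w => (w ≠ z ∧ ¬G.Adj z w) ∧ G.Adj y w)) := by
        ext w
        simp only [Finset.mem_filter, Finset.mem_univ, true_and, Finset.mem_insert,
          Finset.mem_union]
        constructor
        · intro h; tauto
        · rintro (rfl | h | h)
          · exact hy.1.symm
          · exact h.2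
          · exact h.2
      have h4 := hdeg y
      rw [h3, Finset.card_insert_of_notMem, Finset.card_union_of_disjoint] at h4
      · omega
      · rw [Finset.disjoint_left]
        intro w hw hw'
        simp only [Finset.mem_filter, Finset.mem_univ, true_and] at hw hw'
        exact hw'.1.2 hw.1
      · simp
    · intro w hw
      simp only [Finset.mem_filter, Finset.mem_univ, true_and] at hw
      rw [← h.ncard_of_not_adj z w hw.1.symm hw.2, Finset.bipartiteBelow, Finset.filter_filter,
        ← Set.ncard_setOf_eq]
      congr 1
      ext y
      simp only [Set.mem_ofPred_eq, mem_commonNeighbors]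
      constructor
      · exact fun h => ⟨h.1.1, h.2.symm⟩
      · intro h
        exact ⟨⟨h.1, fun t => hw.2 (t.symm.adj_right h.2.symm hw.1)⟩, h.2.symm⟩
  obtain ⟨a, c, hac, hn⟩ := h.exists_not_adj
  have hpos : 0 < (Finset.univ.filter fun w => w ≠ a ∧ ¬G.Adj a w).card :=
    Finset.card_pos.2 ⟨c, by simp [hac.symm, hn]⟩
  refine ⟨{y | G.Twin a y}.ncard, fun z => ?_⟩
  have h1 := hcount a
  have h2 := hcount z
  have h3 := hfar a
  have h4 := hfar z
  have h5 := htwin a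
  have h6 := htwin z
  have h7 : (Finset.univ.filter fun w => w ≠ a ∧ ¬G.Adj a w).card =
    (Finset.univ.filter fun w => w ≠ z ∧ ¬G.Adj z w).card := by omega
  have h8 : k - 1 - L ≠ 0 := by
    intro h0
    rw [h0, mul_zero] at h1
    have := h.pos
    have := Nat.mul_pos hpos this
    omega
  rw [← h7, ← h1] at h2
  have h9 := Nat.eq_of_mul_eq_mul_right (Nat.pos_of_ne_zero h8) h2
  omega

/-- The twin relation as a setoid. -/
def _root_.SimpleGraph.twinSetoid {V : Type*} (G : SimpleGraph V) : Setoid V :=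
  ⟨G.Twin, Twin.refl G, Twin.symm, Twin.trans⟩

/-- A graph all of whose `μ`-graphs are cliques of the same positive size is a clique extension of
a strongly regular Terwilliger graph `H`, the quotient by the twin relation: each vertex of `H` is
replaced by a clique of size `s`. -/
theorem exists_quotient {V : Type u} [Finite V] {G : SimpleGraph V} {k m : ℕ}
    (h : G.IsCliqueRegular k m) : ∃ (W : Type u) (_ : Finite W) (H : SimpleGraph W) (π : V → W)
      (s n' k' l' m' : ℕ), 0 < s ∧ H.IsTerwilligerSRG n' k' l' m' ∧ Function.Surjective π ∧
      (∀ w, (π ⁻¹' {w}).ncard = s) ∧ (∀ a b, H.Adj (π a) (π b) ↔ G.Adj a b ∧ π a ≠ π b) ∧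
      (∀ a b, π a = π b ↔ G.Twin a b) ∧
      Nat.card V = s * n' ∧ k + 1 = s * (k' + 1) ∧ m = s * m' := by
  classical
  obtain ⟨s, hs⟩ := h.exists_ncard_twin
  obtain ⟨L, hL⟩ := h.exists_ncard_commonNeighbors
  let W := Quotient G.twinSetoid
  let π : V → W := Quotient.mk _
  have hπ : ∀ a b, π a = π b ↔ G.Twin a b := fun a b => Quotient.eq (r := G.twinSetoid)
  have hsurj : Function.Surjective π := Quotient.mk_surjective
  have hadj : ∀ a a' b b', π a = π a' → π b = π b' → π a ≠ π b → G.Adj a b → G.Adj a' b' := by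
    intro a a' b b' ha hb hne hab
    have e1 : G.Adj a' b := by
      refine ((hπ _ _).1 ha).adj_right hab ?_
      rintro rfl; exact hne ha
    refine (((hπ _ _).1 hb).adj_right e1.symm ?_).symm
    rintro rfl; exact hne (ha.trans hb.symm)
  let H : SimpleGraph W :=
    { Adj := fun w w' => w ≠ w' ∧ ∃ a b, π a = w ∧ π b = w' ∧ G.Adj a b
      symm := ⟨fun w w' ⟨hne, a, b, ha, hb, hab⟩ => ⟨hne.symm, b, a, hb, ha, hab.symm⟩⟩
      loopless := ⟨fun w hw => hw.1 rfl⟩ }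
  have hH : ∀ a b, H.Adj (π a) (π b) ↔ G.Adj a b ∧ π a ≠ π b := by
    intro a b
    constructor
    · rintro ⟨hne, a', b', ha, hb, hab⟩
      exact ⟨hadj a' a b' b ha hb (by rw [ha, hb]; exact hne) hab, hne⟩
    · rintro ⟨hab, hne⟩
      exact ⟨hne, a, b, rfl, rfl, hab⟩
  have hfin : Finite W := Quotient.finite _
  have hfib : ∀ w, (π ⁻¹' {w}).ncard = s := by
    intro w
    obtain ⟨z, rfl⟩ := hsurj w
    rw [← hs z]
    congr 1
    ext y
    simp only [Set.mem_preimage, Set.mem_singleton_iff, Set.mem_ofPred_eq]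
    rw [eq_comm, hπ]
  have hpre := Set.ncard_preimage_eq_mul hfib
  obtain ⟨a₀, c₀, hac₀, hn₀⟩ := h.exists_not_adj
  have hspos : 0 < s := by
    rw [← hs a₀]
    exact (Set.ncard_pos (Set.toFinite _)).2 ⟨a₀, Twin.refl _ _⟩
  -- Valencies: `Γ(a)` consists of the other twins of `a` and the preimage of the neighbours.
  have hdeg : ∀ a, s * (H.neighborSet (π a)).ncard + s = k + 1 := by
    intro a
    rw [← hpre, ← h.ncard_neighborSet a, ← hfib (π a), ← Set.ncard_insert_of_notMem (a := a) (by simp),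
      ← Set.ncard_union_eq]
    · congr 1
      ext y
      simp only [Set.mem_union, Set.mem_preimage, mem_neighborSet, Set.mem_singleton_iff,
        Set.mem_insert_iff, hH]
      constructor
      · rintro (⟨h1, -⟩ | h1)
        · exact Or.inr h1
        · by_cases e : y = a
          · exact Or.inl e
          · exact Or.inr (((hπ _ _).1 h1).adj e).symm
      · rintro (rfl | h1)
        · exact Or.inr rfl
        · by_cases e : π y = π a
          · exact Or.inr e
          · exact Or.inl ⟨h1, Ne.symm e⟩
    · rw [Set.disjoint_left]
      intro y hy hy'
      simp only [Set.mem_preimage, mem_neighborSet, hH] at hy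
      exact hy.2 hy'.symm
  have hlam : ∀ a b, G.Adj a b → π a ≠ π b →
      s * (H.commonNeighbors (π a) (π b)).ncard + (2 * s) = L + 2 := by
    intro a b hab hne
    have e1 : ((insert a (insert b (G.commonNeighbors a b)) : Set V)).ncard = L + 2 := by
      rw [Set.ncard_insert_of_notMem, Set.ncard_insert_of_notMem, hL a b hab
        (fun t => hne ((hπ _ _).2 t))]
      · simp [mem_commonNeighbors]
      · simp [mem_commonNeighbors, hab.ne]
    rw [← e1, ← hpre, two_mul]
    nth_rewrite 1 [← hfib (π a)]
    rw [← hfib (π b), ← Set.ncard_union_eq, ← Set.ncard_union_eq]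
    · congr 1
      ext y
      simp only [Set.mem_union, Set.mem_preimage, mem_commonNeighbors, Set.mem_singleton_iff,
        Set.mem_insert_iff, hH]
      constructor
      · rintro (⟨⟨h1, -⟩, h2, -⟩ | h1 | h1)
        · exact Or.inr (Or.inr ⟨h1, h2⟩)
        · by_cases e : y = a
          · exact Or.inl e
          · refine Or.inr (Or.inr ⟨(((hπ _ _).1 h1).adj e).symm, ?_⟩)
            exact (hadj a y b b h1.symm rfl hne hab).symm
        · by_cases e : y = b
          · exact Or.inr (Or.inl e)
          · refine Or.inr (Or.inr ⟨?_, (((hπ _ _).1 h1).adj e).symm⟩)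
            exact hadj a a b y rfl h1.symm hne hab
      · rintro (rfl | rfl | ⟨h1, h2⟩)
        · exact Or.inr (Or.inl rfl)
        · exact Or.inr (Or.inr rfl)
        · by_cases ea : π y = π a
          · exact Or.inr (Or.inl ea)
          · by_cases eb : π y = π b
            · exact Or.inr (Or.inr eb)
            · exact Or.inl ⟨⟨h1, Ne.symm ea⟩, h2, Ne.symm eb⟩
    · rw [Set.disjoint_left]
      intro y hy hy'
      simp only [Set.mem_preimage, mem_commonNeighbors, hH] at hy
      rcases hy' with hy' | hy'
      · exact hy.1.2 (Eq.symm hy')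
      · exact hy.2.2 (Eq.symm hy')
    · rw [Set.disjoint_left]
      intro y hy hy'
      exact hne (Eq.trans (Eq.symm hy) hy')
  have hneH : ∀ a b, a ≠ b → ¬G.Adj a b → π a ≠ π b := by
    intro a b hne hn e
    exact hn (((hπ _ _).1 e).adj hne)
  have hmu : ∀ a b, a ≠ b → ¬G.Adj a b →
      π ⁻¹' (H.commonNeighbors (π a) (π b)) = G.commonNeighbors a b := by
    intro a b hne hn
    ext y
    simp only [Set.mem_preimage, mem_commonNeighbors, hH]
    constructor
    · exact fun h => ⟨h.1.1, h.2.1⟩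
    · rintro ⟨h1, h2⟩
      refine ⟨⟨h1, fun e => hn ?_⟩, h2, fun e => hn ?_⟩
      · exact (((hπ _ _).1 e.symm).adj_right h2.symm hne.symm) 
      · exact (((hπ _ _).1 e.symm).adj_right h1.symm hne) |>.symm
  obtain ⟨w₀, hw₀, hw₀'⟩ := h.exists_mem_commonNeighbors hac₀ hn₀
  have hwne : π a₀ ≠ π w₀ := fun e =>
    hn₀ (((hπ _ _).1 e.symm).adj_right hw₀'.symm hac₀.symm)
  refine ⟨W, hfin, H, π, s, Nat.card W, (H.neighborSet (π a₀)).ncard,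
    (H.commonNeighbors (π a₀) (π w₀)).ncard, (H.commonNeighbors (π a₀) (π c₀)).ncard, hspos,
    ⟨⟨?_, ?_, ?_, ?_, ?_⟩, rfl, ?_⟩, hsurj, hfib, hH, hπ, ?_, ?_, ?_⟩
  · intro w
    obtain ⟨a, rfl⟩ := hsurj w
    have h1 := hdeg a
    have h2 := hdeg a₀
    exact Nat.eq_of_mul_eq_mul_left hspos (by omega)
  · intro w w' hne hn
    obtain ⟨a, rfl⟩ := hsurj w
    obtain ⟨b, rfl⟩ := hsurj w'
    have hab : a ≠ b := by rintro rfl; exact hne rfl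
    have hnab : ¬G.Adj a b := fun t => hn ((hH a b).2 ⟨t, hne⟩)
    intro x hx y hy hxy
    obtain ⟨x, rfl⟩ := hsurj x
    obtain ⟨y, rfl⟩ := hsurj y
    rw [← Set.mem_preimage, hmu a b hab hnab] at hx hy
    refine (hH x y).2 ⟨h.isClique a b hab hnab hx hy ?_, hxy⟩
    rintro rfl; exact hxy rfl
  · intro w w' hne hn
    obtain ⟨a, rfl⟩ := hsurj w
    obtain ⟨b, rfl⟩ := hsurj w'
    have hab : a ≠ b := by rintro rfl; exact hne rfl
    have hnab : ¬G.Adj a b := fun t => hn ((hH a b).2 ⟨t, hne⟩)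
    have h1 := hpre (H.commonNeighbors (π a) (π b))
    have h2 := hpre (H.commonNeighbors (π a₀) (π c₀))
    rw [hmu a b hab hnab, h.ncard_of_not_adj a b hab hnab] at h1
    rw [hmu a₀ c₀ hac₀ hn₀, h.ncard_of_not_adj a₀ c₀ hac₀ hn₀] at h2
    exact Nat.eq_of_mul_eq_mul_left hspos (by omega)
  · have h2 := hpre (H.commonNeighbors (π a₀) (π c₀))
    rw [hmu a₀ c₀ hac₀ hn₀, h.ncard_of_not_adj a₀ c₀ hac₀ hn₀] at h2
    have := h.pos
    by_contra h0
    have h0' : (H.commonNeighbors (π a₀) (π c₀)).ncard = 0 := by omega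
    rw [h0'] at h2
    omega
  · intro e
    have h1 : H.Adj (π a₀) (π c₀) := by rw [e]; exact hneH a₀ c₀ hac₀ hn₀
    exact hn₀ ((hH _ _).1 h1).1
  · intro w w' hww
    obtain ⟨a, rfl⟩ := hsurj w
    obtain ⟨b, rfl⟩ := hsurj w'
    obtain ⟨hab, hne⟩ := (hH a b).1 hww
    have h1 := hlam a b hab hne
    have h2 := hlam a₀ w₀ hw₀ hwne
    exact Nat.eq_of_mul_eq_mul_left hspos (by omega)
  · rw [← Set.ncard_univ, ← Set.ncard_univ, ← hpre, Set.preimage_univ]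
  · rw [← hdeg a₀]; ring
  · rw [← hpre, hmu a₀ c₀ hac₀ hn₀, h.ncard_of_not_adj a₀ c₀ hac₀ hn₀]

end SimpleGraph.IsCliqueRegular

/-! ### Local graphs of Terwilliger graphs -/

namespace SimpleGraph

/-- An amply regular Terwilliger graph: valency `k`, any two adjacent vertices have `l` common
neighbours, and any two vertices at distance two have `m` common neighbours, forming a clique. -/
structure IsAmplyTerwilliger {V : Type*} (G : SimpleGraph V) (k l m : ℕ) : Prop where
  ncard_neighborSet : ∀ x, (G.neighborSet x).ncard = k
  ncard_of_adj : ∀ x y, G.Adj x y → (G.commonNeighbors x y).ncard = l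
  isClique : ∀ x y, x ≠ y → ¬G.Adj x y → G.IsClique (G.commonNeighbors x y)
  ncard_of_mem : ∀ x y z, x ≠ y → ¬G.Adj x y → G.Adj x z → G.Adj y z →
    (G.commonNeighbors x y).ncard = m

theorem IsTerwilligerSRG.isAmplyTerwilliger {V : Type*} {G : SimpleGraph V} {n k l m : ℕ}
    (h : G.IsTerwilligerSRG n k l m) : G.IsAmplyTerwilliger k l m :=
  ⟨h.ncard_neighborSet, h.ncard_of_adj, h.isClique, 
    fun x y _ h1 h2 _ _ => h.ncard_of_not_adj x y h1 h2⟩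

namespace IsAmplyTerwilliger

variable {V : Type*} {G : SimpleGraph V} {k l m : ℕ}

theorem ncard_image_val {p : Set V} (S : Set p) : (Subtype.val '' S).ncard = S.ncard :=
  Set.ncard_image_of_injective _ Subtype.val_injective

theorem twin_induce_iff {x : V} {a b : G.neighborSet x} :
    (G.induce (G.neighborSet x)).Twin a b ↔
      ∀ c, G.Adj x c → ((c = a ∨ G.Adj a c) ↔ (c = b ∨ G.Adj b c)) := by
  simp only [Twin, Subtype.forall, comap_adj, Function.Embedding.subtype_apply, mem_neighborSet,
    Subtype.ext_iff]

variable [Finite V]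

theorem isCliqueRegular_induce (h : G.IsAmplyTerwilliger k l m) (hm : 2 ≤ m) (hl : l + 1 < k)
    (x : V) : (G.induce (G.neighborSet x)).IsCliqueRegular l (m - 1) where
  ncard_neighborSet := by
    rintro ⟨y, hy⟩
    rw [← h.ncard_of_adj x y hy, ← ncard_image_val]
    congr 1
    ext z
    simp [mem_commonNeighbors, and_comm]
  isClique := by
    rintro ⟨y, hy⟩ ⟨z, hz⟩ hne hn ⟨a, ha⟩ ha' ⟨b, hb⟩ hb' hab
    simp only [mem_commonNeighbors, comap_adj, Function.Embedding.subtype_apply] at ha' hb' hn ⊢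
    exact h.isClique y z (by simpa using hne) hn ha' hb' (by simpa using hab)
  ncard_of_not_adj := by
    rintro ⟨y, hy⟩ ⟨z, hz⟩ hne hn
    have hne' : y ≠ z := by simpa using hne
    have hn' : ¬G.Adj y z := by simpa using hn
    have hx : x ∈ G.commonNeighbors y z := ⟨Adj.symm hy, Adj.symm hz⟩
    rw [← h.ncard_of_mem y z x hne' hn' hx.1 hx.2, ← ncard_image_val,
      ← Set.ncard_sdiff_singleton_of_mem hx]
    congr 1
    ext a
    simp only [Set.mem_image, mem_commonNeighbors, comap_adj, Function.Embedding.subtype_apply,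
      Subtype.exists, exists_and_right, exists_eq_right, Set.mem_sdiff, Set.mem_singleton_iff,
      mem_neighborSet]
    constructor
    · rintro ⟨⟨ha, h1⟩, h2⟩
      exact ⟨⟨h1, h2⟩, ha.ne'⟩
    · rintro ⟨⟨h1, h2⟩, ha⟩
      have hxa := h.isClique y z hne' hn' hx ⟨h1, h2⟩ (Ne.symm ha)
      exact ⟨⟨hxa, h1⟩, h2⟩
  pos := by omega
  ne_top := by
    intro e
    have h1 : (G.neighborSet x).Nonempty := by
      rw [← Set.ncard_pos, h.ncard_neighborSet]; omega
    obtain ⟨y, hy⟩ := h1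
    have h2 : G.commonNeighbors x y = G.neighborSet x \ {y} := by
      ext z
      simp only [mem_commonNeighbors, Set.mem_sdiff, mem_neighborSet, Set.mem_singleton_iff]
      refine and_congr_right fun hz => ⟨fun h => h.ne', fun hne => ?_⟩
      have : (G.induce (G.neighborSet x)).Adj ⟨y, hy⟩ ⟨z, hz⟩ := by
        rw [e]; exact fun e' => hne (congrArg Subtype.val e').symm
      simpa using this
    have h3 := h.ncard_of_adj x y hy
    rw [h2, Set.ncard_sdiff_singleton_of_mem hy, h.ncard_neighborSet] at h3
    omega

/-- Being twins in the local graph is symmetric in the three vertices of the triangle: if `a` and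
`b` are twins in `Γ(x)`, then `x` and `b` are twins in `Γ(a)`. Both mean that the triangle has the
largest possible number `l - 1` of common neighbours. -/
theorem twin_rotate (h : G.IsAmplyTerwilliger k l m) {x a b : V} (ha : G.Adj x a) (hb : G.Adj x b)
    (hab : a ≠ b) (ht : (G.induce (G.neighborSet x)).Twin ⟨a, ha⟩ ⟨b, hb⟩) :
    ∃ (h1 : G.Adj a x) (h2 : G.Adj a b), (G.induce (G.neighborSet a)).Twin ⟨x, h1⟩ ⟨b, h2⟩ := by
  have hadj : G.Adj a b := by
    simpa using ht.adj fun e => hab (congrArg Subtype.val e)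
  refine ⟨ha.symm, hadj, ?_⟩
  rw [twin_induce_iff] at ht ⊢
  have key : insert x (G.commonNeighbors a x) = insert b (G.commonNeighbors a b) := by
    apply Set.eq_of_subset_of_ncard_le
    · rintro c (rfl | ⟨h1, h2⟩)
      · exact Or.inr ⟨ha.symm, hb.symm⟩
      · rcases (ht c h2).1 (Or.inr h1) with h3 | h3
        · exact Or.inl h3
        · exact Or.inr ⟨h1, h3⟩
    · rw [Set.ncard_insert_of_notMem, Set.ncard_insert_of_notMem, h.ncard_of_adj _ _ ha.symm,
        h.ncard_of_adj _ _ hadj]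
      · simp [mem_commonNeighbors]
      · simp [mem_commonNeighbors]
    · exact Set.toFinite _
  intro c hc
  have := Set.ext_iff.1 key c
  simpa [mem_commonNeighbors, hc] using this

/-- If some local graph is the `s`-clique extension of a triangle-free graph with an edge, then
`s = 1`. Otherwise take adjacent `z`, `w` in `Γ(x)` that are not twins and a twin `w'` of `w` in
`Γ(z)`. Then `w'` is a common neighbour of `x`, `z`, `w`, hence in `Γ(x)` a twin of `z` or of `w`;
by the symmetry of triangles `z` and `w` would be twins in `Γ(x)`. -/
theorem eq_one_of_triangleFree (h : G.IsAmplyTerwilliger k l m) (hm : 2 ≤ m) (hl : l + 1 < k)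
    {x : V} {W : Type*} [Finite W] {H : SimpleGraph W} {π : G.neighborSet x → W} {s : ℕ}
    (hsurj : Function.Surjective π) (hfib : ∀ w, (π ⁻¹' {w}).ncard = s)
    (hH : ∀ a b, H.Adj (π a) (π b) ↔ (G.induce (G.neighborSet x)).Adj a b ∧ π a ≠ π b)
    (hπ : ∀ a b, π a = π b ↔ (G.induce (G.neighborSet x)).Twin a b)
    (hfree : ∀ u v w, H.Adj u v → H.Adj u w → H.Adj v w → False) (hedge : ∃ u v, H.Adj u v) :
    s = 1 := by
  by_contra hs1
  obtain ⟨u, v, huv⟩ := hedge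
  obtain ⟨⟨z, hz⟩, rfl⟩ := hsurj u
  obtain ⟨⟨w, hw⟩, rfl⟩ := hsurj v
  obtain ⟨hzw, hne⟩ := (hH _ _).1 huv
  have hzw' : G.Adj z w := by simpa using hzw
  have hnt : ¬(G.induce (G.neighborSet x)).Twin ⟨z, hz⟩ ⟨w, hw⟩ := fun t => hne ((hπ _ _).2 t)
  -- The vertex `z` has a second twin in `Γ(x)`, so all twin classes of `Γ(z)` are non-trivial.
  obtain ⟨⟨z', hz'⟩, hzz', hzne⟩ : ∃ z', π z' = π ⟨z, hz⟩ ∧ z' ≠ ⟨z, hz⟩ := by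
    by_contra! hc
    have h1 : π ⁻¹' {π ⟨z, hz⟩} = {⟨z, hz⟩} := by
      ext y
      simp only [Set.mem_preimage, Set.mem_singleton_iff]
      exact ⟨hc y, fun e => by rw [e]⟩
    have h2 := hfib (π ⟨z, hz⟩)
    rw [h1, Set.ncard_singleton] at h2
    exact hs1 h2.symm
  have hzne' : z ≠ z' := by rintro rfl; exact hzne rfl
  obtain ⟨hzx, hzz, t1⟩ := h.twin_rotate hz hz' hzne' ((hπ _ _).1 hzz'.symm)
  obtain ⟨s', hs'⟩ := (h.isCliqueRegular_induce hm hl z).exists_ncard_twin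
  have h2 : 1 < s' := by
    rw [← hs' ⟨x, hzx⟩, Set.one_lt_ncard_iff]
    exact ⟨⟨x, hzx⟩, ⟨z', hzz⟩, Twin.refl _ _, t1, fun e => hz'.ne (congrArg Subtype.val e)⟩
  obtain ⟨⟨w', hw'⟩, ht', hne'⟩ : ∃ w', (G.induce (G.neighborSet z)).Twin ⟨w, hzw'⟩ w' ∧
      w' ≠ ⟨w, hzw'⟩ := by
    have := hs' ⟨w, hzw'⟩
    rw [← this, Set.one_lt_ncard_iff] at h2
    obtain ⟨a, b, ha, hb, hab⟩ := h2
    by_cases e : a = ⟨w, hzw'⟩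
    · exact ⟨b, hb, fun e' => hab (e.trans e'.symm)⟩
    · exact ⟨a, ha, e⟩
  have hww : w ≠ w' := by rintro rfl; exact hne' rfl
  -- `x` and `w` are not twins in `Γ(z)`.
  have hnt2 : ¬(G.induce (G.neighborSet z)).Twin ⟨x, hzx⟩ ⟨w, hzw'⟩ := by
    intro t
    obtain ⟨h3, h4, t3⟩ := h.twin_rotate hzx hzw' hw.ne t
    exact hnt t3
  have hxw' : G.Adj x w' := by
    have h3 : (⟨x, hzx⟩ : G.neighborSet z) ≠ ⟨w', hw'⟩ := by
      intro e
      exact hnt2 (e ▸ ht'.symm)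
    have h4 := ht'.adj_right (c := ⟨x, hzx⟩) (by simpa using hw.symm) h3
    simpa using h4.symm
  have hww' : G.Adj w w' := by
    simpa using ht'.adj fun e => hww (congrArg Subtype.val e)
  -- In `Γ(x)` the vertex `w'` is a twin of `z` or of `w`.
  have hcase : π ⟨w', hxw'⟩ = π ⟨z, hz⟩ ∨ π ⟨w', hxw'⟩ = π ⟨w, hw⟩ := by
    by_contra! hc
    refine hfree _ _ _ huv ((hH ⟨z, hz⟩ ⟨w', hxw'⟩).2 ⟨?_, hc.1.symm⟩)
      ((hH ⟨w, hw⟩ ⟨w', hxw'⟩).2 ⟨?_, hc.2.symm⟩)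
    · simpa using hw'
    · simpa using hww'
  rcases hcase with e | e
  · have t := (hπ _ _).1 e
    obtain ⟨h3, h4, t3⟩ := h.twin_rotate hz hxw' hw'.ne t.symm
    exact hnt2 (t3.trans ht'.symm)
  · have t := (hπ _ _).1 e
    obtain ⟨h3, h4, t3⟩ := h.twin_rotate hw hxw' hww t.symm
    obtain ⟨h5, h6, t4⟩ := h.twin_rotate hzw' hw' hww ht'
    have t5 := t3.trans t4.symm
    obtain ⟨h7, h8, t6⟩ := h.twin_rotate h3 h5 hz.ne t5
    exact hnt ((t6.symm))

end IsAmplyTerwilliger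

end SimpleGraph

/-! ### Parameters of strongly regular Terwilliger graphs -/

/-- These numbers lie strictly between consecutive squares. -/
theorem not_isSquare_of_between (w : ℕ) (hw : w = 6480 ∨ w = 11616 ∨ w = 46080) :
    ¬IsSquare w := by
  rintro ⟨z, rfl⟩
  rcases hw with h | h | h
  · rcases Nat.lt_or_ge z 81 with h' | h' <;> nlinarith
  · rcases Nat.lt_or_ge z 108 with h' | h' <;> nlinarith
  · rcases Nat.lt_or_ge z 215 with h' | h' <;> nlinarith

namespace SimpleGraph.IsTerwilligerSRG

section Basic

variable {V : Type*} {G : SimpleGraph V} {n k l m : ℕ}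

theorem isSRGWith [Fintype V] [DecidableRel G.Adj] (h : G.IsTerwilligerSRG n k l m) :
    G.IsSRGWith n k l m where
  card := by rw [← h.card, Nat.card_eq_fintype_card]
  regular := fun x => by
    rw [← h.ncard_neighborSet x, ← G.card_neighborSet_eq_degree, ← Nat.card_coe_set_eq,
      Nat.card_eq_fintype_card]
  of_adj := fun x y hxy => by
    rw [← h.ncard_of_adj x y hxy, ← Nat.card_coe_set_eq, Nat.card_eq_fintype_card]
  of_not_adj := fun x y hne hn => by
    rw [← h.ncard_of_not_adj x y hne hn, ← Nat.card_coe_set_eq, Nat.card_eq_fintype_card]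

theorem eq_of_mem (h : G.IsTerwilligerSRG n k l 1) {x y p q : V} (hxy : x ≠ y)
    (hn : ¬G.Adj x y) (h1 : G.Adj x p) (h2 : G.Adj y p) (h3 : G.Adj x q) (h4 : G.Adj y q) :
    p = q := by
  obtain ⟨w, hw⟩ := Set.ncard_eq_one.1 (h.ncard_of_not_adj x y hxy hn)
  have e1 : p ∈ G.commonNeighbors x y := ⟨h1, h2⟩
  have e2 : q ∈ G.commonNeighbors x y := ⟨h3, h4⟩
  rw [hw] at e1 e2
  exact e1.trans e2.symm

variable [Finite V]

theorem succ_lt (h : G.IsTerwilligerSRG n k l m) : l + 1 < k := by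
  obtain ⟨a, c, hac, hn⟩ := h.exists_not_adj
  obtain ⟨w, hwa, hwc⟩ := h.exists_mem_commonNeighbors hac hn
  have h1 : insert a (insert c (G.commonNeighbors w a)) ⊆ G.neighborSet w := by
    rintro y (rfl | rfl | hy)
    · exact hwa.symm
    · exact hwc.symm
    · exact hy.1
  have h2 := Set.ncard_le_ncard h1 (Set.toFinite _)
  rw [Set.ncard_insert_of_notMem, Set.ncard_insert_of_notMem, h.ncard_of_adj w a hwa.symm,
    h.ncard_neighborSet] at h2
  · omega
  · simp [mem_commonNeighbors, hn]
  · simp [mem_commonNeighbors, hac]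

theorem param_eq (h : G.IsTerwilligerSRG n k l m) :
    k * (k - l - 1) = (n - k - 1) * m := by
  classical
  have := Fintype.ofFinite V
  obtain ⟨a, -⟩ := h.exists_not_adj
  refine SimpleGraph.IsSRGWith.param_eq G h.isSRGWith ?_
  rw [← h.card]
  have : Nonempty V := ⟨a⟩
  exact Nat.card_pos

theorem succ_lt_card (h : G.IsTerwilligerSRG n k l m) : k + 1 < n := by
  have h1 := h.param_eq
  have h2 := h.succ_lt
  have h3 : 0 < k * (k - l - 1) := Nat.mul_pos (by omega) (by omega)
  by_contra h4
  have h5 : n - k - 1 = 0 := by omega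
  rw [h5, zero_mul] at h1
  omega

theorem exists_sq_mul_discr (h : G.IsTerwilligerSRG n k l m)
    (hD : 0 < ((l : ℤ) - m) ^ 2 + 4 * (k - m)) :
    ∃ z : ℕ, ((z * z : ℕ) : ℤ) * (((l : ℤ) - m) ^ 2 + 4 * (k - m))
      = (2 * k + (n - 1) * (l - m)) ^ 2 := by
  classical
  have := Fintype.ofFinite V
  obtain ⟨z, hz⟩ := h.isSRGWith.exists_sq_mul_discr (by have := h.succ_lt_card; omega) hD
  refine ⟨z.natAbs, ?_⟩
  rw [← hz]
  push_cast
  rw [abs_mul_abs_self, ← sq]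

theorem exists_adj_not_adj (h : G.IsTerwilligerSRG n k l m) {a b : V} (hab : G.Adj a b) :
    ∃ z, G.Adj a z ∧ z ≠ b ∧ ¬G.Adj b z := by
  by_contra! hc
  have h1 : G.neighborSet a ⊆ insert b (G.commonNeighbors a b) := by
    intro z hz
    by_cases e : z = b
    · exact Or.inl e
    · exact Or.inr ⟨hz, hc z hz e⟩
  have h2 := Set.ncard_le_ncard h1 (Set.toFinite _)
  have h3 := Set.ncard_insert_le b (G.commonNeighbors a b)
  rw [h.ncard_neighborSet] at h2
  rw [h.ncard_of_adj a b hab] at h3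
  have := h.succ_lt
  omega

/-- If `m = 1` the graph is the collinearity graph of a partial linear space with lines of size
`l + 2` and `r` lines on each point. The points of a line and a point `x` at distance two from all
of them: distinct points of the line are joined to `x` by distinct lines on `x`, so `l + 2 ≤ r`. -/
theorem exists_lines (h : G.IsTerwilligerSRG n k l 1) : ∃ r, k = (l + 1) * r ∧ l + 2 ≤ r := by
  classical
  obtain ⟨a, c₀, hac, hn⟩ := h.exists_not_adj
  obtain ⟨b, hab, -⟩ := h.exists_mem_commonNeighbors hac hn
  obtain ⟨z, haz, hzb, hbz⟩ := h.exists_adj_not_adj hab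
  obtain ⟨x, hzx, hxa, hax⟩ := h.exists_adj_not_adj haz.symm
  let L : Set V := insert a (insert b (G.commonNeighbors a b))
  have hL : L.ncard = l + 2 := by
    rw [Set.ncard_insert_of_notMem, Set.ncard_insert_of_notMem, h.ncard_of_adj a b hab]
    · simp [mem_commonNeighbors]
    · simp [mem_commonNeighbors, hab.ne]
  have hclique : ∀ p ∈ L, ∀ q ∈ L, p ≠ q → G.Adj p q := by
    have e : ∀ p ∈ G.commonNeighbors a b, ∀ q ∈ G.commonNeighbors a b, p ≠ q → G.Adj p q := by
      intro p hp q hq hpq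
      by_contra hc
      exact hab.ne (h.eq_of_mem hpq hc hp.1.symm hq.1.symm hp.2.symm hq.2.symm)
    rintro p (rfl | rfl | hp) q (rfl | rfl | hq) hpq
    · exact absurd rfl hpq
    · exact hab
    · exact hq.1
    · exact hab.symm
    · exact absurd rfl hpq
    · exact hq.2
    · exact hp.1.symm
    · exact hp.2.symm
    · exact e p hp q hq hpq
  have hxL : ∀ p ∈ L, p ≠ x ∧ ¬G.Adj x p := by
    intro p hp
    by_cases e : p = a
    · exact ⟨fun e' => hxa (e' ▸ e), fun h' => hax (e ▸ h').symm⟩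
    · have hap := hclique a (Or.inl rfl) p hp (Ne.symm e)
      refine ⟨?_, fun hxp => ?_⟩
      · rintro rfl; exact hax hap
      · have e1 : z = p := h.eq_of_mem hxa (fun h' => hax h'.symm) hzx.symm haz hxp hap
        rcases hp with hp | hp | hp
        · exact e hp
        · exact hzb (e1.trans hp)
        · exact hbz (e1 ▸ hp.2)
  have hline : ∀ p ∈ L, ∀ p' ∈ L, p ≠ p' → ∀ q, G.Adj q p → G.Adj q p' → q ∈ L := by
    intro p hp p' hp' hpp q h1 h2
    have key : ∀ t ∈ L, q = t ∨ G.Adj q t := by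
      intro t ht
      by_cases hpt : p = t
      · exact Or.inr (hpt ▸ h1)
      by_cases hpt' : p' = t
      · exact Or.inr (hpt' ▸ h2)
      by_contra! hc
      exact hpp (h.eq_of_mem hc.1 hc.2 h1 (hclique p hp t ht hpt).symm h2
        (hclique p' hp' t ht hpt').symm)
    rcases key a (Or.inl rfl) with e | e
    · exact Or.inl e
    rcases key b (Or.inr (Or.inl rfl)) with e' | e'
    · exact Or.inr (Or.inl e')
    · exact Or.inr (Or.inr ⟨e.symm, e'.symm⟩)
  -- The lines on `x`.
  let R : Setoid (G.neighborSet x) :=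
    { r := fun p q => p = q ∨ G.Adj p q
      iseqv :=
        { refl := fun p => Or.inl rfl
          symm := by
            rintro p q (h | h)
            · exact Or.inl h.symm
            · exact Or.inr h.symm
          trans := by
            rintro ⟨p, hp⟩ ⟨q, hq⟩ ⟨t, ht⟩ (h1 | h1) (h2 | h2)
            · exact Or.inl (h1.trans h2)
            · exact Or.inr (by rw [h1]; exact h2)
            · exact Or.inr (by rw [← h2]; exact h1)
            · by_contra! hc
              exact hq.ne (h.eq_of_mem (fun e => hc.1 (Subtype.ext e)) hc.2 (Adj.symm hp)
                (Adj.symm ht) h1 h2.symm) } }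
  have hR : ∀ p q : G.neighborSet x, (Quotient.mk R p = Quotient.mk R q) ↔
      p = q ∨ G.Adj p.1 q.1 := fun p q => Quotient.eq (r := R)
  have hfib : ∀ w, ((Quotient.mk R) ⁻¹' {w}).ncard = l + 1 := by
    intro w
    obtain ⟨⟨p, hp⟩, rfl⟩ := Quotient.mk_surjective w
    rw [← IsAmplyTerwilliger.ncard_image_val, ← h.ncard_of_adj x p hp,
      ← Set.ncard_insert_of_notMem (a := p) (by simp [mem_commonNeighbors])]
    congr 1
    ext q
    simp only [Set.mem_image, Set.mem_preimage, Set.mem_singleton_iff, hR, Subtype.exists,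
      exists_and_right, exists_eq_right, Set.mem_insert_iff, mem_commonNeighbors]
    constructor
    · rintro ⟨hq, e | e⟩
      · exact Or.inl (congrArg Subtype.val e)
      · exact Or.inr ⟨hq, G.adj_symm e⟩
    · rintro (rfl | ⟨h1, h2⟩)
      · exact ⟨hp, Or.inl rfl⟩
      · exact ⟨h1, Or.inr h2.symm⟩
  have hfinQ : Finite (Quotient R) := Quotient.finite _
  refine ⟨Nat.card (Quotient R), ?_, ?_⟩
  · rw [← Set.ncard_univ, ← Set.ncard_preimage_eq_mul hfib, Set.preimage_univ, Set.ncard_univ,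
      Nat.card_coe_set_eq, h.ncard_neighborSet]
  · have hq : ∀ p : L, ∃ q, G.Adj x q ∧ G.Adj p.1 q := fun p =>
      h.exists_mem_commonNeighbors (hxL p p.2).1.symm (hxL p p.2).2
    choose q hq1 hq2 using hq
    rw [← hL, ← Nat.card_coe_set_eq]
    refine Nat.card_le_card_of_injective (fun p => Quotient.mk R ⟨q p, hq1 p⟩) ?_
    intro p p' e
    by_contra hpp
    have hpp' : p.1 ≠ p'.1 := fun e => hpp (Subtype.ext e)
    have hadj := hclique p p.2 p' p'.2 hpp'
    have hnot : ¬G.Adj (q p) p' := fun h' =>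
      (hxL _ (hline p p.2 p' p'.2 hpp' (q p) (hq2 p).symm h')).2 (hq1 p)
    rcases (hR _ _).1 e with e | e
    · have e' : q p = q p' := congrArg Subtype.val e
      exact hnot (e' ▸ (hq2 p').symm)
    · have e' : G.Adj (q p) (q p') := e
      have hne : q p ≠ p'.1 := fun e => (hxL p' p'.2).2 (e ▸ hq1 p)
      have := h.eq_of_mem hne hnot e' (hq2 p') (hq2 p).symm hadj.symm
      exact (hxL p p.2).2 (this ▸ hq1 p')

theorem card_eq_of_mu_one (h : G.IsTerwilligerSRG n k l 1) : n = 1 + k + k * (k - l - 1) := by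
  have h1 := h.param_eq
  have h2 := h.succ_lt_card
  omega

/-- The parameters in the case `m = 1`. -/
theorem eq_of_mu_one (h : G.IsTerwilligerSRG n k l 1) (hk : k < 7 * (l + 1)) :
    n = 5 ∧ k = 2 ∧ l = 0 ∨ n = 10 ∧ k = 3 ∧ l = 0 := by
  obtain ⟨r, hr, hlr⟩ := h.exists_lines
  have hn := h.card_eq_of_mu_one
  have hr6 : r ≤ 6 := by
    by_contra hc
    have : 7 ≤ r := by omega
    have := Nat.mul_le_mul_left (l + 1) this
    omega
  have hl4 : l ≤ 4 := by omega
  have hD : 0 < ((l : ℤ) - (1 : ℕ)) ^ 2 + 4 * (k - (1 : ℕ)) := by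
    have h1 : 2 ≤ k := by have := h.succ_lt; omega
    have h2 : (2 : ℤ) ≤ k := by exact_mod_cast h1
    push_cast
    nlinarith [sq_nonneg ((l : ℤ) - 1)]
  obtain ⟨z, hz⟩ := h.exists_sq_mul_discr hD
  have hsq : IsSquare (z * z) := ⟨z, rfl⟩
  generalize z * z = w at hz hsq
  have hr2 : 2 ≤ r := by omega
  clear hD h
  interval_cases r <;> interval_cases l <;> first | omega | skip
  all_goals
    subst hr
    norm_num at hn
    subst hn
    norm_num at hz
    first
    | omega
    | (norm_num; done)
    | (have hw : w = 6480 ∨ w = 11616 ∨ w = 46080 := by omega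
       exact absurd hsq (not_isSquare_of_between w hw))

end Basic

end SimpleGraph.IsTerwilligerSRG

namespace SimpleGraph

/-- The local graph at `x` is the `t`-clique extension of a strongly regular Terwilliger graph. If
the latter is triangle-free then `t = 1`, so the local graph is triangle-free too. -/
theorem IsAmplyTerwilliger.exists_local_quotient {V : Type u} [Finite V] {G : SimpleGraph V}
    {k l m : ℕ} (h : G.IsAmplyTerwilliger k l m) (hm : 2 ≤ m) (hl : l + 1 < k) (x : V) :
    ∃ t n' k' l' m', 0 < t ∧
      (∃ (W : Type u) (_ : Finite W) (H : SimpleGraph W), H.IsTerwilligerSRG n' k' l' m') ∧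
      k = t * n' ∧ l + 1 = t * (k' + 1) ∧ m - 1 = t * m' ∧
      (l' = 0 → t = 1 ∧ ∀ a b c, G.Adj x a → G.Adj x b → G.Adj x c → G.Adj a b → G.Adj a c →
        G.Adj b c → False) := by
  obtain ⟨W, hW, H, π, t, n', k', l', m', ht, hT, hsurj, hfib, hH, hπ, e1, e2, e3⟩ :=
    (h.isCliqueRegular_induce hm hl x).exists_quotient
  have e1' : k = t * n' := by rw [← e1, Nat.card_coe_set_eq, h.ncard_neighborSet]
  refine ⟨t, n', k', l', m', ht, ⟨W, hW, H, hT⟩, e1', e2, e3, ?_⟩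
  rintro rfl
  have hfree : ∀ u v w, H.Adj u v → H.Adj u w → H.Adj v w → False := by
    intro u v w h1 h2 h3
    have h4 := hT.ncard_of_adj u v h1
    rw [Set.ncard_eq_zero (Set.toFinite _)] at h4
    have h5 : w ∈ H.commonNeighbors u v := ⟨h2, h3⟩
    rw [h4] at h5
    exact h5
  have hedge : ∃ u v, H.Adj u v := by
    obtain ⟨a, c, hac, hn⟩ := hT.exists_not_adj
    obtain ⟨w, hw, -⟩ := hT.exists_mem_commonNeighbors hac hn
    exact ⟨a, w, hw⟩
  have ht1 := h.eq_one_of_triangleFree hm hl hsurj hfib hH hπ hfree hedge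
  refine ⟨ht1, ?_⟩
  have hinj : ∀ a b, π a = π b → a = b := by
    intro a b e
    obtain ⟨c, hc⟩ := Set.ncard_eq_one.1 ((hfib (π b)).trans ht1)
    have h1 : a ∈ π ⁻¹' {π b} := e
    have h2 : b ∈ π ⁻¹' {π b} := rfl
    rw [hc] at h1 h2
    exact Eq.trans h1 (Eq.symm h2)
  intro a b c ha hb hc hab hac hbc
  have key : ∀ p q (hp : G.Adj x p) (hq : G.Adj x q), G.Adj p q → H.Adj (π ⟨p, hp⟩) (π ⟨q, hq⟩) := by
    intro p q hp hq hpq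
    exact (hH _ _).2 ⟨hpq, fun e => hpq.ne (congrArg Subtype.val (hinj _ _ e))⟩
  exact hfree _ _ _ (key a b ha hb hab) (key a c ha hc hac) (key b c hb hc hbc)

namespace IsTerwilligerSRG

/-- Bounds in the case `m ≥ 2`, by induction along local graphs. The small cases, in which the local
graphs are pentagons or Petersen graphs, would give parameters `(11, 5, 2, 2)` and `(41, 10, 3, 2)`,
which are not integral. -/
theorem bounds (m : ℕ) : ∀ {V : Type u} [Finite V] {G : SimpleGraph V} {n k l : ℕ},
    G.IsTerwilligerSRG n k l m → 2 ≤ m → 17 * (m - 1) ≤ k ∧ 12 * (m - 1) + l + 1 ≤ k := by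
  induction m using Nat.strong_induction_on with
  | _ m ih =>
  intro V _ G n k l h hm
  obtain ⟨x, -⟩ := h.exists_not_adj
  obtain ⟨t, n', k', l', m', ht, ⟨W, hW, H, hT⟩, e1, e2, e3, e4⟩ :=
    h.isAmplyTerwilliger.exists_local_quotient hm h.succ_lt x
  have p1 := hT.param_eq
  have p2 := hT.succ_lt
  have p3 := hT.succ_lt_card
  have p4 := hT.pos
  obtain ⟨d, hd⟩ : ∃ d, n' = k' + 1 + d := ⟨n' - k' - 1, by omega⟩
  have hd' : n' - k' - 1 = d := by omega
  rw [hd'] at p1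
  -- It is enough to bound `n'` and the number `d` of non-neighbours in the quotient.
  suffices hs : 17 * m' ≤ n' ∧ 12 * m' ≤ d by
    have s1 := Nat.mul_le_mul_left t hs.1
    have s2 := Nat.mul_le_mul_left t hs.2
    rw [e3]
    have e5 : k = (l + 1) + t * d := by rw [e1, e2, hd]; ring
    constructor
    · rw [e1]; linarith
    · rw [e5]; linarith
  rcases Nat.lt_or_ge m' 2 with hm' | hm'
  · have hm1 : m' = 1 := by omega
    subst hm1
    obtain ⟨r, hr, hlr⟩ := hT.exists_lines
    have hb : k' - l' - 1 = (l' + 1) * (r - 1) := by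
      obtain ⟨r', rfl⟩ : ∃ r', r = r' + 1 := ⟨r - 1, by omega⟩
      rw [hr, Nat.add_sub_cancel, mul_add, mul_one, Nat.sub_sub, Nat.add_sub_cancel]
    have hdd : d = k' * ((l' + 1) * (r - 1)) := by rw [← hb, p1, mul_one]
    by_cases hsmall : l' = 0 ∧ r ≤ 3
    · obtain ⟨rfl, hr3⟩ := hsmall
      obtain ⟨rfl, -⟩ := e4 rfl
      have hm2 : m = 2 := by omega
      subst hm2
      have q1 := h.param_eq
      have q2 := h.succ_lt_card
      exfalso
      have hr2 : r = 2 ∨ r = 3 := by omega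
      rcases hr2 with rfl | rfl
      · norm_num at hr hdd
        subst hr
        have hk : k = 5 := by omega
        have hl : l = 2 := by omega
        subst hk hl
        have hn : n = 11 := by omega
        subst hn
        obtain ⟨z, hz⟩ := h.exists_sq_mul_discr (by norm_num)
        generalize z * z = w at hz
        norm_num at hz
        omega
      · norm_num at hr hdd
        subst hr
        have hk : k = 10 := by omega
        have hl : l = 3 := by omega
        subst hk hl
        have hn : n = 41 := by omega
        subst hn
        obtain ⟨z, hz⟩ := h.exists_sq_mul_discr (by norm_num)
        generalize z * z = w at hz
        norm_num at hz
        omega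
    · have hd12 : 12 ≤ d := by
        rw [hdd, hr]
        rcases Nat.eq_zero_or_pos l' with h0 | h0
        · subst h0
          have hr4 : 4 ≤ r := by omega
          obtain ⟨r', rfl⟩ : ∃ r', r = r' + 4 := ⟨r - 4, by omega⟩
          have : r' + 4 - 1 = r' + 3 := by omega
          rw [this]; nlinarith
        · obtain ⟨r', rfl⟩ : ∃ r', r = r' + 3 := ⟨r - 3, by omega⟩
          obtain ⟨l'', rfl⟩ : ∃ l'', l' = l'' + 1 := ⟨l' - 1, by omega⟩
          have : r' + 3 - 1 = r' + 2 := by omega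
          rw [this]
          calc 12 ≤ (2 * 3) * (2 * 2) := by norm_num
            _ ≤ _ := Nat.mul_le_mul (Nat.mul_le_mul (by omega) (by omega))
              (Nat.mul_le_mul (by omega) (by omega))
      have hk4 : 4 ≤ k' := by
        rw [hr]
        rcases Nat.eq_zero_or_pos l' with h0 | h0
        · subst h0; omega
        · calc 4 ≤ 2 * 3 := by norm_num
            _ ≤ _ := Nat.mul_le_mul (by omega) (by omega)
      omega
  · have hlt : m' < m := by
      have := Nat.le_mul_of_pos_left m' ht
      omega
    obtain ⟨i1, i2⟩ := ih m' hlt hT hm'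
    have hbig : 12 * (m' - 1) ≤ k' - l' - 1 := by omega
    have h1 := Nat.mul_le_mul i1 hbig
    rw [p1] at h1
    obtain ⟨j, rfl⟩ : ∃ j, m' = j + 2 := ⟨m' - 2, by omega⟩
    have e : j + 2 - 1 = j + 1 := by omega
    rw [e] at h1
    have h2 : 17 * (j + 2) ≤ d := by
      by_contra hc
      have h3 : d * (j + 2) ≤ (17 * (j + 2)) * (j + 2) := Nat.mul_le_mul_right _ (by omega)
      nlinarith
    omega

/-- The strongly regular Terwilliger graphs with at most `7k` vertices have the parameters of the
pentagon or of the Petersen graph. -/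
theorem eq_of_card_le {V : Type u} [Finite V] {G : SimpleGraph V} {n k l m : ℕ}
    (h : G.IsTerwilligerSRG n k l m) (hn : n ≤ 7 * k) :
    m = 1 ∧ (n = 5 ∧ k = 2 ∧ l = 0 ∨ n = 10 ∧ k = 3 ∧ l = 0) := by
  have p1 := h.param_eq
  have p2 := h.succ_lt
  have p3 := h.succ_lt_card
  have p4 := h.pos
  have hb : k - l - 1 < 6 * m := by
    by_contra hc
    have h1 : k * (6 * m) ≤ (n - k - 1) * m := by
      rw [← p1]; exact Nat.mul_le_mul_left _ (by omega)
    have h2 : (n - k - 1) * m ≤ (6 * k - 1) * m := Nat.mul_le_mul_right _ (by omega)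
    have h3 : (6 * k - 1) * m < 6 * k * m := Nat.mul_lt_mul_of_pos_right (by omega) (by omega)
    nlinarith
  rcases Nat.lt_or_ge m 2 with hm | hm
  · have hm1 : m = 1 := by omega
    subst hm1
    exact ⟨rfl, h.eq_of_mu_one (by omega)⟩
  · obtain ⟨-, b2⟩ := bounds m h hm
    omega

end IsTerwilligerSRG

end SimpleGraph

/-! ### Graphs at the level of the definitions -/

namespace SimpleGraph

theorem dist_eq_two_iff {V : Type*} {G : SimpleGraph V} {u v : V} :
    G.dist u v = 2 ↔ u ≠ v ∧ ¬G.Adj u v ∧ ∃ w, G.Adj u w ∧ G.Adj v w := by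
  rw [dist, ENat.toNat_eq_iff (by norm_num)]
  exact edist_eq_two_iff

theorem Connected.exists_dist_eq_two {V : Type*} {G : SimpleGraph V} (h : G.Connected)
    (ht : G ≠ ⊤) : ∃ u v, G.dist u v = 2 := by
  by_contra! hc
  have key : ∀ {a b : V} (_ : G.Walk a b), a = b ∨ G.Adj a b := by
    intro a b p
    induction p with
    | nil => exact Or.inl rfl
    | @cons a v w hav _ ih =>
      by_contra! hn
      rcases ih with rfl | ih
      · exact hn.2 hav
      · exact hc a w (dist_eq_two_iff.2 ⟨hn.1, hn.2, v, hav, ih.symm⟩)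
  apply ht
  ext a b
  rw [top_adj]
  refine ⟨fun h => h.ne, fun hne => ?_⟩
  obtain ⟨p⟩ := h.preconnected a b
  exact (key p).resolve_left hne

theorem IsCliqueRegular.connected {V : Type*} {G : SimpleGraph V} {k m : ℕ}
    (h : G.IsCliqueRegular k m) : G.Connected := by
  obtain ⟨a, -⟩ := h.exists_not_adj
  have : Nonempty V := ⟨a⟩
  refine ⟨fun x y => ?_⟩
  by_cases hxy : x = y
  · exact hxy ▸ Reachable.refl _
  by_cases hadj : G.Adj x y
  · exact hadj.reachable
  · obtain ⟨w, h1, h2⟩ := h.exists_mem_commonNeighbors hxy hadj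
    exact h1.reachable.trans h2.symm.reachable

section SRG

variable {V : Type*} [Fintype V] {G : SimpleGraph V} [DecidableRel G.Adj] {n k l m : ℕ}

theorem IsSRGWith.ncard_commonNeighbors (h : G.IsSRGWith n k l m) {x y : V} (hxy : x ≠ y)
    (hn : ¬G.Adj x y) : (G.commonNeighbors x y).ncard = m := by
  rw [← h.of_not_adj hxy hn, ← Nat.card_coe_set_eq, Nat.card_eq_fintype_card]

theorem IsSRGWith.isTerwilligerSRG (h : G.IsSRGWith n k l m)
    (hcl : ∀ x y, x ≠ y → ¬G.Adj x y → G.IsClique (G.commonNeighbors x y)) (hm : 1 ≤ m)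
    (ht : G ≠ ⊤) : G.IsTerwilligerSRG n k l m where
  ncard_neighborSet := fun x => by
    rw [← h.regular x, ← G.card_neighborSet_eq_degree, ← Nat.card_coe_set_eq,
      Nat.card_eq_fintype_card]
  isClique := hcl
  ncard_of_not_adj := fun x y hxy hn => h.ncard_commonNeighbors hxy hn
  pos := hm
  ne_top := ht
  card := by rw [← h.card, Nat.card_eq_fintype_card]
  ncard_of_adj := fun x y hxy => by
    rw [← h.of_adj x y hxy, ← Nat.card_coe_set_eq, Nat.card_eq_fintype_card]

theorem IsSRGWith.isTerwilligerSRG_of_one (h : G.IsSRGWith n k l 1) (ht : G ≠ ⊤) :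
    G.IsTerwilligerSRG n k l 1 := by
  refine h.isTerwilligerSRG (fun x y hxy hn => ?_) le_rfl ht
  obtain ⟨w, hw⟩ := Set.ncard_eq_one.1 (h.ncard_commonNeighbors hxy hn)
  rw [hw]
  exact Set.pairwise_singleton _ _

theorem IsSRGWith.isTerwilligerSRG_of_isTerwilliger (h : G.IsSRGWith n k l m)
    (hT : G.IsTerwilliger) : G.IsTerwilligerSRG n k l m := by
  obtain ⟨hc, ht, μ, hμ, hT⟩ := hT
  obtain ⟨u, v, huv⟩ := hc.exists_dist_eq_two ht
  obtain ⟨h1, h2, -⟩ := dist_eq_two_iff.1 huv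
  have hm : m = μ := by rw [← h.ncard_commonNeighbors h1 h2, (hT u v huv).2]
  refine h.isTerwilligerSRG (fun x y hxy hn => ?_) (hm ▸ hμ) ht
  refine (hT x y (dist_eq_two_iff.2 ⟨hxy, hn, ?_⟩)).1
  obtain ⟨w, hw⟩ := Set.nonempty_of_ncard_ne_zero (s := G.commonNeighbors x y)
    (by rw [h.ncard_commonNeighbors hxy hn]; omega)
  exact ⟨w, hw⟩

end SRG

/-- A distance-regular Terwilliger graph is amply regular. -/
theorem IsDistanceRegularWith.isAmplyTerwilliger {V : Type*} [Finite V] {G : SimpleGraph V}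
    {b c : ℕ → ℕ} (h : G.IsDistanceRegularWith b c) (hT : G.IsTerwilliger) :
    ∃ l : ℕ, intersectionA b c 1 = l ∧ l + 1 < b 0 ∧ G.IsAmplyTerwilliger (b 0) l (c 2) := by
  obtain ⟨hc, ht, μ, hμ, hT⟩ := hT
  have hdeg : ∀ x, (G.neighborSet x).ncard = b 0 := by
    intro x
    have := h.card_succ x x
    rw [dist_self] at this
    rw [← this]
    congr 1
    ext z
    simp only [mem_neighborSet, Set.mem_ofPred_eq, zero_add, dist_eq_one_iff_adj, and_self]
  have hpart : ∀ x y, G.Adj x y → 1 + (G.commonNeighbors x y).ncard + b 1 = b 0 := by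
    intro x y hxy
    have h1 := h.card_succ x y
    rw [dist_eq_one_iff_adj.2 hxy] at h1
    have h2 : G.neighborSet y = insert x (G.commonNeighbors x y ∪
        {z | G.Adj y z ∧ G.dist x z = 1 + 1}) := by
      ext z
      simp only [mem_neighborSet, Set.mem_insert_iff, Set.mem_union, mem_commonNeighbors,
        Set.mem_ofPred_eq]
      constructor
      · intro hyz
        by_cases hxz : z = x
        · exact Or.inl hxz
        · by_cases hadj : G.Adj x z
          · exact Or.inr (Or.inl ⟨hadj, hyz⟩)
          · exact Or.inr (Or.inr ⟨hyz, dist_eq_two_iff.2 ⟨Ne.symm hxz, hadj, y, hxy, hyz.symm⟩⟩)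
      · rintro (rfl | h | h)
        · exact hxy.symm
        · exact h.2
        · exact h.1
    rw [← hdeg y, h2, Set.ncard_insert_of_notMem, Set.ncard_union_eq, h1]
    · ring
    · rw [Set.disjoint_left]
      rintro z ⟨hz, -⟩ ⟨-, hz'⟩
      exact (dist_eq_two_iff.1 hz').2.1 hz
    · simp [mem_commonNeighbors]
  obtain ⟨u, v, huv⟩ := hc.exists_dist_eq_two ht
  obtain ⟨h1, h2, w, huw, hvw⟩ := dist_eq_two_iff.1 huv
  have hb1 : 0 < b 1 := by
    have h3 := h.card_succ u w
    rw [dist_eq_one_iff_adj.2 huw] at h3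
    rw [← h3, Set.ncard_pos]
    exact ⟨v, hvw.symm, huv⟩
  have hc1 : c 1 = 1 := by
    have h3 := h.card_pred u w
    rw [dist_eq_one_iff_adj.2 huw] at h3
    rw [← h3, Set.ncard_eq_one]
    refine ⟨u, ?_⟩
    ext z
    simp only [Set.mem_ofPred_eq, Set.mem_singleton_iff, Nat.add_eq_right, hc.dist_eq_zero_iff]
    exact ⟨fun h => h.2.symm, fun e => by rw [e]; exact ⟨huw.symm, rfl⟩⟩
  have hl := hpart u w huw
  refine ⟨(G.commonNeighbors u w).ncard, ?_, by omega, hdeg, ?_, ?_, ?_⟩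
  · rw [intersectionA, hc1]; omega
  · intro x y hxy
    have := hpart x y hxy
    omega
  · intro x y hxy hn
    by_cases hw : ∃ w, G.Adj x w ∧ G.Adj y w
    · exact (hT x y (dist_eq_two_iff.2 ⟨hxy, hn, hw⟩)).1
    · intro w hw'
      exact absurd ⟨w, hw'⟩ hw
  · intro x y z hxy hn hxz hyz
    have hd := dist_eq_two_iff.2 ⟨hxy, hn, z, hxz, hyz⟩
    have h3 := h.card_pred x y
    rw [hd] at h3
    rw [← h3]
    congr 1
    ext z
    simp only [mem_commonNeighbors, Set.mem_ofPred_eq, Nat.reduceEqDiff, dist_eq_one_iff_adj]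
    exact and_comm

/-- The bound on `k` for `m ≥ 2` forces the local graphs to be pentagons or Petersen graphs. -/
theorem IsAmplyTerwilliger.params {V : Type u} [Finite V] [Nonempty V] {G : SimpleGraph V}
    {k l m : ℕ} (h : G.IsAmplyTerwilliger k l m) (hm : 2 ≤ m) (hl : l + 1 < k)
    (hk : 57 * k ≤ 350 * (l + 1)) :
    m = 2 ∧ (k = 5 ∧ l = 2 ∨ k = 10 ∧ l = 3) ∧
      ∀ x a b c, G.Adj x a → G.Adj x b → G.Adj x c → G.Adj a b → G.Adj a c → G.Adj b c → False := by
  have key : ∀ x, m = 2 ∧ (k = 5 ∧ l = 2 ∨ k = 10 ∧ l = 3) ∧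
      ∀ a b c, G.Adj x a → G.Adj x b → G.Adj x c → G.Adj a b → G.Adj a c → G.Adj b c →
        False := by
    intro x
    obtain ⟨t, n', k', l', m', ht, ⟨W, hW, H, hT⟩, e1, e2, e3, e4⟩ :=
      h.exists_local_quotient hm hl x
    have h1 : 57 * n' ≤ 350 * (k' + 1) := by
      rw [e1, e2] at hk
      refine Nat.le_of_mul_le_mul_left ?_ ht
      linarith
    have h2 : n' ≤ 7 * k' := by
      by_contra hc
      have p1 := hT.param_eq
      have p2 := hT.succ_lt
      have p4 := hT.pos
      have h3 : k' ≤ 5 := by omega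
      have h4 : (6 * k') * 1 ≤ (n' - k' - 1) * m' := Nat.mul_le_mul (by omega) p4
      have h5 : k' * (k' - l' - 1) ≤ k' * 5 := Nat.mul_le_mul_left _ (by omega)
      omega
    obtain ⟨rfl, h3⟩ := hT.eq_of_card_le h2
    have hl0 : l' = 0 := by omega
    obtain ⟨rfl, h4⟩ := e4 hl0
    refine ⟨by omega, by omega, h4⟩
  obtain ⟨x⟩ := ‹Nonempty V›
  exact ⟨(key x).1, (key x).2.1, fun y => (key y).2.2⟩

end SimpleGraph

/-! ### Uniqueness of the pentagon and of the Petersen graph -/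

namespace SimpleGraph

theorem ncard_neighborSet_of_isRegular {V : Type*} [Fintype V] {G : SimpleGraph V}
    [DecidableRel G.Adj] {d : ℕ} (h : ∀ v, G.degree v = d) (v : V) :
    (G.neighborSet v).ncard = d := by
  rw [← h v, ← G.card_neighborSet_eq_degree, ← Nat.card_coe_set_eq, Nat.card_eq_fintype_card]

namespace IsTerwilligerSRG

variable {V : Type*} [Finite V] {G : SimpleGraph V} {n k m : ℕ}

theorem triangleFree (h : G.IsTerwilligerSRG n k 0 m) {x y z : V} (h1 : G.Adj x y)
    (h2 : G.Adj x z) (h3 : G.Adj y z) : False := by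
  have h4 := h.ncard_of_adj x y h1
  rw [Set.ncard_eq_zero (Set.toFinite _)] at h4
  have h5 : z ∈ G.commonNeighbors x y := ⟨h2, h3⟩
  rw [h4] at h5
  exact h5

/-- In a triangle-free graph with `m = 1`, a vertex other than `a` has at most one neighbour in
common with `a`. -/
theorem eq_of_ne (h : G.IsTerwilligerSRG n k 0 1) {a x p q : V} (hx : x ≠ a) (h1 : G.Adj a p)
    (h2 : G.Adj a q) (h3 : G.Adj x p) (h4 : G.Adj x q) : p = q := by
  refine h.eq_of_mem hx (fun hxa => h.triangleFree hxa h3 h1) h3 h1 h4 h2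

theorem exists_other (h : G.IsTerwilligerSRG n k 0 m) (hk : 2 ≤ k) (a b : V) :
    ∃ c, G.Adj a c ∧ c ≠ b := by
  by_contra! hc
  have h1 : G.neighborSet a ⊆ {b} := fun c hac => hc c hac
  have h2 := Set.ncard_le_ncard h1
  rw [h.ncard_neighborSet, Set.ncard_singleton] at h2
  omega

theorem nonempty_iso_pentagon (h : G.IsTerwilligerSRG 5 2 0 1) : Nonempty (G ≃g pentagon) := by
  obtain ⟨a, -⟩ := h.exists_not_adj
  obtain ⟨b, e, hbe, hN⟩ := Set.ncard_eq_two.1 (h.ncard_neighborSet a)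
  have hab : G.Adj a b := by
    have : b ∈ G.neighborSet a := by rw [hN]; simp
    exact this
  have hae : G.Adj a e := by
    have : e ∈ G.neighborSet a := by rw [hN]; simp
    exact this
  obtain ⟨c, hbc, hca⟩ := h.exists_other le_rfl b a
  have hce : ¬G.Adj c e := fun hce => hbe (h.eq_of_ne hca hab hae hbc.symm hce)
  have hce' : c ≠ e := by rintro rfl; exact h.triangleFree hab hae hbc
  obtain ⟨d, hcd, hed⟩ := h.exists_mem_commonNeighbors hce' hce
  have hac : ¬G.Adj a c := fun hac => h.triangleFree hab hac hbc
  have hda : d ≠ a := by rintro rfl; exact hac hcd.symm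
  have hdb : d ≠ b := by
    rintro rfl
    exact h.triangleFree hab hae hed.symm
  refine nonempty_iso_of_injective (T := pentagon) ![a, b, c, d, e] ?_ ?_ (d := 2) ?_
    h.ncard_neighborSet h.connected
  · have key : ∀ i j, pentagon.Adj i j → j = i + 1 ∨ i = j + 1 := by decide
    have hstep : ∀ i, G.Adj (![a, b, c, d, e] i) (![a, b, c, d, e] (i + 1)) := by
      intro i
      fin_cases i
      · exact hab
      · exact hbc
      · exact hcd
      · exact hed.symm
      · exact hae.symm
    intro i j hij
    rcases key i j hij with rfl | rfl
    · exact hstep i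
    · exact (hstep j).symm
  · have hnd : [a, b, c, d, e].Nodup := by
      simp [hab.ne, hbc.ne, hcd.ne, hed.ne', hae.ne, hca.symm, hda.symm, hdb.symm, hbe, hce']
    intro i j hij
    have := (List.nodup_ofFn (f := ![a, b, c, d, e])).1 (by simpa using hnd)
    exact this hij
  · exact ncard_neighborSet_of_isRegular (by decide)

end IsTerwilligerSRG

end SimpleGraph

/-- The neighbours of the vertices of the Petersen graph, in a numbering in which `1, 2, 3` are the
neighbours of `0` and `4, …, 9` form the hexagon opposite to `0`. -/
def petersenNbr : Fin 10 → Fin 3 → Fin 10 :=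
  ![![1, 2, 3], ![0, 4, 7], ![0, 5, 8], ![0, 6, 9], ![1, 9, 5], ![2, 4, 6], ![3, 5, 7], ![1, 6, 8],
    ![2, 7, 9], ![3, 8, 4]]

/-- The Petersen graph on `Fin 10`. -/
def petersenFin : SimpleGraph (Fin 10) where
  Adj i j := ∃ t, petersenNbr i t = j
  symm := ⟨by decide⟩
  loopless := ⟨by decide⟩

instance : DecidableRel petersenFin.Adj :=
  fun i j => inferInstanceAs (Decidable (∃ t, petersenNbr i t = j))

/-- The vertices of `petersenFin` as `2`-subsets of a `5`-set. -/
def petersenSubset : Fin 10 → {s : Finset (Fin 5) // s.card = 2} :=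
  ![⟨{0, 1}, rfl⟩, ⟨{2, 3}, rfl⟩, ⟨{2, 4}, rfl⟩, ⟨{3, 4}, rfl⟩, ⟨{0, 4}, rfl⟩, ⟨{1, 3}, rfl⟩,
    ⟨{0, 2}, rfl⟩, ⟨{1, 4}, rfl⟩, ⟨{0, 3}, rfl⟩, ⟨{1, 2}, rfl⟩]

theorem nonempty_petersenFin_iso : Nonempty (petersenFin ≃g petersenGraph) := by
  have hb : Function.Bijective petersenSubset := by
    constructor
    · unfold Function.Injective; decide
    · unfold Function.Surjective; decide
  refine ⟨⟨Equiv.ofBijective _ hb, ?_⟩⟩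
  intro i j
  show Disjoint (petersenSubset i).1 (petersenSubset j).1 ↔ petersenFin.Adj i j
  revert i j
  decide

namespace SimpleGraph.IsTerwilligerSRG

theorem nonempty_iso_petersenFin {V : Type*} [Finite V] {G : SimpleGraph V}
    (h : G.IsTerwilligerSRG 10 3 0 1) : Nonempty (G ≃g petersenFin) := by
  obtain ⟨v0, -⟩ := h.exists_not_adj
  obtain ⟨v1, v2, v3, h12, h13, h23, hN⟩ := Set.ncard_eq_three.1 (h.ncard_neighborSet v0)
  have hadj0 : ∀ v, G.Adj v0 v ↔ v = v1 ∨ v = v2 ∨ v = v3 := by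
    intro v
    have := Set.ext_iff.1 hN v
    simpa using this
  have a1 : G.Adj v0 v1 := (hadj0 _).2 (by simp)
  have a2 : G.Adj v0 v2 := (hadj0 _).2 (by simp)
  have a3 : G.Adj v0 v3 := (hadj0 _).2 (by simp)
  -- A neighbour of one of `v1`, `v2`, `v3` other than `v0` has a common neighbour with the others.
  have step : ∀ {p q x : V}, G.Adj v0 p → G.Adj v0 q → p ≠ q → G.Adj p x → x ≠ v0 →
      ∃ y, G.Adj x y ∧ G.Adj q y ∧ y ≠ v0 := by
    intro p q x hp hq hpq hpx hx
    have hxq : ¬G.Adj x q := fun hxq => hpq (h.eq_of_ne hx hp hq hpx.symm hxq)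
    have hxq' : x ≠ q := by rintro rfl; exact h.triangleFree hp hq hpx
    obtain ⟨y, hy1, hy2⟩ := h.exists_mem_commonNeighbors hxq' hxq
    refine ⟨y, hy1, hy2, ?_⟩
    rintro rfl
    exact h.triangleFree hp hy1.symm hpx
  obtain ⟨v4, a14, n4⟩ := h.exists_other (by norm_num) v1 v0
  obtain ⟨v5, a45, a25, n5⟩ := step a1 a2 h12 a14 n4
  obtain ⟨v6, a56, a36, n6⟩ := step a2 a3 h23 a25 n5
  obtain ⟨v7, a67, a17, n7⟩ := step a3 a1 h13.symm a36 n6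
  obtain ⟨v8, a78, a28, n8⟩ := step a1 a2 h12 a17 n7
  obtain ⟨v9, a89, a39, n9⟩ := step a2 a3 h23 a28 n8
  obtain ⟨w, a9w, a1w, nw⟩ := step a3 a1 h13.symm a39 n9
  have n47 : v4 ≠ v7 := by rintro rfl; exact h.triangleFree a45 a67.symm a56
  have hw : w = v4 := by
    have h1 : ({v0, v4, v7} : Set V) = G.neighborSet v1 := by
      apply Set.eq_of_subset_of_ncard_le
      · rintro x (rfl | rfl | rfl)
        · exact a1.symm
        · exact a14
        · exact a17
      · rw [h.ncard_neighborSet, Set.ncard_eq_three.2 ⟨v0, v4, v7, n4.symm, n7.symm, n47, rfl⟩]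
      · exact Set.toFinite _
    have h2 : w ∈ G.neighborSet v1 := a1w
    rw [← h1] at h2
    rcases h2 with h2 | h2 | h2
    · exact absurd h2 nw
    · exact h2
    · rw [h2] at a9w
      exact (h.triangleFree a78 a9w.symm a89).elim
  subst hw
  -- The six vertices of the hexagon lie in three groups, according to their neighbour in `Γ(v0)`.
  have grp : ∀ {p q x y : V}, G.Adj v0 p → G.Adj v0 q → p ≠ q → G.Adj p x → G.Adj q y → x ≠ v0 →
      x ≠ y := by
    intro p q x y hp hq hpq hpx hqy hx
    rintro rfl
    exact hpq (h.eq_of_ne hx hp hq hpx.symm hqy.symm)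
  have lev : ∀ {p q x : V}, G.Adj v0 p → G.Adj v0 q → G.Adj q x → p ≠ x := by
    intro p q x hp hq hqx
    rintro rfl
    exact h.triangleFree hq hp hqx
  have n58 : v5 ≠ v8 := by rintro rfl; exact h.triangleFree a67 a56.symm a78
  have n69 : v6 ≠ v9 := by rintro rfl; exact h.triangleFree a78 a67.symm a89
  let φ : Fin 10 → V := ![v0, v1, v2, v3, w, v5, v6, v7, v8, v9]
  have hom : ∀ i t, G.Adj (φ i) (φ (petersenNbr i t)) := by
    intro i t
    fin_cases i <;> fin_cases t <;>
      first
      | exact a1 | exact a2 | exact a3 | exact a14 | exact a17 | exact a25 | exact a28 | exact a36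
      | exact a39 | exact a45 | exact a56 | exact a67 | exact a78 | exact a89 | exact a9w
      | exact a1.symm | exact a2.symm | exact a3.symm | exact a14.symm | exact a17.symm
      | exact a25.symm | exact a28.symm | exact a36.symm | exact a39.symm | exact a45.symm
      | exact a56.symm | exact a67.symm | exact a78.symm | exact a89.symm | exact a9w.symm
  have hinj : ∀ i (s t : Fin 3), s < t → φ (petersenNbr i s) ≠ φ (petersenNbr i t) := by
    intro i s t hst
    fin_cases s <;> fin_cases t <;> first | exact absurd hst (by decide) | skip
    · fin_cases i
      exacts [h12, n4.symm, n5.symm, n6.symm, lev a1 a3 a39, lev a2 a1 a14, lev a3 a2 a25,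
        lev a1 a3 a36, lev a2 a1 a17, lev a3 a2 a28]
    · fin_cases i
      exacts [h13, n7.symm, n8.symm, n9.symm, lev a1 a2 a25, lev a2 a3 a36, lev a3 a1 a17,
        lev a1 a2 a28, lev a2 a3 a39, lev a3 a1 a14]
    · fin_cases i
      exacts [h23, n47, n58, n69, grp a3 a2 h23.symm a39 a25 n9, grp a1 a3 h13 a14 a36 n4,
        grp a2 a1 h12.symm a25 a17 n5, grp a3 a2 h23.symm a36 a28 n6, grp a1 a3 h13 a17 a39 n7,
        grp a2 a1 h12.symm a28 a14 n8]
  refine nonempty_iso_of_locally_injective (T := petersenFin) φ ?_ ?_ (d := 3) ?_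
    h.ncard_neighborSet h.connected ?_
  · rintro i _ ⟨t, rfl⟩
    exact hom i t
  · rintro i _ ⟨s, rfl⟩ _ ⟨t, rfl⟩ e
    rcases lt_trichotomy s t with hst | rfl | hst
    · exact absurd e (hinj i s t hst)
    · rfl
    · exact absurd e.symm (hinj i t s hst)
  · exact ncard_neighborSet_of_isRegular (by decide)
  · rw [h.card]; simp

end SimpleGraph.IsTerwilligerSRG

/-! ### Graphs that are locally a pentagon or the Petersen graph -/

theorem Set.eq_or_eq_of_ncard_eq_two {α : Type*} {s : Set α} (hs : s.ncard = 2) {a b c : α}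
    (ha : a ∈ s) (hb : b ∈ s) (hab : a ≠ b) (hc : c ∈ s) : c = a ∨ c = b := by
  obtain ⟨p, q, -, rfl⟩ := Set.ncard_eq_two.1 hs
  simp only [Set.mem_insert_iff, Set.mem_singleton_iff] at ha hb hc
  grind

namespace SimpleGraph

/-- All local graphs are triangle-free, of order `k`, regular of valency `l`, and two non-adjacent
vertices of a local graph have a unique common neighbour there, as `m = 2`. So the local graphs are
Moore graphs of diameter two: pentagons for `(k, l) = (5, 2)` and Petersen graphs for
`(k, l) = (10, 3)`. -/
structure IsLocallyMoore {V : Type*} (G : SimpleGraph V) (k l : ℕ) : Prop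
    extends G.IsAmplyTerwilliger k l 2 where
  cliqueFree : ∀ x a b c, G.Adj x a → G.Adj x b → G.Adj x c → G.Adj a b → G.Adj a c → G.Adj b c →
    False

namespace IsLocallyMoore

variable {V : Type*} {G : SimpleGraph V} {k l : ℕ}

/-- Two vertices at distance two have exactly two common neighbours. -/
theorem eq_or_eq (h : G.IsLocallyMoore k l) {x y p q r : V} (hxy : x ≠ y) (hn : ¬G.Adj x y)
    (hxp : G.Adj x p) (hyp : G.Adj y p) (hxq : G.Adj x q) (hyq : G.Adj y q) (hpq : p ≠ q)
    (hxr : G.Adj x r) (hyr : G.Adj y r) : r = p ∨ r = q :=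
  Set.eq_or_eq_of_ncard_eq_two (h.ncard_of_mem x y p hxy hn hxp hyp)
    (show p ∈ G.commonNeighbors x y from ⟨hxp, hyp⟩) (show q ∈ G.commonNeighbors x y from ⟨hxq, hyq⟩)
    hpq (show r ∈ G.commonNeighbors x y from ⟨hxr, hyr⟩)

/-- The second common neighbour of two vertices at distance two. -/
theorem exists_second (h : G.IsLocallyMoore k l) {x y p : V} (hxy : x ≠ y) (hn : ¬G.Adj x y)
    (hxp : G.Adj x p) (hyp : G.Adj y p) : ∃ q, G.Adj x q ∧ G.Adj y q ∧ G.Adj p q := by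
  obtain ⟨a, b, hab, e⟩ := Set.ncard_eq_two.1 (h.ncard_of_mem x y p hxy hn hxp hyp)
  have hp : p ∈ G.commonNeighbors x y := ⟨hxp, hyp⟩
  have ha : a ∈ G.commonNeighbors x y := by rw [e]; simp
  have hb : b ∈ G.commonNeighbors x y := by rw [e]; simp
  have hcl := h.isClique x y hxy hn
  rw [e] at hp
  rcases hp with rfl | rfl
  · exact ⟨b, hb.1, hb.2, hcl ha hb hab⟩
  · exact ⟨a, ha.1, ha.2, hcl hb ha hab.symm⟩

theorem adj_of_mem (h : G.IsLocallyMoore k l) {x y p q : V} (hxy : x ≠ y) (hn : ¬G.Adj x y)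
    (hxp : G.Adj x p) (hyp : G.Adj y p) (hxq : G.Adj x q) (hyq : G.Adj y q) (hpq : p ≠ q) :
    G.Adj p q :=
  h.isClique x y hxy hn ⟨hxp, hyp⟩ ⟨hxq, hyq⟩ hpq

/-- There is no quadrangle in a local graph. -/
theorem no_quadrangle (h : G.IsLocallyMoore k l) {x a b c d : V} (ha : G.Adj x a) (hb : G.Adj x b)
    (hc : G.Adj x c) (hd : G.Adj x d) (hab : G.Adj a b) (hbc : G.Adj b c) (hcd : G.Adj c d)
    (hda : G.Adj d a) (hac : a ≠ c) (hbd : b ≠ d) : False := by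
  have hn : ¬G.Adj a c := fun hac => h.cliqueFree x a b c ha hb hc hab hac hbc
  exact h.cliqueFree x a b d ha hb hd hab hda.symm
    (h.adj_of_mem hac hn hab hbc.symm hda.symm hcd hbd)

/-- A numbering of a local graph. -/
theorem exists_local_iso {W : Type*} {H : SimpleGraph W} {x : V}
    (h : Nonempty (G.induce (G.neighborSet x) ≃g H)) : ∃ y : W → V, Function.Injective y ∧
      (∀ i, G.Adj x (y i)) ∧ (∀ v, G.Adj x v → ∃ i, y i = v) ∧
      ∀ i j, G.Adj (y i) (y j) ↔ H.Adj i j := by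
  obtain ⟨e⟩ := h
  refine ⟨fun i => (e.symm i).1, Subtype.val_injective.comp e.symm.injective,
    fun i => (e.symm i).2, fun v hv => ⟨e ⟨v, hv⟩, by simp⟩, fun i j => ?_⟩
  exact e.symm.map_adj_iff

variable [Finite V]

theorem isTerwilligerSRG_induce (h : G.IsLocallyMoore k l) (hl : l + 1 < k) (x : V) :
    (G.induce (G.neighborSet x)).IsTerwilligerSRG k l 0 1 where
  toIsCliqueRegular := h.isCliqueRegular_induce le_rfl hl x
  card := by rw [Nat.card_coe_set_eq, h.ncard_neighborSet]
  ncard_of_adj := by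
    rintro ⟨a, ha⟩ ⟨b, hb⟩ hab
    rw [Set.ncard_eq_zero (Set.toFinite _)]
    ext ⟨c, hc⟩
    simp only [Set.mem_empty_iff_false, iff_false]
    rintro ⟨h1, h2⟩
    exact h.cliqueFree x a b c ha hb hc hab h1 h2

instance : DecidableRel icosahedronAdj
  | (_, none), (_, none) => inferInstanceAs (Decidable False)
  | (s, none), (t, some _) => inferInstanceAs (Decidable (s = t))
  | (s, some _), (t, none) => inferInstanceAs (Decidable (s = t))
  | (true, some i), (true, some j) => inferInstanceAs (Decidable (j = i + 1 ∨ i = j + 1))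
  | (false, some i), (false, some j) => inferInstanceAs (Decidable (j = i + 1 ∨ i = j + 1))
  | (true, some i), (false, some j) => inferInstanceAs (Decidable (j = i ∨ j = i + 1))
  | (false, some j), (true, some i) => inferInstanceAs (Decidable (j = i ∨ j = i + 1))

instance : DecidableRel icosahedron.Adj := inferInstanceAs (DecidableRel icosahedronAdj)

/-- A connected graph that is locally a pentagon is the icosahedron. -/
theorem nonempty_iso_icosahedron (h : G.IsLocallyMoore 5 2) (hc : G.Connected) :
    Nonempty (G ≃g icosahedron) := by
  obtain ⟨x⟩ := hc.nonempty
  obtain ⟨y, hyi, hxy, -, hy⟩ : ∃ y : ZMod 5 → V, Function.Injective y ∧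
      (∀ i, G.Adj x (y i)) ∧ (∀ v, G.Adj x v → ∃ i, y i = v) ∧
      ∀ i j, G.Adj (y i) (y j) ↔ pentagon.Adj i j :=
    exists_local_iso (h.isTerwilligerSRG_induce (by norm_num) x).nonempty_iso_pentagon
  have hpent : ∀ i j : ZMod 5, pentagon.Adj i j ↔ j = i + 1 ∨ i = j + 1 :=
    (by decide : ∀ i j : Fin 5, pentagon.Adj i j ↔ j = i + 1 ∨ i = j + 1)
  have hyy : ∀ i, G.Adj (y i) (y (i + 1)) := fun i => (hy _ _).2 ((hpent _ _).2 (Or.inl rfl))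
  have hu : ∀ i, ∃ u, u ≠ x ∧ G.Adj (y i) u ∧ G.Adj (y (i + 1)) u := by
    intro i
    have h1 := h.ncard_of_adj _ _ (hyy i)
    obtain ⟨u, hu, hux⟩ := Set.exists_ne_of_one_lt_ncard
      (show 1 < (G.commonNeighbors (y i) (y (i + 1))).ncard by omega) x
    exact ⟨u, hux, hu.1, hu.2⟩
  choose u hux hu1 hu2 using hu
  have hxu : ∀ i, ¬G.Adj x (u i) := fun i hi =>
    h.cliqueFree x (y i) (y (i + 1)) (u i) (hxy _) (hxy _) hi (hyy i) (hu1 i) (hu2 i)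
  have hyu : ∀ i j, G.Adj (y j) (u i) → j = i ∨ j = i + 1 := by
    intro i j hij
    rcases h.eq_or_eq (hux i).symm (hxu i) (hxy i) (hu1 i).symm (hxy (i + 1)) (hu2 i).symm
      (hyy i).ne (hxy j) hij.symm with e | e
    · exact Or.inl (hyi e)
    · exact Or.inr (hyi e)
  have hyneu : ∀ i j, y j ≠ u i := fun i j e => hxu i (e ▸ hxy j)
  have hui : Function.Injective u := by
    intro i j e
    have h1 := hyu j i (e ▸ hu1 i)
    have h2 := hyu j (i + 1) (e ▸ hu2 i)
    revert h1 h2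
    revert i j
    intro i j _
    clear * -
    revert i j
    decide
  have hpair : ∀ i v, G.Adj (y i) v → G.Adj (y (i + 1)) v → v = x ∨ v = u i := fun i v h1 h2 =>
    Set.eq_or_eq_of_ncard_eq_two (h.ncard_of_adj _ _ (hyy i))
      (show x ∈ G.commonNeighbors _ _ from ⟨(hxy _).symm, (hxy _).symm⟩)
      (show u i ∈ G.commonNeighbors _ _ from ⟨hu1 i, hu2 i⟩) (hux i).symm
      (show v ∈ G.commonNeighbors _ _ from ⟨h1, h2⟩)
  have huu : ∀ i, G.Adj (u i) (u (i + 1)) := by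
    intro i
    have hn : ¬G.Adj (u i) (y (i + 1 + 1)) := by
      intro hn
      have := hyu i _ hn.symm
      revert this
      clear * -
      revert i
      decide
    obtain ⟨q, h1, h2, h3⟩ := h.exists_second (hyneu i _).symm hn (hu2 i).symm (hyy (i + 1)).symm
    rcases hpair (i + 1) q h3 h2 with e | e
    · exact absurd (e ▸ h1) (fun h' => hxu i h'.symm)
    · exact e ▸ h1
  have hw : ∀ i, ∃ w, G.Adj (u i) w ∧ G.Adj (u (i + 1)) w ∧ G.Adj (u (i + 1 + 1)) w := by
    intro i
    have hne : u i ≠ u (i + 1 + 1) := by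
      intro e
      have := hui e
      revert this
      clear * -
      revert i
      decide
    have hn : ¬G.Adj (u i) (u (i + 1 + 1)) := by
      intro hn
      exact h.no_quadrangle (huu i).symm (hu1 (i + 1)).symm (hu2 (i + 1)).symm (huu (i + 1))
        (hu2 i).symm (hyy (i + 1)) (hu1 (i + 1 + 1)) hn.symm (hyneu i (i + 1 + 1)).symm (hyneu _ _)
    obtain ⟨w, h1, h2, h3⟩ := h.exists_second hne hn (huu i) (huu (i + 1)).symm
    exact ⟨w, h1, h3, h2⟩
  choose w hw1 hw2 hw3 using hw
  have hyw : ∀ i j, w i ≠ y j := by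
    intro i j e
    have h1 := hyu i j (e ▸ (hw1 i).symm)
    have h2 := hyu _ j (e ▸ (hw3 i).symm)
    revert h1 h2
    clear * -
    revert i j
    decide
  have hwstep : ∀ i, w (i + 1) = w i := by
    intro i
    have e1 : w i ∈ G.commonNeighbors (u (i + 1)) (u (i + 1 + 1)) := ⟨hw2 i, hw3 i⟩
    have e2 : w (i + 1) ∈ G.commonNeighbors (u (i + 1)) (u (i + 1 + 1)) := ⟨hw1 _, hw2 _⟩
    have e3 : y (i + 1 + 1) ∈ G.commonNeighbors (u (i + 1)) (u (i + 1 + 1)) :=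
      ⟨(hu2 _).symm, (hu1 _).symm⟩
    rcases Set.eq_or_eq_of_ncard_eq_two (h.ncard_of_adj _ _ (huu (i + 1))) e3 e1 (hyw _ _).symm e2
      with e | e
    · exact absurd e (hyw _ _)
    · exact e
  have hwc : ∀ i, w i = w 0 := by
    have h1 := hwstep 0
    have h2 := hwstep 1
    have h3 := hwstep 2
    have h4 := hwstep 3
    intro i
    have hi : i = 0 ∨ i = 0 + 1 ∨ i = 1 + 1 ∨ i = 2 + 1 ∨ i = 3 + 1 := by
      clear * -
      revert i
      decide
    have e1 : (0 + 1 : ZMod 5) = 1 := rfl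
    have e2 : (1 + 1 : ZMod 5) = 2 := rfl
    have e3 : (2 + 1 : ZMod 5) = 3 := rfl
    rw [e1] at h1; rw [e2] at h2; rw [e3] at h3
    rcases hi with rfl | rfl | rfl | rfl | rfl
    · rfl
    · rw [e1, h1]
    · rw [e2, h2, h1]
    · rw [e3, h3, h2, h1]
    · rw [h4, h3, h2, h1]
  have huw : ∀ i, G.Adj (u i) (w 0) := fun i => hwc i ▸ hw1 i
  have hwx : w 0 ≠ x := by
    intro e
    exact hxu 0 (e ▸ (huw 0).symm)
  let φ : Bool × Option (ZMod 5) → V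
    | (true, none) => x
    | (true, some i) => y i
    | (false, some j) => u (j - 1)
    | (false, none) => w 0
  have huu' : ∀ i, G.Adj (u (i - 1)) (u (i + 1 - 1)) := by
    intro i
    have := huu (i - 1)
    rwa [sub_add_eq_add_sub] at this
  have hyu1 : ∀ i, G.Adj (y i) (u (i - 1)) := by
    intro i
    have := hu2 (i - 1)
    rwa [sub_add_cancel] at this
  have hyu2 : ∀ i, G.Adj (y i) (u (i + 1 - 1)) := by
    intro i
    rw [add_sub_cancel_right]
    exact hu1 i
  refine nonempty_iso_of_injective (T := icosahedron) φ ?_ ?_ (d := 5) ?_ h.ncard_neighborSet hc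
  · rintro ⟨_ | _, _ | i⟩ ⟨_ | _, _ | j⟩ hij <;>
      simp only [icosahedron, icosahedronAdj, reduceCtorEq] at hij <;> simp only [φ]
    · exact (huw _).symm
    · exact huw _
    · rcases hij with rfl | rfl
      · exact huu' i
      · exact (huu' j).symm
    · rcases hij with rfl | rfl
      · exact (hyu1 _).symm
      · exact (hyu2 _).symm
    · exact hxy _
    · rcases hij with rfl | rfl
      · exact hyu1 _
      · exact hyu2 _
    · exact (hxy _).symm
    · rcases hij with rfl | rfl
      · exact hyy _
      · exact (hyy _).symm
  · rintro ⟨_ | _, _ | i⟩ ⟨_ | _, _ | j⟩ hij <;> simp only [φ] at hij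
    · rfl
    · exact absurd hij (huw _).ne'
    · exact absurd hij hwx
    · exact absurd hij (hyw _ _)
    · exact absurd hij (huw _).ne
    · rw [sub_left_injective (hui hij)]
    · exact absurd hij (hux _)
    · exact absurd hij (hyneu _ _).symm
    · exact absurd hij hwx.symm
    · exact absurd hij.symm (hux _)
    · rfl
    · exact absurd hij (hxy _).ne
    · exact absurd hij.symm (hyw _ _)
    · exact absurd hij (hyneu _ _)
    · exact absurd hij (hxy _).ne'
    · rw [hyi hij]
  · exact ncard_neighborSet_of_isRegular (by decide)

end IsLocallyMoore

end SimpleGraph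

/-! ### The second neighbourhood in a graph that is locally a Petersen graph -/

namespace SimpleGraph

namespace IsLocallyMoore

variable {V : Type*} {G : SimpleGraph V} {k l : ℕ}

/-- The vertices `u` and `w` at distance two from `x` lie over the disjoint edges `yz` and `y'z'`
of the local graph at `x`, and are adjacent. In a locally Petersen graph this does not happen
(`IsLocallyMoore.not_isCrossEdge`). -/
structure IsCrossEdge (G : SimpleGraph V) (x y z u y' z' w : V) : Prop where
  xy : G.Adj x y
  xz : G.Adj x z
  yz : G.Adj y z
  uy : G.Adj u y
  uz : G.Adj u z
  xu : ¬G.Adj x u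
  xy' : G.Adj x y'
  xz' : G.Adj x z'
  yz' : G.Adj y' z'
  wy' : G.Adj w y'
  wz' : G.Adj w z'
  xw : ¬G.Adj x w
  uw : G.Adj u w
  wy : ¬G.Adj w y
  wz : ¬G.Adj w z
  uy' : ¬G.Adj u y'
  uz' : ¬G.Adj u z'

namespace IsCrossEdge

variable {x y z u y' z' w : V}

theorem symm (e : IsCrossEdge G x y z u y' z' w) : IsCrossEdge G x y' z' w y z u :=
  ⟨e.xy', e.xz', e.yz', e.wy', e.wz', e.xw, e.xy, e.xz, e.yz, e.uy, e.uz, e.xu, e.uw.symm,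
    e.uy', e.uz', e.wy, e.wz⟩

theorem swap (e : IsCrossEdge G x y z u y' z' w) : IsCrossEdge G x z y u y' z' w :=
  ⟨e.xz, e.xy, e.yz.symm, e.uz, e.uy, e.xu, e.xy', e.xz', e.yz', e.wy', e.wz', e.xw, e.uw,
    e.wz, e.wy, e.uy', e.uz'⟩

theorem swap' (e : IsCrossEdge G x y z u y' z' w) : IsCrossEdge G x y z u z' y' w :=
  e.symm.swap.symm

theorem ne_left (e : IsCrossEdge G x y z u y' z' w) : x ≠ u :=
  fun h => e.uy' (h ▸ e.xy')

theorem exists_common (e : IsCrossEdge G x y z u y' z' w) (h : G.IsLocallyMoore k l) :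
    ∃ p, G.Adj w p ∧ G.Adj y p ∧ G.Adj u p :=
  h.exists_second (fun h' => e.xw (h' ▸ e.xy)) e.wy e.uw.symm e.uy.symm

/-- A common neighbour of `u` and `w` is not adjacent to the base vertex. -/
theorem not_adj_of_mem (e : IsCrossEdge G x y z u y' z' w) (h : G.IsLocallyMoore k l) {p : V}
    (hu : G.Adj u p) (hw : G.Adj w p) : ¬G.Adj x p := by
  intro hp
  rcases h.eq_or_eq e.ne_left e.xu e.xy e.uy e.xz e.uz e.yz.ne hp hu with rfl | rfl
  exacts [e.wy hw, e.wz hw]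

theorem adj_of_common (e : IsCrossEdge G x y z u y' z' w) (h : G.IsLocallyMoore k l) {p : V}
    (hu : G.Adj u p) (hw : G.Adj w p) (hy : G.Adj y p) (hy' : G.Adj y' p) : G.Adj y y' := by
  refine h.adj_of_mem (x := x) (y := p) ?_ (e.not_adj_of_mem h hu hw) e.xy hy.symm e.xy' hy'.symm ?_
  · rintro rfl
    exact e.xu hu.symm
  · rintro rfl
    exact e.wy e.wy'

/-- After exchanging names, the two ends of a cross edge have a common neighbour `p` over an edge
that joins their base edges: the four second common neighbours of `u` with `y'`, `z'`
and of `w` with `y`, `z` are among the three common neighbours of `u` and `w`. -/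
theorem exists_join (e : IsCrossEdge G x y z u y' z' w) (h : G.IsLocallyMoore k 3) :
    ∃ a b a' b' p, IsCrossEdge G x a b u a' b' w ∧ ({a, b} : Set V) = {y, z} ∧
      ({a', b'} : Set V) = {y', z'} ∧
      G.Adj u p ∧ G.Adj w p ∧ G.Adj a p ∧ G.Adj a' p ∧ G.Adj a a' := by
  obtain ⟨p, hpw, hpy, hpu⟩ := e.exists_common h
  obtain ⟨q, hqw, hqz, hqu⟩ := e.swap.exists_common h
  obtain ⟨t, htu, hty, htw⟩ := e.symm.exists_common h
  obtain ⟨t', htu', htz, htw'⟩ := e.symm.swap.exists_common h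
  have hpq : p ≠ q := by
    rintro rfl
    exact h.cliqueFree p y z u hpy.symm hqz.symm hpu.symm e.yz e.uy.symm e.uz.symm
  have htt : t ≠ t' := by
    rintro rfl
    exact h.cliqueFree t y' z' w hty.symm htz.symm htw.symm e.yz' e.wy'.symm e.wz'.symm
  have key : p = t ∨ p = t' ∨ q = t ∨ q = t' := by
    obtain ⟨a, b, c, -, -, -, habc⟩ := Set.ncard_eq_three.1 (h.ncard_of_adj u w e.uw)
    have hm : ∀ v, G.Adj u v → G.Adj w v → v = a ∨ v = b ∨ v = c := fun v h1 h2 => by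
      have : v ∈ G.commonNeighbors u w := ⟨h1, h2⟩
      simpa [habc] using this
    have h1 := hm p hpu hpw
    have h2 := hm q hqu hqw
    have h3 := hm t htu htw
    have h4 := hm t' htu' htw'
    grind
  rcases key with rfl | rfl | rfl | rfl
  · exact ⟨y, z, y', z', p, e, rfl, rfl, hpu, hpw, hpy, hty, e.adj_of_common h hpu hpw hpy hty⟩
  · exact ⟨y, z, z', y', p, e.swap', rfl, Set.pair_comm _ _, hpu, hpw, hpy, htz,
      e.swap'.adj_of_common h hpu hpw hpy htz⟩
  · exact ⟨z, y, y', z', q, e.swap, Set.pair_comm _ _, rfl, hqu, hqw, hqz, hty,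
      e.swap.adj_of_common h hqu hqw hqz hty⟩
  · exact ⟨z, y, z', y', q, e.swap.swap', Set.pair_comm _ _, Set.pair_comm _ _, hqu, hqw, hqz, htz,
      e.swap.swap'.adj_of_common h hqu hqw hqz htz⟩

/-- If the base edges of a cross edge `uw` are joined by `yy'`, and `r` is the second common
neighbour of `u` and `z'`, then `ur` is a cross edge as well, and the second base vertex `m` of `r`
is a neighbour of `z`. -/
theorem exists_next (e : IsCrossEdge G x y z u y' z' w) (h : G.IsLocallyMoore k 3)
    (hyy : G.Adj y y') {r : V} (hru : G.Adj u r) (hrw : G.Adj w r) (hrz : G.Adj z' r) :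
    ∃ m p, G.Adj x m ∧ G.Adj z' m ∧ G.Adj z m ∧ G.Adj r m ∧ ¬G.Adj u m ∧ G.Adj r p ∧ G.Adj u p ∧
      G.Adj z p ∧ G.Adj m p := by
  have hxr := e.not_adj_of_mem h hru hrw
  have hxr' : x ≠ r := by
    rintro rfl
    exact e.xu hru.symm
  have hyz' : y ≠ z' := by
    rintro rfl
    exact e.uz' e.uy
  have hzy' : z ≠ y' := by
    rintro rfl
    exact e.uy' e.uz
  have hzz' : z ≠ z' := by
    rintro rfl
    exact e.uz' e.uz
  have hnzz : ¬G.Adj z z' := fun h' =>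
    h.no_quadrangle e.xy e.xz e.xz' e.xy' e.yz h' e.yz'.symm hyy.symm hyz' hzy'
  have hnyz : ¬G.Adj y z' := fun h' =>
    h.cliqueFree x y y' z' e.xy e.xy' e.xz' hyy h' e.yz'
  obtain ⟨m, hxm, hrm, hzm⟩ := h.exists_second hxr' hxr e.xz' hrz.symm
  have hmy' : m ≠ y' := by
    rintro rfl
    exact h.cliqueFree r m z' w hrm hrz.symm hrw.symm e.yz' e.wy'.symm e.wz'.symm
  have hmy : y ≠ m := by
    rintro rfl
    exact hnyz hzm.symm
  have hmz : z ≠ m := by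
    rintro rfl
    exact hnzz hzm.symm
  have hr : ∀ v, G.Adj x v → G.Adj r v → v = z' ∨ v = m := fun v h1 h2 =>
    h.eq_or_eq hxr' hxr e.xz' hrz.symm hxm hrm hzm.ne h1 h2
  have hum : ¬G.Adj u m := fun h' => by
    rcases h.eq_or_eq e.ne_left e.xu e.xy e.uy e.xz e.uz e.yz.ne hxm h' with h1 | h1
    exacts [hmy h1.symm, hmz h1.symm]
  have e' : IsCrossEdge G x y z u z' m r :=
    ⟨e.xy, e.xz, e.yz, e.uy, e.uz, e.xu, e.xz', hxm, hzm, hrz.symm, hrm, hxr, hru,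
      fun h' => (hr y e.xy h').elim hyz' hmy, fun h' => (hr z e.xz h').elim hzz' hmz, e.uz', hum⟩
  obtain ⟨a, b, a', b', p, e'', hab, hab', hpu, hpr, hpa, hpa', haa⟩ := e'.exists_join h
  have ha : a = y ∨ a = z := by
    have : a ∈ ({y, z} : Set V) := hab ▸ Set.mem_insert _ _
    simpa using this
  have ha' : a' = z' ∨ a' = m := by
    have : a' ∈ ({z', m} : Set V) := hab' ▸ Set.mem_insert _ _
    simpa using this
  rcases ha with rfl | rfl <;> rcases ha' with rfl | rfl
  · exact absurd haa hnyz
  · exact (h.no_quadrangle e.xy hxm e.xz' e.xy' haa hzm.symm e.yz'.symm hyy.symm hyz' hmy').elim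
  · exact absurd haa hnzz
  · exact ⟨_, p, hxm, hzm, haa, hrm, hum, hpr, hpu, hpa, hpa'⟩

end IsCrossEdge

/-- Vertices at distance two from `x` over disjoint edges of the local graph are not adjacent. -/
theorem not_isCrossEdge (h : G.IsLocallyMoore k 3) {x y z u y' z' w : V} :
    ¬IsCrossEdge G x y z u y' z' w := by
  intro e₀
  obtain ⟨y, z, y', z', p, e, -, -, -, -, -, -, hyy⟩ := e₀.exists_join h
  obtain ⟨q, hqw, hqz, hqu⟩ := e.swap.exists_common h
  obtain ⟨r, hru, hrz, hrw⟩ := e.symm.swap.exists_common h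
  obtain ⟨m, p, hxm, hzm', hzm, hrm, hum, hpr, hpu, hpz, hpm⟩ := e.exists_next h hyy hru hrw hrz
  obtain ⟨m', -, hxm', hzm₁, hzm₂, hqm, -⟩ := e.symm.exists_next h hyy.symm hqw hqu hqz
  have hzz' : z ≠ z' := by
    rintro rfl
    exact e.uz' e.uz
  have hnzz : ¬G.Adj z z' := fun h' => h.cliqueFree x z z' m e.xz e.xz' hxm h' hzm hzm'
  have hmm : m' = m := by
    rcases h.eq_or_eq hzz' hnzz e.xz.symm e.xz'.symm hzm hzm' hxm.ne hzm₁ hzm₂ with h1 | h1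
    · exact absurd h1 hxm'.ne'
    · exact h1
  subst hmm
  have hqp : q = p := by
    rcases h.eq_or_eq (by rintro rfl; exact e.xu hxm) hum e.uz hzm.symm hpu hpm hpz.ne hqu hqm.symm with
      h1 | h1
    · exact absurd h1 hqz.ne'
    · exact h1
  subst hqp
  exact h.cliqueFree u w q r e.uw hqu hru hqw hrw hpr.symm

end IsLocallyMoore

end SimpleGraph

/-! ### Coordinates on the second neighbourhood -/

namespace SimpleGraph

/-- Coordinates on the first two neighbourhoods of a vertex `x` of a locally Petersen graph. The
neighbours of `x` are the `y a`, where `a` is a vertex of the Petersen graph; the two vertices other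
than `x` adjacent to `y a` and `y b`, for an edge `ab`, are `u a b 0` and `u a b 1`. The signs
`σ a b c`, for a path `abc`, tell which of the vertices over `ab` and `bc` are adjacent. -/
structure PetersenChart {V : Type*} (G : SimpleGraph V) (x : V) where
  /-- the neighbours of `x` -/
  y : Fin 10 → V
  /-- the vertices at distance two from `x` -/
  u : Fin 10 → Fin 10 → ZMod 2 → V
  /-- the signs of the paths of length two in the Petersen graph -/
  σ : Fin 10 → Fin 10 → Fin 10 → ZMod 2
  isLocallyMoore : G.IsLocallyMoore 10 3
  y_injective : Function.Injective y
  adj_y : ∀ a, G.Adj x (y a)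
  exists_y : ∀ v, G.Adj x v → ∃ a, y a = v
  y_adj_iff : ∀ a b, G.Adj (y a) (y b) ↔ petersenFin.Adj a b
  u_comm : ∀ a b i, petersenFin.Adj a b → u a b i = u b a i
  u_ne : ∀ a b i, petersenFin.Adj a b → u a b i ≠ x
  adj_u : ∀ a b i, petersenFin.Adj a b → G.Adj (y a) (u a b i)
  u_injective : ∀ a b, petersenFin.Adj a b → Function.Injective (u a b)
  adj_u_iff : ∀ a b c i j, petersenFin.Adj a b → petersenFin.Adj b c → a ≠ c →
    (G.Adj (u a b i) (u b c j) ↔ j = i + σ a b c)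

/-- The vertex `w` is at distance at least three from `x`. -/
structure IsFar {V : Type*} (G : SimpleGraph V) (x w : V) : Prop where
  ne : w ≠ x
  not_adj : ¬G.Adj x w
  not_mem : ∀ p, G.Adj x p → ¬G.Adj p w

namespace IsLocallyMoore

variable {V : Type*} {G : SimpleGraph V}

/-- Over an edge `yb` of a local graph, a vertex over the edge `ya` has a unique neighbour. -/
theorem existsUnique_adj (h : G.IsLocallyMoore 10 3) {x y b v : V} (hxv : ¬G.Adj x v)
    (hyv : G.Adj y v) (hxb : G.Adj x b) (hyb : G.Adj y b) (hvb : ¬G.Adj b v) :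
    ∃! p, p ≠ x ∧ G.Adj y p ∧ G.Adj b p ∧ G.Adj v p := by
  have hne : v ≠ b := by
    rintro rfl
    exact hxv hxb
  have hn : ¬G.Adj v b := fun h' => hvb h'.symm
  obtain ⟨p, hvp, hbp, hyp⟩ := h.exists_second hne hn hyv.symm hyb.symm
  refine ⟨p, ⟨?_, hyp, hbp, hvp⟩, ?_⟩
  · rintro rfl
    exact hxv hvp.symm
  · rintro q ⟨hq, hyq, hbq, hvq⟩
    rcases h.eq_or_eq hne hn hyv.symm hyb.symm hvp hbp hyp.ne hvq hbq with h1 | h1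
    · exact absurd h1 hyq.ne'
    · exact h1

/-- The vertices over an edge of a local graph. -/
theorem exists_pair (h : G.IsLocallyMoore 10 3) {x y z : V} (hxy : G.Adj x y) (hxz : G.Adj x z)
    (hyz : G.Adj y z) : ∃ f : ZMod 2 → V, Function.Injective f ∧ (∀ i, f i ≠ x) ∧
      (∀ i, G.Adj y (f i)) ∧ (∀ i, G.Adj z (f i)) ∧
      ∀ v, G.Adj y v → G.Adj z v → v ≠ x → ∃ i, f i = v := by
  have hx : x ∈ G.commonNeighbors y z := ⟨hxy.symm, hxz.symm⟩
  have h2 : (G.commonNeighbors y z \ {x}).ncard = 2 := by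
    rw [Set.ncard_sdiff_singleton_of_mem hx, h.ncard_of_adj _ _ hyz]
  obtain ⟨p, q, hpq, e⟩ := Set.ncard_eq_two.1 h2
  have hm : ∀ v, (G.Adj y v ∧ G.Adj z v) ∧ v ≠ x ↔ v = p ∨ v = q := fun v => by
    have := Set.ext_iff.1 e v
    simpa [mem_commonNeighbors] using this
  have hp := (hm p).2 (Or.inl rfl)
  have hq := (hm q).2 (Or.inr rfl)
  have h01 : ∀ i : ZMod 2, i = 0 ∨ i = 1 := by decide
  refine ⟨fun i => if i = 0 then p else q, ?_, ?_, ?_, ?_, ?_⟩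
  · intro i j hij
    rcases h01 i with rfl | rfl <;> rcases h01 j with rfl | rfl <;> simp_all
  · intro i; dsimp only; split_ifs; exacts [hp.2, hq.2]
  · intro i; dsimp only; split_ifs; exacts [hp.1.1, hq.1.1]
  · intro i; dsimp only; split_ifs; exacts [hp.1.2, hq.1.2]
  · intro v h1 h2 h3
    rcases (hm v).1 ⟨⟨h1, h2⟩, h3⟩ with rfl | rfl
    · exact ⟨0, by simp⟩
    · exact ⟨1, by simp⟩

theorem nonempty_petersenChart [Finite V] (h : G.IsLocallyMoore 10 3) (x : V) :
    Nonempty (G.PetersenChart x) := by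
  obtain ⟨y, hyi, hxy, hys, hy⟩ :=
    exists_local_iso (h.isTerwilligerSRG_induce (by norm_num) x).nonempty_iso_petersenFin
  have hf : ∀ a b, ∃ f : ZMod 2 → V, petersenFin.Adj a b → Function.Injective f ∧
      (∀ i, f i ≠ x) ∧ (∀ i, G.Adj (y a) (f i)) ∧ (∀ i, G.Adj (y b) (f i)) ∧
      ∀ v, G.Adj (y a) v → G.Adj (y b) v → v ≠ x → ∃ i, f i = v := by
    intro a b
    by_cases hab : petersenFin.Adj a b
    · obtain ⟨f, hf⟩ := h.exists_pair (hxy a) (hxy b) ((hy a b).2 hab)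
      exact ⟨f, fun _ => hf⟩
    · exact ⟨fun _ => x, fun h' => absurd h' hab⟩
  choose f hf using hf
  -- The order of the ends of an edge is forgotten.
  let u : Fin 10 → Fin 10 → ZMod 2 → V := fun a b => f (min a b) (max a b)
  have hu : ∀ a b, petersenFin.Adj a b → Function.Injective (u a b) ∧
      (∀ i, u a b i ≠ x) ∧ (∀ i, G.Adj (y a) (u a b i)) ∧ (∀ i, G.Adj (y b) (u a b i)) ∧
      ∀ v, G.Adj (y a) v → G.Adj (y b) v → v ≠ x → ∃ i, u a b i = v := by
    intro a b hab
    rcases le_total a b with hle | hle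
    · simp only [u, min_eq_left hle, max_eq_right hle]
      exact hf a b hab
    · simp only [u, min_eq_right hle, max_eq_left hle]
      obtain ⟨h1, h2, h3, h4, h5⟩ := hf b a hab.symm
      exact ⟨h1, h2, h4, h3, fun v hv hv' => h5 v hv' hv⟩
  have hucomm : ∀ a b, u a b = u b a := fun a b => by
    simp only [u, min_comm, max_comm]
  have hxu : ∀ a b i, petersenFin.Adj a b → ¬G.Adj x (u a b i) := fun a b i hab hx =>
    h.cliqueFree x (y a) (y b) (u a b i) (hxy a) (hxy b) hx ((hy a b).2 hab) ((hu a b hab).2.2.1 i)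
      ((hu a b hab).2.2.2.1 i)
  have hyu : ∀ a b c i, petersenFin.Adj a b → G.Adj (y c) (u a b i) → c = a ∨ c = b := by
    intro a b c i hab hc
    obtain ⟨-, h2, h3, h4, -⟩ := hu a b hab
    rcases h.eq_or_eq (h2 i).symm (hxu a b i hab) (hxy a) (h3 i).symm (hxy b) (h4 i).symm
      (fun e => hab.ne (hyi e)) (hxy c) hc.symm with e | e
    exacts [Or.inl (hyi e), Or.inr (hyi e)]
  have hstep : ∀ a b c i, petersenFin.Adj a b → petersenFin.Adj b c → a ≠ c →
      ∃ j, ∀ j', G.Adj (u a b i) (u b c j') ↔ j' = j := by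
    intro a b c i hab hbc hac
    have hcu : ¬G.Adj (y c) (u a b i) := fun hc => by
      rcases hyu a b c i hab hc with e | e
      exacts [hac e.symm, hbc.ne' e]
    obtain ⟨p, ⟨hpx, hbp, hcp, hup⟩, hp⟩ := h.existsUnique_adj (hxu a b i hab)
      ((hu a b hab).2.2.2.1 i) (hxy c) ((hy b c).2 hbc) hcu
    obtain ⟨h1, h2, h3, h4, h5⟩ := hu b c hbc
    obtain ⟨j, rfl⟩ := h5 p hbp hcp hpx
    refine ⟨j, fun j' => ⟨fun hj' => h1 (hp _ ⟨h2 j', h3 j', h4 j', hj'⟩), ?_⟩⟩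
    rintro rfl
    exact hup
  have hσ : ∀ a b c, ∃ s : ZMod 2, petersenFin.Adj a b → petersenFin.Adj b c → a ≠ c → ∀ i j,
      (G.Adj (u a b i) (u b c j) ↔ j = i + s) := by
    intro a b c
    by_cases hp : petersenFin.Adj a b ∧ petersenFin.Adj b c ∧ a ≠ c
    · obtain ⟨hab, hbc, hac⟩ := hp
      choose F hF using fun i => hstep a b c i hab hbc hac
      have hFi : Function.Injective F := by
        intro i i' e
        have h1 := (hF i _).2 rfl
        have h2 := (hF i' _).2 rfl
        rw [← e] at h2
        obtain ⟨j, hj⟩ := hstep c b a (F i) hbc.symm hab.symm hac.symm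
        rw [hucomm a b, hucomm b c] at h1 h2
        rw [(hj i).1 h1.symm, (hj i').1 h2.symm]
      have hlin : ∀ F : ZMod 2 → ZMod 2, Function.Injective F → ∃ s, ∀ i, F i = i + s := by
        unfold Function.Injective
        exact (by decide : ∀ F : Fin 2 → Fin 2, (∀ a b, F a = F b → a = b) → ∃ s, ∀ i, F i = i + s)
      obtain ⟨s, hs⟩ := hlin F hFi
      exact ⟨s, fun _ _ _ i j => by rw [hF, hs]⟩
    · exact ⟨0, fun h1 h2 h3 => absurd ⟨h1, h2, h3⟩ hp⟩
  choose σ hσ using hσ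
  exact ⟨⟨y, u, σ, h, hyi, hxy, hys, hy, fun a b i _ => by rw [hucomm],
    fun a b i hab => (hu a b hab).2.1 i, fun a b i hab => (hu a b hab).2.2.1 i,
    fun a b hab => (hu a b hab).1, fun a b c i j hab hbc hac => hσ a b c hab hbc hac i j⟩⟩

end IsLocallyMoore

namespace PetersenChart

variable {V : Type*} {G : SimpleGraph V} {x : V} (C : G.PetersenChart x) {a b c d : Fin 10}
  {i j : ZMod 2} {v w : V}

theorem adj_u' (hab : petersenFin.Adj a b) (i : ZMod 2) : G.Adj (C.y b) (C.u a b i) :=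
  C.u_comm a b i hab ▸ C.adj_u b a i hab.symm

theorem adj_u_add (hab : petersenFin.Adj a b) (hbc : petersenFin.Adj b c) (hac : a ≠ c)
    (i : ZMod 2) : G.Adj (C.u a b i) (C.u b c (i + C.σ a b c)) :=
  (C.adj_u_iff a b c i _ hab hbc hac).2 rfl

theorem not_adj_u (hab : petersenFin.Adj a b) (i : ZMod 2) : ¬G.Adj x (C.u a b i) := fun hx =>
  C.isLocallyMoore.cliqueFree x (C.y a) (C.y b) (C.u a b i) (C.adj_y a) (C.adj_y b) hx
    ((C.y_adj_iff a b).2 hab) (C.adj_u a b i hab) (C.adj_u' hab i)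

theorem y_adj_u (hab : petersenFin.Adj a b) : G.Adj (C.y c) (C.u a b i) ↔ c = a ∨ c = b := by
  constructor
  · intro hc
    rcases C.isLocallyMoore.eq_or_eq (C.u_ne a b i hab).symm (C.not_adj_u hab i) (C.adj_y a)
      (C.adj_u a b i hab).symm (C.adj_y b) (C.adj_u' hab i).symm
      (fun e => hab.ne (C.y_injective e)) (C.adj_y c) hc.symm with e | e
    exacts [Or.inl (C.y_injective e), Or.inr (C.y_injective e)]
  · rintro (rfl | rfl)
    exacts [C.adj_u _ _ i hab, C.adj_u' hab i]

theorem y_ne_u (hab : petersenFin.Adj a b) : C.y c ≠ C.u a b i := fun e =>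
  C.not_adj_u hab i (e ▸ C.adj_y c)

theorem u_eq_iff (hab : petersenFin.Adj a b) (hcd : petersenFin.Adj c d) :
    C.u a b i = C.u c d j ↔ (a = c ∧ b = d ∨ a = d ∧ b = c) ∧ i = j := by
  constructor
  · intro e
    have h1 := (C.y_adj_u hcd).1 (e ▸ C.adj_u a b i hab)
    have h2 := (C.y_adj_u hcd).1 (e ▸ C.adj_u' hab i)
    have h3 := hab.ne
    have h4 : a = c ∧ b = d ∨ a = d ∧ b = c := by grind
    refine ⟨h4, ?_⟩
    rcases h4 with ⟨rfl, rfl⟩ | ⟨rfl, rfl⟩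
    · exact C.u_injective a b hab e
    · rw [C.u_comm b a j hcd] at e
      exact C.u_injective a b hab e
  · rintro ⟨⟨rfl, rfl⟩ | ⟨rfl, rfl⟩, rfl⟩
    · rfl
    · exact C.u_comm _ _ _ hab

/-- The vertices at distance two from `x` are the `u a b i`. -/
theorem exists_u (hab : petersenFin.Adj a b) (ha : G.Adj (C.y a) v) (hb : G.Adj (C.y b) v)
    (hv : v ≠ x) : ∃ i, v = C.u a b i := by
  have hy := (C.y_adj_iff a b).2 hab
  have h2 : (G.commonNeighbors (C.y a) (C.y b) \ {x}).ncard = 2 := by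
    rw [Set.ncard_sdiff_singleton_of_mem
      (show x ∈ G.commonNeighbors _ _ from ⟨(C.adj_y a).symm, (C.adj_y b).symm⟩),
      C.isLocallyMoore.ncard_of_adj _ _ hy]
  have hm : ∀ i, C.u a b i ∈ G.commonNeighbors (C.y a) (C.y b) \ {x} := fun i =>
    ⟨⟨C.adj_u a b i hab, C.adj_u' hab i⟩, C.u_ne a b i hab⟩
  rcases Set.eq_or_eq_of_ncard_eq_two h2 (hm 0) (hm 1)
    (fun e => absurd (C.u_injective a b hab e) (by decide)) (show v ∈ _ from ⟨⟨ha, hb⟩, hv⟩) with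
    e | e
  exacts [⟨0, e⟩, ⟨1, e⟩]

theorem exists_u_of_adj (hx : v ≠ x) (hxv : ¬G.Adj x v) (ha : G.Adj (C.y a) v) :
    ∃ b i, petersenFin.Adj a b ∧ v = C.u a b i := by
  obtain ⟨q, hxq, hvq, haq⟩ := C.isLocallyMoore.exists_second hx.symm hxv (C.adj_y a) ha.symm
  obtain ⟨b, rfl⟩ := C.exists_y q hxq
  have hab := (C.y_adj_iff a b).1 haq
  obtain ⟨i, hi⟩ := C.exists_u hab ha hvq.symm hx
  exact ⟨b, i, hab, hi⟩

theorem not_adj_same (hab : petersenFin.Adj a b) : ¬G.Adj (C.u a b i) (C.u a b j) := fun hij =>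
  C.isLocallyMoore.cliqueFree (C.y a) (C.y b) _ _ ((C.y_adj_iff a b).2 hab) (C.adj_u a b i hab)
    (C.adj_u a b j hab) (C.adj_u' hab i) (C.adj_u' hab j) hij

/-- Adjacent vertices at distance two from `x` lie over edges with a common vertex. -/
theorem eq_of_adj_u (hab : petersenFin.Adj a b) (hcd : petersenFin.Adj c d)
    (hadj : G.Adj (C.u a b i) (C.u c d j)) : a = c ∨ a = d ∨ b = c ∨ b = d := by
  by_contra! hne
  have hn : ∀ {e f g : Fin 10} {t : ZMod 2}, petersenFin.Adj e f → g ≠ e → g ≠ f →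
      ¬G.Adj (C.u e f t) (C.y g) := fun hef h1 h2 h3 =>
    ((C.y_adj_u hef).1 h3.symm).elim h1 h2
  exact C.isLocallyMoore.not_isCrossEdge (x := x) (y := C.y a) (z := C.y b) (u := C.u a b i)
    (y' := C.y c) (z' := C.y d) (w := C.u c d j)
    ⟨C.adj_y a, C.adj_y b, (C.y_adj_iff a b).2 hab, (C.adj_u a b i hab).symm,
      (C.adj_u' hab i).symm, C.not_adj_u hab i, C.adj_y c, C.adj_y d, (C.y_adj_iff c d).2 hcd,
      (C.adj_u c d j hcd).symm, (C.adj_u' hcd j).symm, C.not_adj_u hcd j, hadj,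
      hn hcd hne.1 hne.2.1, hn hcd hne.2.2.1 hne.2.2.2, hn hab hne.1.symm hne.2.2.1.symm,
      hn hab hne.2.1.symm hne.2.2.2.symm⟩

theorem sigma_comm (hab : petersenFin.Adj a b) (hbc : petersenFin.Adj b c) (hac : a ≠ c) :
    C.σ c b a = C.σ a b c := by
  have h1 := C.adj_u_add hab hbc hac 0
  rw [C.u_comm a b _ hab, C.u_comm b c _ hbc] at h1
  have h2 := (C.adj_u_iff c b a _ _ hbc.symm hab.symm hac.symm).1 h1.symm
  revert h2
  generalize C.σ a b c = s
  generalize C.σ c b a = t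
  revert s t
  decide

/-- The three edges at a vertex of the Petersen graph have signs with sum `1`, because the local
graph at `y b` has no triangles. -/
theorem sigma_triangle (hba : petersenFin.Adj b a) (hbc : petersenFin.Adj b c)
    (hbd : petersenFin.Adj b d) (hac : a ≠ c) (hcd : c ≠ d) (had : a ≠ d) :
    C.σ a b c + C.σ c b d + C.σ a b d = 1 := by
  have h01 : ∀ s : ZMod 2, s ≠ 1 → s = 0 := by decide
  by_contra hne
  have h0 := h01 _ hne
  have e : ∀ r s t : ZMod 2, r + s + t = 0 → 0 + t = 0 + r + s := by decide
  have h1 := C.adj_u_add hba.symm hbc hac 0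
  have h2 := C.adj_u_add hbc.symm hbd hcd (0 + C.σ a b c)
  have h3 := C.adj_u_add hba.symm hbd had 0
  rw [C.u_comm c b _ hbc.symm] at h2
  rw [e _ _ _ h0] at h3
  exact C.isLocallyMoore.cliqueFree (C.y b) _ _ _ (C.adj_u' hba.symm 0) (C.adj_u b c _ hbc)
    (C.adj_u b d _ hbd) h1 h3 h2

/-! ### Vertices at distance at least three -/

theorem isFar_iff : G.IsFar x w ↔ w ≠ x ∧ (∀ a, w ≠ C.y a) ∧
    ∀ a b i, petersenFin.Adj a b → w ≠ C.u a b i := by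
  constructor
  · rintro ⟨h1, h2, h3⟩
    refine ⟨h1, ?_, ?_⟩
    · rintro a rfl
      exact h2 (C.adj_y a)
    · rintro a b i hab rfl
      exact h3 _ (C.adj_y a) (C.adj_u a b i hab)
  · rintro ⟨h1, h2, h3⟩
    have h4 : ¬G.Adj x w := fun hw => by
      obtain ⟨a, rfl⟩ := C.exists_y w hw
      exact h2 a rfl
    refine ⟨h1, h4, fun p hp hpw => ?_⟩
    obtain ⟨a, rfl⟩ := C.exists_y p hp
    obtain ⟨b, i, hab, rfl⟩ := C.exists_u_of_adj h1 h4 hpw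
    exact h3 a b i hab rfl

theorem not_isFar_u (hab : petersenFin.Adj a b) : ¬G.IsFar x (C.u a b i) := fun hf =>
  (C.isFar_iff.1 hf).2.2 a b i hab rfl

theorem not_adj_y (hw : G.IsFar x w) : ¬G.Adj (C.y a) w := hw.not_mem _ (C.adj_y a)

theorem exists_u_of_not_isFar (hw : ¬G.IsFar x w) (h1 : w ≠ x) (h2 : ∀ a, w ≠ C.y a) :
    ∃ a b i, petersenFin.Adj a b ∧ w = C.u a b i := by
  rw [C.isFar_iff] at hw
  push Not at hw
  exact hw h1 h2

/-- A neighbour of `u a b i` that is adjacent to neither `y a` nor `y b` is far from `x`. -/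
theorem isFar_of_adj (hab : petersenFin.Adj a b) (hw : G.Adj (C.u a b i) w)
    (ha : ¬G.Adj (C.y a) w) (hb : ¬G.Adj (C.y b) w) : G.IsFar x w := by
  rw [C.isFar_iff]
  refine ⟨?_, ?_, ?_⟩
  · rintro rfl
    exact C.not_adj_u hab i hw.symm
  · rintro c rfl
    have hya := (C.y_adj_iff a b).2 hab
    rcases (C.y_adj_u hab).1 hw.symm with rfl | rfl
    exacts [hb hya.symm, ha hya]
  · rintro c d j hcd rfl
    rcases C.eq_of_adj_u hab hcd hw with rfl | rfl | rfl | rfl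
    exacts [ha (C.adj_u _ _ _ hcd), ha (C.adj_u' hcd _), hb (C.adj_u _ _ _ hcd),
      hb (C.adj_u' hcd _)]

/-- If a far vertex has a neighbour over an edge at `a`, then it has exactly one neighbour over
another edge at `a`, and these two are adjacent. -/
theorem exists_next_u (hw : G.IsFar x w) (hab : petersenFin.Adj a b) (hu : G.Adj w (C.u a b i)) :
    ∃ c, petersenFin.Adj a c ∧ b ≠ c ∧ G.Adj w (C.u a c (i + C.σ b a c)) := by
  have hwa : w ≠ C.y a := (C.isFar_iff.1 hw).2.1 a
  obtain ⟨p, hwp, hap, hup⟩ := C.isLocallyMoore.exists_second hwa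
    (fun h' => C.not_adj_y hw h'.symm) hu (C.adj_u a b i hab)
  have hxp : ¬G.Adj x p := fun h' => hw.not_mem p h' hwp.symm
  have hpx : p ≠ x := by
    rintro rfl
    exact hw.not_adj hwp.symm
  obtain ⟨c, j, hac, rfl⟩ := C.exists_u_of_adj hpx hxp hap
  have hbc : b ≠ c := by
    rintro rfl
    exact C.not_adj_same hab hup
  refine ⟨c, hac, hbc, ?_⟩
  rw [C.u_comm a b i hab] at hup
  rwa [← (C.adj_u_iff b a c i j hab.symm hac hbc).1 hup]

/-- A far vertex has at most two neighbours over the edges at `a`. -/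
theorem eq_or_eq_of_adj (hw : G.IsFar x w) {k : ZMod 2} (hab : petersenFin.Adj a b)
    (hac : petersenFin.Adj a c) (had : petersenFin.Adj a d) (hb : G.Adj w (C.u a b i))
    (hc : G.Adj w (C.u a c j)) (hbc : b ≠ c) (hd : G.Adj w (C.u a d k)) :
    C.u a d k = C.u a b i ∨ C.u a d k = C.u a c j :=
  C.isLocallyMoore.eq_or_eq ((C.isFar_iff.1 hw).2.1 a) (fun h' => C.not_adj_y hw h'.symm) hb
    (C.adj_u a b i hab) hc (C.adj_u a c j hac)
    (fun e => by have := ((C.u_eq_iff hab hac).1 e).1; grind) hd (C.adj_u a d k had)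

end PetersenChart

end SimpleGraph

/-! ### Induced cycles in the Petersen graph -/

/-- The set `S` of vertices of the Petersen graph induces a graph in which all valencies are two:
every vertex of `S` has exactly one neighbour outside `S`. -/
def IsPetersenCycle (S : Fin 10 → Bool) : Prop :=
  ∀ i, S i = true → ∃ t, ∀ s, S (petersenNbr i s) = true ↔ s ≠ t

instance : DecidablePred IsPetersenCycle := fun S =>
  inferInstanceAs (Decidable (∀ i, S i = true → ∃ t, ∀ s, S (petersenNbr i s) = true ↔ s ≠ t))

/-- The characteristic function of a set of vertices of the Petersen graph, from its values. -/
theorem petersen_forall {p : (Fin 10 → Bool) → Prop}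
    (h : ∀ b₀ b₁ b₂ b₃ b₄ b₅ b₆ b₇ b₈ b₉ : Bool, p ![b₀, b₁, b₂, b₃, b₄, b₅, b₆, b₇, b₈, b₉]) (S) :
    p S := by
  have e : S = ![S 0, S 1, S 2, S 3, S 4, S 5, S 6, S 7, S 8, S 9] := by
    funext i
    fin_cases i <;> rfl
  rw [e]
  exact h ..

namespace IsPetersenCycle

variable {S : Fin 10 → Bool}

theorem card_eq : IsPetersenCycle S → (∃ i, S i = true) →
    (Finset.univ.filter (S · = true)).card = 5 ∨ (Finset.univ.filter (S · = true)).card = 6 := by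
  refine petersen_forall (p := fun S => IsPetersenCycle S → (∃ i, S i = true) →
    (Finset.univ.filter (S · = true)).card = 5 ∨ (Finset.univ.filter (S · = true)).card = 6) ?_ S
  decide +kernel

set_option synthInstance.maxSize 1000 in
set_option synthInstance.maxHeartbeats 200000 in
theorem pentagon : IsPetersenCycle S → (Finset.univ.filter (S · = true)).card = 5 →
    ∀ p, S p = true → ∀ v, S v = true → petersenFin.Adj p v → ∀ q, S q = true →
    petersenFin.Adj v q → p ≠ q → ∃ r, (S r = true ∧ petersenFin.Adj q r ∧ r ≠ v) ∧
      ∃ s, (S s = true ∧ petersenFin.Adj r s ∧ s ≠ q) ∧ petersenFin.Adj s p ∧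
      ∀ t, S t = true → t = p ∨ t = v ∨ t = q ∨ t = r ∨ t = s := by
  refine petersen_forall (p := fun S => IsPetersenCycle S →
    (Finset.univ.filter (S · = true)).card = 5 →
    ∀ p, S p = true → ∀ v, S v = true → petersenFin.Adj p v → ∀ q, S q = true →
    petersenFin.Adj v q → p ≠ q → ∃ r, (S r = true ∧ petersenFin.Adj q r ∧ r ≠ v) ∧
      ∃ s, (S s = true ∧ petersenFin.Adj r s ∧ s ≠ q) ∧ petersenFin.Adj s p ∧
      ∀ t, S t = true → t = p ∨ t = v ∨ t = q ∨ t = r ∨ t = s) ?_ S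
  decide +kernel

theorem exists_adj_of_pentagon : IsPetersenCycle S →
    (Finset.univ.filter (S · = true)).card = 5 →
    ∀ i, S i = false → ∃ j, S j = true ∧ petersenFin.Adj i j := by
  refine petersen_forall (p := fun S => IsPetersenCycle S →
    (Finset.univ.filter (S · = true)).card = 5 →
    ∀ i, S i = false → ∃ j, S j = true ∧ petersenFin.Adj i j) ?_ S
  decide +kernel

set_option synthInstance.maxSize 1000 in
set_option synthInstance.maxHeartbeats 200000 in
theorem hexagon : IsPetersenCycle S → (Finset.univ.filter (S · = true)).card = 6 →
    ∀ p, S p = true → ∀ v, S v = true → petersenFin.Adj p v → ∀ q, S q = true →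
    petersenFin.Adj v q → p ≠ q → ∃ r, (S r = true ∧ petersenFin.Adj q r ∧ r ≠ v) ∧
      ∃ s, (S s = true ∧ petersenFin.Adj r s ∧ s ≠ q) ∧
      ∃ t, (S t = true ∧ petersenFin.Adj s t ∧ t ≠ r) ∧ petersenFin.Adj t p ∧
      ∀ z, S z = true → z = p ∨ z = v ∨ z = q ∨ z = r ∨ z = s ∨ z = t := by
  refine petersen_forall (p := fun S => IsPetersenCycle S →
    (Finset.univ.filter (S · = true)).card = 6 →
    ∀ p, S p = true → ∀ v, S v = true → petersenFin.Adj p v → ∀ q, S q = true →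
    petersenFin.Adj v q → p ≠ q → ∃ r, (S r = true ∧ petersenFin.Adj q r ∧ r ≠ v) ∧
      ∃ s, (S s = true ∧ petersenFin.Adj r s ∧ s ≠ q) ∧
      ∃ t, (S t = true ∧ petersenFin.Adj s t ∧ t ≠ r) ∧ petersenFin.Adj t p ∧
      ∀ z, S z = true → z = p ∨ z = v ∨ z = q ∨ z = r ∨ z = s ∨ z = t) ?_ S
  decide +kernel

/-- Outside a hexagon of the Petersen graph lie its centre, not adjacent to the hexagon, and the
three neighbours of the centre, each adjacent to the hexagon. -/
theorem exists_centre_of_hexagon : IsPetersenCycle S →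
    (Finset.univ.filter (S · = true)).card = 6 → ∃ c, S c = false ∧
      (∀ k, petersenFin.Adj c k → S k = false) ∧
      ∀ j, S j = false → j ≠ c → petersenFin.Adj c j ∧ ∃ k, S k = true ∧ petersenFin.Adj j k := by
  refine petersen_forall (p := fun S => IsPetersenCycle S →
    (Finset.univ.filter (S · = true)).card = 6 → ∃ c, S c = false ∧
      (∀ k, petersenFin.Adj c k → S k = false) ∧
      ∀ j, S j = false → j ≠ c → petersenFin.Adj c j ∧ ∃ k, S k = true ∧ petersenFin.Adj j k) ?_ S
  decide +kernel

end IsPetersenCycle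

/-! ### The cycle under a vertex at distance three -/

theorem petersenFin_no_triangle : ∀ a b, petersenFin.Adj a b → ∀ c, petersenFin.Adj b c →
    ¬petersenFin.Adj c a := by
  decide +kernel

theorem petersenFin_no_square : ∀ a b, petersenFin.Adj a b → ∀ c, petersenFin.Adj b c → a ≠ c →
    ∀ d, petersenFin.Adj c d → b ≠ d → ¬petersenFin.Adj d a := by
  decide +kernel

theorem petersenNbr_injective : ∀ i s t, petersenNbr i s = petersenNbr i t → s = t := by
  decide +kernel

namespace SimpleGraph

/-- The neighbours of `w` that are not at distance three or more from `x`. -/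
def lower {V : Type*} (G : SimpleGraph V) (x w : V) : Set V :=
  {v | G.Adj w v ∧ ¬G.IsFar x v}

namespace PetersenChart

variable {V : Type*} {G : SimpleGraph V} {x : V} (C : G.PetersenChart x) {a b c d : Fin 10}
  {i j : ZMod 2} {v w : V}

theorem mem_lower (hw : G.IsFar x w) :
    v ∈ G.lower x w ↔ ∃ a b i, petersenFin.Adj a b ∧ v = C.u a b i ∧ G.Adj w v := by
  constructor
  · rintro ⟨h1, h2⟩
    obtain ⟨a, b, i, hab, rfl⟩ := C.exists_u_of_not_isFar h2
      (by rintro rfl; exact hw.not_adj h1.symm) (by rintro a rfl; exact C.not_adj_y hw h1.symm)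
    exact ⟨a, b, i, hab, rfl, h1⟩
  · rintro ⟨a, b, i, hab, rfl, h⟩
    exact ⟨h, C.not_isFar_u hab⟩

theorem u_mem_lower (hab : petersenFin.Adj a b) :
    C.u a b i ∈ G.lower x w ↔ G.Adj w (C.u a b i) :=
  ⟨And.left, fun h => ⟨h, C.not_isFar_u hab⟩⟩

/-- The lower neighbours of a far vertex that are adjacent to the lower neighbour `u a b i`: one of
them lies over an edge at `a` and one over an edge at `b`. -/
theorem exists_lower_adj (hw : G.IsFar x w) (hab : petersenFin.Adj a b)
    (hu : G.Adj w (C.u a b i)) : ∃ c d, (petersenFin.Adj a c ∧ b ≠ c ∧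
      G.Adj w (C.u a c (i + C.σ b a c))) ∧ (petersenFin.Adj b d ∧ a ≠ d ∧
      G.Adj w (C.u b d (i + C.σ a b d))) ∧
      ∀ r ∈ G.lower x w, G.Adj (C.u a b i) r →
        r = C.u a c (i + C.σ b a c) ∨ r = C.u b d (i + C.σ a b d) := by
  have hu' : G.Adj w (C.u b a i) := C.u_comm a b i hab ▸ hu
  obtain ⟨c, hac, hbc, hc⟩ := C.exists_next_u hw hab hu
  obtain ⟨d, hbd, had, hd⟩ := C.exists_next_u hw hab.symm hu'
  refine ⟨c, d, ⟨hac, hbc, hc⟩, ⟨hbd, had, hd⟩, ?_⟩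
  -- At each end of `ab`, the vertex `w` has only one other neighbour.
  have key : ∀ {a b c e : Fin 10} {j k : ZMod 2}, petersenFin.Adj a b → petersenFin.Adj a c →
      petersenFin.Adj a e → b ≠ c → G.Adj w (C.u a b i) → G.Adj w (C.u a c k) →
      G.Adj w (C.u a e j) → G.Adj (C.u a b i) (C.u a e j) → C.u a e j = C.u a c k := by
    intro a b c e j k hab hac hae hbc h1 h2 h3 h4
    rcases C.eq_or_eq_of_adj hw hab hac hae h1 h2 hbc h3 with e | e
    · exact absurd e h4.ne'
    · exact e
  intro r hr hur
  obtain ⟨e, f, j, hef, rfl, hwr⟩ := (C.mem_lower hw).1 hr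
  rcases C.eq_of_adj_u hab hef hur with rfl | rfl | rfl | rfl
  · exact Or.inl (key hab hac hef hbc hu hc hwr hur)
  · rw [C.u_comm _ _ _ hef] at hwr hur ⊢
    exact Or.inl (key hab hac hef.symm hbc hu hc hwr hur)
  · rw [C.u_comm _ _ _ hab] at hur
    exact Or.inr (key hab.symm hbd hef had hu' hd hwr hur)
  · rw [C.u_comm _ _ _ hab, C.u_comm _ _ _ hef] at hur
    rw [C.u_comm _ _ _ hef] at hwr ⊢
    exact Or.inr (key hab.symm hbd hef.symm had hu' hd hwr hur)

/-- Following the lower neighbours of a far vertex one traces a path in the Petersen graph. -/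
theorem exists_step (hw : G.IsFar x w) (hab : petersenFin.Adj a b) (hbc : petersenFin.Adj b c)
    (hac : a ≠ c) (h1 : G.Adj w (C.u a b i)) (h2 : G.Adj w (C.u b c j))
    {r : V} (hr : r ∈ G.lower x w) (hr2 : G.Adj (C.u b c j) r) (hr1 : r ≠ C.u a b i) :
    ∃ d, petersenFin.Adj c d ∧ b ≠ d ∧ r = C.u c d (j + C.σ b c d) := by
  obtain ⟨e, d, ⟨hbe, hce, he⟩, ⟨hcd, hbd, hd⟩, hall⟩ := C.exists_lower_adj hw hbc h2
  rcases hall r hr hr2 with rfl | rfl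
  · rw [C.u_comm a b i hab] at hr1 h1
    rcases C.eq_or_eq_of_adj hw hab.symm hbc hbe h1 h2 hac he with h3 | h3
    · exact absurd h3 hr1
    · exact absurd h3 hr2.ne'
  · exact ⟨d, hcd, hbd, rfl⟩

variable [Finite V]

/-- A numbering of the local graph at a vertex at distance three, in which the lower neighbours
form an induced cycle of the Petersen graph. -/
theorem exists_cycle (C : G.PetersenChart x) (hw : G.IsFar x w) :
    ∃ (z : Fin 10 → V) (S : Fin 10 → Bool), Function.Injective z ∧
    (∀ i, G.Adj w (z i)) ∧ (∀ v, G.Adj w v → ∃ i, z i = v) ∧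
    (∀ i j, G.Adj (z i) (z j) ↔ petersenFin.Adj i j) ∧ (∀ i, S i = true ↔ z i ∈ G.lower x w) ∧
    IsPetersenCycle S ∧ (Finset.univ.filter (S · = true)).card = (G.lower x w).ncard := by
  classical
  obtain ⟨z, hzi, hwz, hzs, hz⟩ := IsLocallyMoore.exists_local_iso
    (C.isLocallyMoore.isTerwilligerSRG_induce (by norm_num) w).nonempty_iso_petersenFin
  refine ⟨z, fun i => decide (z i ∈ G.lower x w), hzi, hwz, hzs, hz, fun i => by simp, ?_, ?_⟩
  · intro k hk
    obtain ⟨a, b, i, hab, hzk, hu⟩ := (C.mem_lower hw).1 (by simpa using hk)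
    rw [hzk] at hu
    obtain ⟨c, d, ⟨hac, hbc, hc⟩, ⟨hbd, had, hd⟩, hall⟩ := C.exists_lower_adj hw hab hu
    obtain ⟨p, hp⟩ := hzs _ hc
    obtain ⟨q, hq⟩ := hzs _ hd
    have hkp : petersenFin.Adj k p := by
      rw [← hz, hzk, hp, C.u_comm a b i hab]
      exact C.adj_u_add hab.symm hac hbc i
    have hkq : petersenFin.Adj k q := by
      rw [← hz, hzk, hq]
      exact C.adj_u_add hab hbd had i
    have hpq : p ≠ q := by
      rintro rfl
      have := ((C.u_eq_iff hac hbd).1 (hp.symm.trans hq)).1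
      have := hab.ne
      grind
    obtain ⟨s, rfl⟩ := hkp
    obtain ⟨t, rfl⟩ := hkq
    have third : ∀ s t : Fin 3, s ≠ t → ∃ r, ∀ m, m ≠ r ↔ m = s ∨ m = t := by decide
    obtain ⟨r, hr⟩ := third s t (fun e => hpq (e ▸ rfl))
    refine ⟨r, fun m => ?_⟩
    rw [hr, decide_eq_true_iff]
    constructor
    · intro hm
      have hadj : G.Adj (C.u a b i) (z (petersenNbr k m)) := hzk ▸ (hz _ _).2 ⟨m, rfl⟩
      rcases hall _ hm hadj with e | e
      · exact Or.inl (petersenNbr_injective _ _ _ (hzi (e.trans hp.symm)))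
      · exact Or.inr (petersenNbr_injective _ _ _ (hzi (e.trans hq.symm)))
    · rintro (rfl | rfl)
      · rw [hp]; exact (C.u_mem_lower hac).2 hc
      · rw [hq]; exact (C.u_mem_lower hbd).2 hd
  · have e : G.lower x w = z '' {i | z i ∈ G.lower x w} := by
      ext v
      constructor
      · intro hv
        obtain ⟨i, rfl⟩ := hzs v hv.1
        exact ⟨i, hv, rfl⟩
      · rintro ⟨i, hi, rfl⟩
        exact hi
    conv_rhs => rw [e, Set.ncard_image_of_injective _ hzi]
    rw [← Set.ncard_coe_finset]
    congr 1
    ext i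
    simp

theorem ncard_lower (C : G.PetersenChart x) (hw : G.IsFar x w) (hne : (G.lower x w).Nonempty) :
    (G.lower x w).ncard = 5 ∨ (G.lower x w).ncard = 6 := by
  obtain ⟨z, S, hzi, hwz, hzs, hz, hS, hcyc, hcard⟩ := C.exists_cycle hw
  rw [← hcard]
  obtain ⟨v, hv⟩ := hne
  obtain ⟨i, rfl⟩ := hzs v hv.1
  exact hcyc.card_eq ⟨i, (hS i).2 hv⟩

theorem exists_lower_of_pentagon (C : G.PetersenChart x) (hw : G.IsFar x w) (hn : (G.lower x w).ncard = 5)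
    (hv : G.Adj w v) : ∃ r ∈ G.lower x w, v ∈ G.lower x w ∨ G.Adj v r := by
  obtain ⟨z, S, hzi, hwz, hzs, hz, hS, hcyc, hcard⟩ := C.exists_cycle hw
  obtain ⟨i, rfl⟩ := hzs v hv
  by_cases hi : z i ∈ G.lower x w
  · exact ⟨_, hi, Or.inl hi⟩
  · obtain ⟨j, hj, hij⟩ := hcyc.exists_adj_of_pentagon (hcard.trans hn) i
      (by rw [← hS] at hi; simpa using hi)
    exact ⟨z j, (hS j).1 hj, Or.inr ((hz _ _).2 hij)⟩

/-- If the lower neighbours of a vertex at distance three form a hexagon, then of its other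
neighbours one, the centre, is not adjacent to the hexagon, and the others are adjacent to the
centre and to the hexagon. -/
theorem exists_centre (C : G.PetersenChart x) (hw : G.IsFar x w) (hn : (G.lower x w).ncard = 6) :
    ∃ m, G.Adj w m ∧ G.IsFar x m ∧ (∀ k ∈ G.lower x w, ¬G.Adj m k) ∧
      ∀ j, G.Adj w j → G.IsFar x j → j ≠ m →
        G.Adj m j ∧ ∃ k ∈ G.lower x w, G.Adj j k := by
  obtain ⟨z, S, hzi, hwz, hzs, hz, hS, hcyc, hcard⟩ := C.exists_cycle hw
  have hS' : ∀ i, S i = false ↔ G.IsFar x (z i) := fun i => by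
    rw [← Bool.not_eq_true, hS, lower, Set.mem_ofPred_eq, not_and, not_not]
    exact ⟨fun h => h (hwz i), fun h _ => h⟩
  obtain ⟨m, hm, hm1, hm2⟩ := hcyc.exists_centre_of_hexagon (hcard.trans hn)
  refine ⟨z m, hwz m, (hS' m).1 hm, ?_, ?_⟩
  · intro k hk hmk
    obtain ⟨k, rfl⟩ := hzs k hk.1
    exact hk.2 ((hS' k).1 (hm1 k ((hz _ _).1 hmk)))
  · intro j hj hjf hjm
    obtain ⟨j, rfl⟩ := hzs j hj
    obtain ⟨h1, k, hk, hjk⟩ := hm2 j ((hS' j).2 hjf) (fun e => hjm (e ▸ rfl))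
    exact ⟨(hz _ _).2 h1, z k, (hS k).1 hk, (hz _ _).2 hjk⟩

/-- If a vertex at distance three has five lower neighbours, these lie over a pentagon of the
Petersen graph, and the signs along the pentagon have sum zero. -/
theorem exists_pentagon (hw : G.IsFar x w) (hn : (G.lower x w).ncard = 5)
    (hab : petersenFin.Adj a b) (hbc : petersenFin.Adj b c) (hcd : petersenFin.Adj c d)
    (hac : a ≠ c) (hbd : b ≠ d) (h0 : G.Adj w (C.u a b i))
    (h1 : G.Adj w (C.u b c (i + C.σ a b c)))
    (h2 : G.Adj w (C.u c d (i + C.σ a b c + C.σ b c d))) :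
    ∃ e, petersenFin.Adj d e ∧ petersenFin.Adj e a ∧
      i + C.σ a b c + C.σ b c d + C.σ c d e + C.σ d e a + C.σ e a b = i ∧
      ∀ t, t ∈ G.lower x w ↔ t = C.u a b i ∨ t = C.u b c (i + C.σ a b c) ∨
        t = C.u c d (i + C.σ a b c + C.σ b c d) ∨
        t = C.u d e (i + C.σ a b c + C.σ b c d + C.σ c d e) ∨
        t = C.u e a (i + C.σ a b c + C.σ b c d + C.σ c d e + C.σ d e a) := by
  obtain ⟨z, S, hzi, hwz, hzs, hz, hS, hcyc, hcard⟩ := C.exists_cycle hw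
  obtain ⟨p, hp⟩ := hzs _ h0
  obtain ⟨v, hv⟩ := hzs _ h1
  obtain ⟨q, hq⟩ := hzs _ h2
  have hSp : S p = true := (hS p).2 (hp ▸ (C.u_mem_lower hab).2 h0)
  have hSv : S v = true := (hS v).2 (hv ▸ (C.u_mem_lower hbc).2 h1)
  have hSq : S q = true := (hS q).2 (hq ▸ (C.u_mem_lower hcd).2 h2)
  have hpv : petersenFin.Adj p v := by
    rw [← hz, hp, hv]
    exact C.adj_u_add hab hbc hac i
  have hvq : petersenFin.Adj v q := by
    rw [← hz, hv, hq]
    exact C.adj_u_add hbc hcd hbd _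
  have hpq : p ≠ q := by
    rintro rfl
    have := ((C.u_eq_iff hab hcd).1 (hp.symm.trans hq)).1
    have := hbc.ne
    grind
  obtain ⟨r, ⟨hSr, hqr, hrv⟩, s, ⟨hSs, hrs, hsq⟩, hsp, hall⟩ :=
    hcyc.pentagon (hcard.trans hn) p hSp v hSv hpv q hSq hvq hpq
  have hadj : ∀ {i j}, petersenFin.Adj i j → G.Adj (z i) (z j) := (hz _ _).2
  obtain ⟨e, hde, hce, hr⟩ := C.exists_step hw hbc hcd hbd h1 h2 ((hS r).1 hSr)
    (hq ▸ hadj hqr) (hv ▸ hzi.ne hrv)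
  have h3 := hr ▸ hwz r
  obtain ⟨f, hef, hdf, hs⟩ := C.exists_step hw hcd hde hce h2 h3 ((hS s).1 hSs)
    (hr ▸ hadj hrs) (hq ▸ hzi.ne hsq)
  have hsp' := hadj hsp
  rw [hs, hp] at hsp'
  have hfa : f = a := by
    rcases C.eq_of_adj_u hef hab hsp' with rfl | rfl | rfl | rfl
    · exact absurd hde (petersenFin_no_square _ _ hab _ hbc hac _ hcd hbd)
    · exact absurd hde (petersenFin_no_triangle _ _ hbc _ hcd)
    · rfl
    · exact absurd hef (petersenFin_no_square _ _ hbc _ hcd hbd _ hde hce)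
  subst hfa
  have heb : e ≠ b := by
    rintro rfl
    exact petersenFin_no_triangle _ _ hbc _ hcd hde
  refine ⟨e, hde, hef, ((C.adj_u_iff _ _ _ _ _ hef hab heb).1 hsp').symm, fun t => ?_⟩
  rw [← hp, ← hv, ← hq, ← hr, ← hs]
  constructor
  · intro ht
    obtain ⟨t, rfl⟩ := hzs t ht.1
    rcases hall t ((hS t).2 ht) with rfl | rfl | rfl | rfl | rfl <;> simp
  · rintro (rfl | rfl | rfl | rfl | rfl)
    exacts [(hS _).1 hSp, (hS _).1 hSv, (hS _).1 hSq, (hS _).1 hSr, (hS _).1 hSs]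

/-- If a vertex at distance three has six lower neighbours, these lie over a hexagon of the
Petersen graph, and the signs along the hexagon have sum zero. -/
theorem exists_hexagon (hw : G.IsFar x w) (hn : (G.lower x w).ncard = 6)
    (hab : petersenFin.Adj a b) (hbc : petersenFin.Adj b c) (hcd : petersenFin.Adj c d)
    (hac : a ≠ c) (hbd : b ≠ d) (h0 : G.Adj w (C.u a b i))
    (h1 : G.Adj w (C.u b c (i + C.σ a b c)))
    (h2 : G.Adj w (C.u c d (i + C.σ a b c + C.σ b c d))) :
    ∃ e f, petersenFin.Adj d e ∧ petersenFin.Adj e f ∧ petersenFin.Adj f a ∧ c ≠ e ∧ d ≠ f ∧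
      e ≠ a ∧ f ≠ b ∧ i + C.σ a b c + C.σ b c d + C.σ c d e + C.σ d e f + C.σ e f a + C.σ f a b = i ∧
      ∀ t, t ∈ G.lower x w ↔ t = C.u a b i ∨ t = C.u b c (i + C.σ a b c) ∨
        t = C.u c d (i + C.σ a b c + C.σ b c d) ∨
        t = C.u d e (i + C.σ a b c + C.σ b c d + C.σ c d e) ∨
        t = C.u e f (i + C.σ a b c + C.σ b c d + C.σ c d e + C.σ d e f) ∨
        t = C.u f a (i + C.σ a b c + C.σ b c d + C.σ c d e + C.σ d e f + C.σ e f a) := by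
  obtain ⟨z, S, hzi, hwz, hzs, hz, hS, hcyc, hcard⟩ := C.exists_cycle hw
  obtain ⟨p, hp⟩ := hzs _ h0
  obtain ⟨v, hv⟩ := hzs _ h1
  obtain ⟨q, hq⟩ := hzs _ h2
  have hSp : S p = true := (hS p).2 (hp ▸ (C.u_mem_lower hab).2 h0)
  have hSv : S v = true := (hS v).2 (hv ▸ (C.u_mem_lower hbc).2 h1)
  have hSq : S q = true := (hS q).2 (hq ▸ (C.u_mem_lower hcd).2 h2)
  have hpv : petersenFin.Adj p v := by
    rw [← hz, hp, hv]
    exact C.adj_u_add hab hbc hac i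
  have hvq : petersenFin.Adj v q := by
    rw [← hz, hv, hq]
    exact C.adj_u_add hbc hcd hbd _
  have hpq : p ≠ q := by
    rintro rfl
    have := ((C.u_eq_iff hab hcd).1 (hp.symm.trans hq)).1
    have := hbc.ne
    grind
  obtain ⟨r, ⟨hSr, hqr, hrv⟩, s, ⟨hSs, hrs, hsq⟩, m, ⟨hSm, hsm, hmr⟩, hmp, hall⟩ :=
    hcyc.hexagon (hcard.trans hn) p hSp v hSv hpv q hSq hvq hpq
  have hadj : ∀ {i j}, petersenFin.Adj i j → G.Adj (z i) (z j) := (hz _ _).2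
  obtain ⟨e, hde, hce, hr⟩ := C.exists_step hw hbc hcd hbd h1 h2 ((hS r).1 hSr)
    (hq ▸ hadj hqr) (hv ▸ hzi.ne hrv)
  have h3 := hr ▸ hwz r
  obtain ⟨f, hef, hdf, hs⟩ := C.exists_step hw hcd hde hce h2 h3 ((hS s).1 hSs)
    (hr ▸ hadj hrs) (hq ▸ hzi.ne hsq)
  have h4 := hs ▸ hwz s
  obtain ⟨g, hfg, heg, hm⟩ := C.exists_step hw hde hef hdf h3 h4 ((hS m).1 hSm)
    (hs ▸ hadj hsm) (hr ▸ hzi.ne hmr)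
  have hmp' := hadj hmp
  rw [hm, hp] at hmp'
  -- A path that closes up after five steps would give a vertex with three lower neighbours.
  have hea : e ≠ a := by
    rintro rfl
    exact petersenFin_no_square _ _ hab _ hbc hac _ hcd hbd hde
  have hfb : f ≠ b := by
    rintro rfl
    exact petersenFin_no_square _ _ hbc _ hcd hbd _ hde hce hef
  have hfa : f ≠ a := by
    rintro rfl
    have heb : e ≠ b := by
      rintro rfl
      exact petersenFin_no_triangle _ _ hbc _ hcd hde
    rw [C.u_comm _ _ _ hef] at h4 hs
    rcases C.eq_or_eq_of_adj hw hef.symm hab hfg h4 h0 heb (hm ▸ hwz m) with h5 | h5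
    · exact (hadj hsm).ne (hs.trans (h5.symm.trans hm.symm))
    · exact hmp'.ne h5
  have hgb : g ≠ b := by
    rintro rfl
    have h5 := hm ▸ hwz m
    rw [C.u_comm _ _ _ hfg] at h5 hmp' hm
    rw [C.u_comm _ _ _ hab] at h0 hmp'
    rcases C.eq_or_eq_of_adj hw hab.symm hbc hfg.symm h0 h1 hac h5 with h6 | h6
    · exact hmp'.ne h6
    · have h7 := ((C.u_eq_iff hfg.symm hbc).1 h6).1
      have h8 : f = c := by
        have := hbc.ne
        grind
      subst h8
      exact petersenFin_no_triangle _ _ hcd _ hde hef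
  have hga : g = a := by
    rcases C.eq_of_adj_u hfg hab hmp' with h5 | h5 | h5 | h5
    exacts [absurd h5 hfa, absurd h5 hfb, h5, absurd h5 hgb]
  subst hga
  refine ⟨e, f, hde, hef, hfg, hce, hdf, hea, hfb,
    ((C.adj_u_iff _ _ _ _ _ hfg hab hfb).1 hmp').symm, fun t => ?_⟩
  rw [← hp, ← hv, ← hq, ← hr, ← hs, ← hm]
  constructor
  · intro ht
    obtain ⟨t, rfl⟩ := hzs t ht.1
    rcases hall t ((hS t).2 ht) with rfl | rfl | rfl | rfl | rfl | rfl <;> simp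
  · rintro (rfl | rfl | rfl | rfl | rfl | rfl)
    exacts [(hS _).1 hSp, (hS _).1 hSv, (hS _).1 hSq, (hS _).1 hSr, (hS _).1 hSs, (hS _).1 hSm]

end PetersenChart

end SimpleGraph

/-! ### Signs of pentagons -/

theorem petersenFin_eq_of_adj : ∀ b a, petersenFin.Adj b a → ∀ c, petersenFin.Adj b c → a ≠ c →
    ∀ f, petersenFin.Adj b f → c ≠ f → a ≠ f → ∀ g, petersenFin.Adj b g → g = a ∨ g = c ∨ g = f := by
  decide +kernel

namespace SimpleGraph.PetersenChart

variable {V : Type*} {G : SimpleGraph V} {x : V} (C : G.PetersenChart x) {a b c d e f : Fin 10}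
  {i j : ZMod 2} {v w : V}

theorem not_adj_u_u (hab : petersenFin.Adj a b) (hcd : petersenFin.Adj c d) (hac : a ≠ c)
    (had : a ≠ d) (hbc : b ≠ c) (hbd : b ≠ d) : ¬G.Adj (C.u a b i) (C.u c d j) := fun h => by
  rcases C.eq_of_adj_u hab hcd h with h | h | h | h
  exacts [hac h, had h, hbc h, hbd h]

theorem u_ne_u (hab : petersenFin.Adj a b) (hcd : petersenFin.Adj c d) (hac : a ≠ c)
    (had : a ≠ d) : C.u a b i ≠ C.u c d j := fun h => by
  rcases ((C.u_eq_iff hab hcd).1 h).1 with h | h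
  exacts [hac h.1, had h.1]

/-- Every path of length three in the Petersen graph lies under a far vertex. -/
theorem exists_isFar (hab : petersenFin.Adj a b) (hbc : petersenFin.Adj b c)
    (hcd : petersenFin.Adj c d) (hac : a ≠ c) (hbd : b ≠ d) (i : ZMod 2) :
    ∃ w, G.IsFar x w ∧ G.Adj w (C.u a b i) ∧ G.Adj w (C.u b c (i + C.σ a b c)) ∧
      G.Adj w (C.u c d (i + C.σ a b c + C.σ b c d)) := by
  have had : a ≠ d := by
    rintro rfl
    exact petersenFin_no_triangle _ _ hab _ hbc hcd
  have h1 := C.adj_u_add hab hbc hac i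
  have h2 := C.adj_u_add hbc hcd hbd (i + C.σ a b c)
  obtain ⟨w, hpw, hqw, hvw⟩ := C.isLocallyMoore.exists_second (C.u_ne_u hab hcd hac had)
    (C.not_adj_u_u hab hcd hac had hbc.ne hbd) h1 h2.symm
  refine ⟨w, C.isFar_of_adj hbc hvw (fun hb => ?_) (fun hc => ?_), hpw.symm, hvw.symm, hqw.symm⟩
  · exact C.isLocallyMoore.cliqueFree (C.y b) _ _ _ (C.adj_u' hab i) (C.adj_u b c _ hbc) hb h1 hpw
      hvw
  · exact C.isLocallyMoore.cliqueFree (C.y c) _ _ _ (C.adj_u' hbc _) (C.adj_u c d _ hcd) hc h2 hvw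
      hqw

/-- A far vertex is determined by a path of length three under it. -/
theorem eq_of_path {w' : V} (hw : G.IsFar x w) (hw' : G.IsFar x w') (hab : petersenFin.Adj a b)
    (hbc : petersenFin.Adj b c) (hcd : petersenFin.Adj c d) (hac : a ≠ c) (hbd : b ≠ d)
    (h1 : G.Adj w (C.u a b i)) (h2 : G.Adj w (C.u c d (i + C.σ a b c + C.σ b c d)))
    (h1' : G.Adj w' (C.u a b i)) (h2' : G.Adj w' (C.u c d (i + C.σ a b c + C.σ b c d))) :
    w' = w := by
  have had : a ≠ d := by
    rintro rfl
    exact petersenFin_no_triangle _ _ hab _ hbc hcd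
  have h3 := C.adj_u_add hab hbc hac i
  have h4 := C.adj_u_add hbc hcd hbd (i + C.σ a b c)
  rcases C.isLocallyMoore.eq_or_eq (C.u_ne_u hab hcd hac had)
    (C.not_adj_u_u hab hcd hac had hbc.ne hbd) h3 h4.symm h1.symm h2.symm
    (fun h => C.not_isFar_u hbc (h ▸ hw)) h1'.symm h2'.symm with h | h
  · exact absurd (h ▸ hw') (C.not_isFar_u hbc)
  · exact h

variable [Finite V]

theorem pentagon_sum_eq_zero
    (hn : ∀ w, G.IsFar x w → (G.lower x w).Nonempty → (G.lower x w).ncard = 5)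
    (hab : petersenFin.Adj a b) (hbc : petersenFin.Adj b c)
    (hcd : petersenFin.Adj c d) (hde : petersenFin.Adj d e) (hea : petersenFin.Adj e a) :
    C.σ a b c + C.σ b c d + C.σ c d e + C.σ d e a + C.σ e a b = 0 := by
  have hac : a ≠ c := by
    rintro rfl
    exact petersenFin_no_triangle _ _ hcd _ hde hea
  have hbd : b ≠ d := by
    rintro rfl
    exact petersenFin_no_triangle _ _ hde _ hea hab
  have had : a ≠ d := by
    rintro rfl
    exact petersenFin_no_triangle _ _ hab _ hbc hcd
  obtain ⟨w, hw, h0, h1, h2⟩ := C.exists_isFar hab hbc hcd hac hbd 0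
  obtain ⟨e', hde', hea', hsum, -⟩ := C.exists_pentagon hw
    (hn w hw ⟨_, (C.u_mem_lower hab).2 h0⟩) hab hbc hcd hac hbd h0 h1 h2
  have hee : e = e' := by
    by_contra hee
    exact petersenFin_no_square _ _ hde _ hea had.symm _ hea'.symm hee hde'.symm
  subst hee
  linear_combination hsum

end SimpleGraph.PetersenChart

/-- In a hexagon through the path `abcd`, the vertex after `d` is the one on the pentagon through
`bcd` that avoids `a`. -/
theorem petersenFin_eq_of_hexagon : ∀ b c, petersenFin.Adj b c → ∀ d, petersenFin.Adj c d → b ≠ d →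
    ∀ e, petersenFin.Adj d e → ∀ f, petersenFin.Adj e f → petersenFin.Adj f b →
    ∀ a, petersenFin.Adj a b → a ≠ c → a ≠ f → ∀ e', petersenFin.Adj d e' → c ≠ e' →
    ∀ f', petersenFin.Adj e' f' → petersenFin.Adj f' a → e' = e := by
  decide +kernel

namespace SimpleGraph.PetersenChart

variable {V : Type*} {G : SimpleGraph V} {x : V} (C : G.PetersenChart x) {a b c d e f : Fin 10}
  {i j : ZMod 2} {v w : V}

/-- Let `w` lie over a hexagon with the opposite edges `ab` and `de`. The neighbours of `w` over
these edges have another common neighbour `r`, which lies over the hexagon that contains the path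
from `ab` to `de` through the common neighbour of `b` and `e`. Comparing the signs along the two
paths from `b` to `e` gives the sign of the pentagon. -/
theorem pentagon_sum_eq_one [Finite V]
    (hn : ∀ w, G.IsFar x w → (G.lower x w).Nonempty → (G.lower x w).ncard = 6)
    (hbc : petersenFin.Adj b c) (hcd : petersenFin.Adj c d) (hde : petersenFin.Adj d e)
    (hef : petersenFin.Adj e f) (hfb : petersenFin.Adj f b) :
    C.σ b c d + C.σ c d e + C.σ d e f + C.σ e f b + C.σ f b c = 1 := by
  have hbd : b ≠ d := by
    rintro rfl
    exact petersenFin_no_triangle _ _ hde _ hef hfb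
  have hcf : c ≠ f := by
    rintro rfl
    exact petersenFin_no_triangle _ _ hcd _ hde hef
  have hdf : d ≠ f := by
    rintro rfl
    exact petersenFin_no_triangle _ _ hbc _ hcd hfb
  have hbe : b ≠ e := by
    rintro rfl
    exact petersenFin_no_triangle _ _ hbc _ hcd hde
  have hce : c ≠ e := by
    rintro rfl
    exact petersenFin_no_triangle _ _ hbc _ hef hfb
  obtain ⟨a, hba, hac, haf⟩ : ∃ a, petersenFin.Adj b a ∧ a ≠ c ∧ a ≠ f := by
    revert hcf
    clear * -
    revert b c f
    decide +kernel
  have hab := hba.symm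
  have hae : a ≠ e := by
    rintro rfl
    exact petersenFin_no_triangle _ _ hef _ hfb hba
  have had : a ≠ d := by
    rintro rfl
    exact petersenFin_no_triangle _ _ hab _ hbc hcd
  obtain ⟨w, hw, h0, h1, h2⟩ := C.exists_isFar hab hbc hcd hac hbd 0
  obtain ⟨e', f', hde', hef', hfa', hce', hdf', hea', hfb', -, hlow⟩ := C.exists_hexagon hw
    (hn w hw ⟨_, (C.u_mem_lower hab).2 h0⟩) hab hbc hcd hac hbd h0 h1 h2
  obtain rfl : e' = e := petersenFin_eq_of_hexagon b c hbc d hcd hbd e hde f hef hfb a hab hac haf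
    e' hde' hce' f' hef' hfa'
  have hff : f' ≠ f := by
    rintro rfl
    exact petersenFin_no_triangle _ _ hab _ hfb.symm hfa'
  obtain ⟨h3, -⟩ := (hlow _).2 (Or.inr (Or.inr (Or.inr (Or.inl rfl))))
  obtain ⟨h4, -⟩ := (hlow _).2 (Or.inr (Or.inr (Or.inr (Or.inr (Or.inl rfl)))))
  obtain ⟨r, hr0, hr3, hwr⟩ := C.isLocallyMoore.exists_second
    (C.u_ne_u hab hde had hae) (C.not_adj_u_u hab hde had hae hbd hbe) h0.symm h3.symm
  have hr : G.IsFar x r := by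
    by_contra hr
    rcases (hlow r).1 ⟨hwr, hr⟩ with rfl | rfl | rfl | rfl | rfl | rfl
    · exact hr0.ne rfl
    · exact C.not_adj_u_u hde hbc hbd.symm hcd.ne' hbe.symm hce.symm hr3
    · exact C.not_adj_u_u hab hcd hac had hbc.ne hbd hr0
    · exact hr3.ne rfl
    · exact C.not_adj_u_u hab hef' hae hfa'.ne' hbe hfb'.symm hr0
    · exact C.not_adj_u_u hde hfa' hdf' had.symm hef'.ne hae.symm hr3
  -- The neighbours of `r` next to the ones over `ab` and `de` lie over `bf` and `ef`.
  rw [C.u_comm a b _ hab] at hr0 h0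
  obtain ⟨c', hbc', hac', hrc⟩ := C.exists_next_u hr hba hr0.symm
  have hcf' : c' = f := by
    rcases petersenFin_eq_of_adj b a hba c hbc hac f hfb.symm hcf haf c' hbc' with h | h | h
    · exact absurd h.symm hac'
    · subst h
      refine (C.isLocallyMoore.cliqueFree w _ _ _ hwr h0 h1 hr0.symm hrc ?_).elim
      rw [← C.u_comm a b _ hab]
      exact C.adj_u_add hab hbc hac 0
    · exact h
  subst hcf'
  rw [C.u_comm d e' _ hde] at hr3 h3
  obtain ⟨g, heg, hdg, hrg⟩ := C.exists_next_u hr hde.symm hr3.symm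
  have hgf : g = c' := by
    rcases petersenFin_eq_of_adj e' d hde.symm f' hef' hdf' c' hef hff hdf g heg with h | h | h
    · exact absurd h.symm hdg
    · subst h
      refine (C.isLocallyMoore.cliqueFree w _ _ _ hwr h3 h4 hr3.symm hrg ?_).elim
      rw [← C.u_comm d e' _ hde]
      exact C.adj_u_add hde hef' hdf' _
    · exact h
  subst hgf
  rw [C.u_comm _ _ _ hbc'] at hrc
  rw [C.u_comm _ _ _ heg] at hrg
  obtain ⟨m, hfm, hbm, hrm⟩ := C.exists_next_u hr hfb hrc
  have key : 0 + C.σ a b c + C.σ b c d + C.σ c d e' + C.σ d e' g =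
      0 + C.σ a b g + C.σ b g e' := by
    rcases C.eq_or_eq_of_adj hr hfb heg.symm hfm hrc hrg hbe hrm with h | h
    · have := ((C.u_eq_iff hfm hfb).1 h).1
      grind
    · obtain ⟨h5, h6⟩ := (C.u_eq_iff hfm heg.symm).1 h
      have h7 : m = e' := by grind
      rw [← h6, h7]
  have htri := C.sigma_triangle hba hbc hfb.symm hac hcf haf
  rw [C.sigma_comm hfb.symm hef.symm hbe, C.sigma_comm hbc.symm hfb.symm hcf]
  revert key htri
  generalize C.σ a b c = s1
  generalize C.σ b c d = s2
  generalize C.σ c d e' = s3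
  generalize C.σ d e' g = s4
  generalize C.σ a b g = s5
  generalize C.σ b g e' = s6
  generalize C.σ c b g = s7
  clear * -
  intro h1 h2
  have h3 : (2 : ZMod 2) = 0 := rfl
  linear_combination h1 + h2 + (s6 - s1) * h3

end SimpleGraph.PetersenChart

/-! ### Change of coordinates -/

/-- A neighbour of a vertex of the Petersen graph on a shortest path to the vertex `0`. -/
def petersenParent : Fin 10 → Fin 10 := ![0, 0, 0, 0, 1, 2, 3, 1, 2, 3]

/-- An edge of the Petersen graph contains the vertex `0`, or leads away from `0`, or is the edge
opposite to `0` in a pentagon. -/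
theorem petersenFin_edge_cases : ∀ a b, petersenFin.Adj a b →
    (a = 0 ∧ petersenParent b = 0 ∧ b ≠ 0) ∨ (b = 0 ∧ petersenParent a = 0 ∧ a ≠ 0) ∨
    (a ≠ 0 ∧ b ≠ 0 ∧ petersenParent a = 0 ∧ petersenParent b = a) ∨
    (a ≠ 0 ∧ b ≠ 0 ∧ petersenParent b = 0 ∧ petersenParent a = b) ∨
    (a ≠ 0 ∧ b ≠ 0 ∧ petersenParent a ≠ 0 ∧ petersenParent b ≠ 0 ∧
      petersenFin.Adj 0 (petersenParent a) ∧ petersenFin.Adj (petersenParent a) a ∧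
      petersenFin.Adj b (petersenParent b) ∧ petersenFin.Adj (petersenParent b) 0) := by
  decide +kernel

/-- A function on the edges of the Petersen graph whose sum over every pentagon is zero is a
coboundary. -/
theorem exists_vertex_potential (η : Fin 10 → Fin 10 → ZMod 2)
    (hcomm : ∀ a b, petersenFin.Adj a b → η b a = η a b)
    (hpent : ∀ a b c d e, petersenFin.Adj a b → petersenFin.Adj b c → petersenFin.Adj c d →
      petersenFin.Adj d e → petersenFin.Adj e a → η a b + η b c + η c d + η d e + η e a = 0) :
    ∃ t : Fin 10 → ZMod 2, ∀ a b, petersenFin.Adj a b → t a + t b = η a b := by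
  have h2 : (2 : ZMod 2) = 0 := rfl
  refine ⟨fun v => if v = 0 then 0 else if petersenParent v = 0 then η 0 v else
    η 0 (petersenParent v) + η (petersenParent v) v, fun a b hab => ?_⟩
  rcases petersenFin_edge_cases a b hab with ⟨rfl, h1, h3⟩ | ⟨rfl, h1, h3⟩ | ⟨h1, h3, h4, h5⟩ |
    ⟨h1, h3, h4, h5⟩ | ⟨h1, h3, h4, h5, h6, h7, h8, h9⟩
  · simp [h1, h3]
  · simp [h1, h3, hcomm _ _ hab]
  · simp only [h1, h3, h4, h5, if_true, if_false]
    linear_combination η 0 a * h2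
  · simp only [h1, h3, h4, h5, if_true, if_false, ← hcomm _ _ hab]
    linear_combination η 0 b * h2
  · simp only [h1, h3, h4, h5, if_false]
    have h := hpent _ _ _ _ _ h6 h7 hab h8 h9
    rw [hcomm _ _ h8.symm, hcomm _ _ h9.symm] at h
    linear_combination h - η a b * h2

/-- Signs on the paths of length two in the Petersen graph with sum zero at each vertex and along
each pentagon are trivial. -/
theorem exists_edge_potential (δ : Fin 10 → Fin 10 → Fin 10 → ZMod 2)
    (hcomm : ∀ a b c, petersenFin.Adj a b → petersenFin.Adj b c → a ≠ c → δ c b a = δ a b c)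
    (htri : ∀ a b c d, petersenFin.Adj b a → petersenFin.Adj b c → petersenFin.Adj b d → a ≠ c →
      c ≠ d → a ≠ d → δ a b c + δ c b d + δ a b d = 0)
    (hpent : ∀ a b c d e, petersenFin.Adj a b → petersenFin.Adj b c → petersenFin.Adj c d →
      petersenFin.Adj d e → petersenFin.Adj e a →
      δ a b c + δ b c d + δ c d e + δ d e a + δ e a b = 0) :
    ∃ g : Fin 10 → Fin 10 → ZMod 2, (∀ a b, petersenFin.Adj a b → g a b = g b a) ∧
      ∀ a b c, petersenFin.Adj a b → petersenFin.Adj b c → a ≠ c → δ a b c = g a b + g b c := by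
  have h2 : (2 : ZMod 2) = 0 := rfl
  -- At each vertex `b` the signs are differences of a function `h b` on the neighbours of `b`.
  obtain ⟨h, hh⟩ : ∃ h : Fin 10 → Fin 10 → ZMod 2, ∀ a b c, petersenFin.Adj a b →
      petersenFin.Adj b c → a ≠ c → δ a b c = h b a + h b c := by
    refine ⟨fun b a => if a = petersenNbr b 0 then 0 else δ a b (petersenNbr b 0),
      fun a b c hab hbc hac => ?_⟩
    have hb : petersenFin.Adj b (petersenNbr b 0) := ⟨0, rfl⟩
    beta_reduce
    by_cases h1 : a = petersenNbr b 0
    · rw [if_pos h1, if_neg (fun h3 => hac (h1.trans h3.symm)), ← h1, hcomm a b c hab hbc hac,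
        zero_add]
    · by_cases h3 : c = petersenNbr b 0
      · rw [if_neg h1, if_pos h3, ← h3, add_zero]
      · rw [if_neg h1, if_neg h3]
        linear_combination htri a b c _ hab.symm hbc hb hac h3 h1 -
          (δ a b (petersenNbr b 0) + δ c b (petersenNbr b 0)) * h2
  have hne : ∀ {a b c d e}, petersenFin.Adj a b → petersenFin.Adj b c → petersenFin.Adj c d →
      petersenFin.Adj d e → petersenFin.Adj e a → a ≠ c := by
    rintro a b c d e - - hcd hde hea rfl
    exact petersenFin_no_triangle _ _ hcd _ hde hea
  obtain ⟨t, ht⟩ := exists_vertex_potential (fun a b => h a b + h b a)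
    (fun a b _ => add_comm _ _) (fun a b c d e hab hbc hcd hde hea => by
      have h3 := hpent a b c d e hab hbc hcd hde hea
      rw [hh _ _ _ hab hbc (hne hab hbc hcd hde hea), hh _ _ _ hbc hcd (hne hbc hcd hde hea hab),
        hh _ _ _ hcd hde (hne hcd hde hea hab hbc), hh _ _ _ hde hea (hne hde hea hab hbc hcd),
        hh _ _ _ hea hab (hne hea hab hbc hcd hde)] at h3
      linear_combination h3)
  refine ⟨fun a b => h a b + t a, fun a b hab => ?_, fun a b c hab hbc hac => ?_⟩
  · linear_combination ht a b hab + (h a b - t b) * h2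
  · rw [hh a b c hab hbc hac]
    linear_combination -ht a b hab - h a b * h2

namespace SimpleGraph.PetersenChart

variable {V : Type*} {G : SimpleGraph V} {x : V}

/-- Exchange the two vertices over the edges `ab` with `g a b = 1`. -/
def twist (C : G.PetersenChart x) (g : Fin 10 → Fin 10 → ZMod 2)
    (hg : ∀ a b, petersenFin.Adj a b → g a b = g b a) : G.PetersenChart x where
  y := C.y
  u a b i := C.u a b (i + g a b)
  σ a b c := C.σ a b c + (g a b + g b c)
  isLocallyMoore := C.isLocallyMoore
  y_injective := C.y_injective
  adj_y := C.adj_y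
  exists_y := C.exists_y
  y_adj_iff := C.y_adj_iff
  u_comm a b i hab := by rw [C.u_comm a b _ hab, hg a b hab]
  u_ne a b i hab := C.u_ne a b _ hab
  adj_u a b i hab := C.adj_u a b _ hab
  u_injective a b hab := (C.u_injective a b hab).comp (add_left_injective _)
  adj_u_iff a b c i j hab hbc hac := by
    rw [C.adj_u_iff a b c _ _ hab hbc hac]
    have h2 : (2 : ZMod 2) = 0 := rfl
    constructor <;> intro h
    · linear_combination h - g b c * h2
    · linear_combination h + g b c * h2

/-- The signs of a chart are determined, up to a change of coordinates, by the signs of the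
pentagons. -/
theorem exists_sigma_eq {W : Type*} {H : SimpleGraph W} {z : W} (C : G.PetersenChart x)
    (D : H.PetersenChart z) (τ : ZMod 2)
    (hC : ∀ a b c d e, petersenFin.Adj a b → petersenFin.Adj b c → petersenFin.Adj c d →
      petersenFin.Adj d e → petersenFin.Adj e a →
      C.σ a b c + C.σ b c d + C.σ c d e + C.σ d e a + C.σ e a b = τ)
    (hD : ∀ a b c d e, petersenFin.Adj a b → petersenFin.Adj b c → petersenFin.Adj c d →
      petersenFin.Adj d e → petersenFin.Adj e a →
      D.σ a b c + D.σ b c d + D.σ c d e + D.σ d e a + D.σ e a b = τ) :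
    ∃ D' : H.PetersenChart z, D'.σ = C.σ := by
  have h2 : (2 : ZMod 2) = 0 := rfl
  obtain ⟨g, hg, hδ⟩ := exists_edge_potential (fun a b c => C.σ a b c + D.σ a b c)
    (fun a b c hab hbc hac => by
      simp only [C.sigma_comm hab hbc hac, D.sigma_comm hab hbc hac])
    (fun a b c d hba hbc hbd hac hcd had => by
      linear_combination C.sigma_triangle hba hbc hbd hac hcd had +
        D.sigma_triangle hba hbc hbd hac hcd had + h2)
    (fun a b c d e hab hbc hcd hde hea => by
      linear_combination hC a b c d e hab hbc hcd hde hea + hD a b c d e hab hbc hcd hde hea +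
        τ * h2)
  refine ⟨{ D.twist g hg with
    σ := C.σ
    adj_u_iff := fun a b c i j hab hbc hac => ?_ }, rfl⟩
  have h3 : (D.twist g hg).σ a b c = C.σ a b c := by
    show D.σ a b c + (g a b + g b c) = C.σ a b c
    linear_combination -hδ a b c hab hbc hac + D.σ a b c * h2
  rw [← h3]
  exact (D.twist g hg).adj_u_iff a b c i j hab hbc hac

end SimpleGraph.PetersenChart

/-! ### Comparing two locally Petersen graphs -/

namespace SimpleGraph

/-- The vertex `w` is at distance three from `x`. -/
structure IsThird {V : Type*} (G : SimpleGraph V) (x w : V) : Prop extends G.IsFar x w where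
  nonempty : (G.lower x w).Nonempty

/-- The vertex `m` is at distance four from `x`. -/
structure IsFourth {V : Type*} (G : SimpleGraph V) (x m : V) : Prop extends G.IsFar x m where
  lower_eq : ∀ v, G.Adj m v → G.IsFar x v
  exists_third : ∃ w, G.IsThird x w ∧ G.Adj w m

namespace PetersenChart

variable {V : Type*} {G : SimpleGraph V} {x : V} {a b c d e f : Fin 10}
  {i j : ZMod 2} {v w m : V}

theorem isThird_of_adj (C : G.PetersenChart x) (hw : G.IsFar x w) (hab : petersenFin.Adj a b)
    (h : G.Adj w (C.u a b i)) : G.IsThird x w :=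
  ⟨hw, _, (C.u_mem_lower hab).2 h⟩

/-- The path under a vertex at distance three. -/
theorem exists_path (C : G.PetersenChart x) (hw : G.IsThird x w) :
    ∃ a b c d i, petersenFin.Adj a b ∧ petersenFin.Adj b c ∧ petersenFin.Adj c d ∧ a ≠ c ∧ b ≠ d ∧
      G.Adj w (C.u a b i) ∧ G.Adj w (C.u b c (i + C.σ a b c)) ∧
      G.Adj w (C.u c d (i + C.σ a b c + C.σ b c d)) := by
  obtain ⟨v, hv⟩ := hw.nonempty
  obtain ⟨b, c, i, hbc, rfl, hwv⟩ := (C.mem_lower hw.toIsFar).1 hv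
  obtain ⟨a, d, ⟨hba, hca, ha⟩, ⟨hcd, hbd, hd⟩, -⟩ := C.exists_lower_adj hw.toIsFar hbc hwv
  refine ⟨a, b, c, d, i + C.σ c b a, hba.symm, hbc, hcd, hca.symm, hbd, ?_, ?_, ?_⟩
  · rwa [C.u_comm a b _ hba.symm]
  all_goals
    rw [C.sigma_comm hba.symm hbc hca.symm, add_assoc i, CharTwo.add_self_eq_zero, add_zero]
    assumption

/-- Two vertices at distance three with a common neighbour `v` at distance two are adjacent if they
have no common neighbour at distance two adjacent to `v`. -/
theorem adj_of_common_lower (C : G.PetersenChart x) {w₁ w₂ : V} (h1 : G.IsFar x w₁)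
    (h2 : G.IsFar x w₂) (hne : w₁ ≠ w₂) (hab : petersenFin.Adj a b) (hu1 : G.Adj w₁ (C.u a b i))
    (hu2 : G.Adj w₂ (C.u a b i))
    (hv : ∀ v, G.Adj w₁ v → G.Adj w₂ v → ¬G.IsFar x v → ¬G.Adj (C.u a b i) v) :
    G.Adj w₁ w₂ := by
  by_contra hn
  obtain ⟨q, hq1, hq2, hqu⟩ := C.isLocallyMoore.exists_second hne hn hu1 hu2
  have hq : G.IsFar x q := by
    by_contra hq
    exact hv q hq1 hq2 hq hqu
  -- The neighbours of `w₁`, `w₂` and `q` over the edges at `a` other than `ab`.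
  obtain ⟨c₁, hac1, hbc1, hc1⟩ := C.exists_next_u h1 hab hu1
  obtain ⟨c₂, hac2, hbc2, hc2⟩ := C.exists_next_u h2 hab hu2
  obtain ⟨c, hac, hbc, hc⟩ := C.exists_next_u hq hab hqu.symm
  have hadj : ∀ {c}, petersenFin.Adj a c → b ≠ c →
      G.Adj (C.u a b i) (C.u a c (i + C.σ b a c)) := fun hac hbc =>
    C.u_comm a b i hab ▸ C.adj_u_add hab.symm hac hbc i
  have hcc : c₁ ≠ c₂ := by
    rintro rfl
    exact hv _ hc1 hc2 (C.not_isFar_u hac1) (hadj hac1 hbc1)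
  rcases petersenFin_eq_of_adj a b hab c₁ hac1 hbc1 c₂ hac2 hcc hbc2 c hac with rfl | rfl | rfl
  · exact hbc rfl
  · exact C.isLocallyMoore.cliqueFree q _ _ _ hq1.symm hqu.symm hc hu1 hc1 (hadj hac hbc)
  · exact C.isLocallyMoore.cliqueFree q _ _ _ hq2.symm hqu.symm hc hu2 hc2 (hadj hac hbc)

variable [Finite V]

/-- Adjacent vertices at distance three have a common neighbour at distance two. -/
theorem exists_common_lower (C : G.PetersenChart x) {w₁ w₂ : V} {n : ℕ}
    (hn : ∀ w, G.IsThird x w → (G.lower x w).ncard = n) (h1 : G.IsThird x w₁)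
    (h2 : G.IsThird x w₂) (hadj : G.Adj w₁ w₂) :
    ∃ v, G.Adj w₁ v ∧ G.Adj w₂ v ∧ ¬G.IsFar x v := by
  have hn1 := hn w₁ h1
  rcases C.ncard_lower h1.toIsFar h1.nonempty with h5 | h6
  · obtain ⟨r, hr, h3 | h3⟩ := C.exists_lower_of_pentagon h1.toIsFar h5 hadj
    · exact absurd h2.toIsFar h3.2
    · exact ⟨r, hr.1, h3, hr.2⟩
  · obtain rfl : n = 6 := hn1.symm.trans h6
    obtain ⟨m₁, hm1, hm1f, hm1l, hm1j⟩ := C.exists_centre h1.toIsFar h6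
    obtain ⟨m₂, hm2, hm2f, hm2l, hm2j⟩ := C.exists_centre h2.toIsFar (hn w₂ h2)
    by_cases e1 : w₂ = m₁
    swap
    · obtain ⟨-, k, hk, hk'⟩ := hm1j w₂ hadj h2.toIsFar e1
      exact ⟨k, hk.1, hk', hk.2⟩
    by_cases e2 : w₁ = m₂
    swap
    · obtain ⟨-, k, hk, hk'⟩ := hm2j w₁ hadj.symm h1.toIsFar e2
      exact ⟨k, hk', hk.1, hk.2⟩
    subst e1 e2
    -- If each were the centre for the other, then neither would be the centre for a third vertex.
    exfalso
    have hcn := C.isLocallyMoore.ncard_of_adj _ _ hadj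
    obtain ⟨r, hr1, hr2⟩ : (G.commonNeighbors w₁ w₂).Nonempty := by
      rw [← Set.ncard_pos (Set.toFinite _)]
      omega
    have hrf : G.IsFar x r := by
      by_contra hrf
      exact hm1l r ⟨hr1, hrf⟩ hr2
    obtain ⟨-, k1, hk1, hrk1⟩ := hm1j r hr1 hrf hr2.ne'
    obtain ⟨-, k2, hk2, hrk2⟩ := hm2j r hr2 hrf hr1.ne'
    obtain ⟨m, hm, hmf, hml, hmj⟩ := C.exists_centre hrf (hn r ⟨hrf, k1, hrk1, hk1.2⟩)
    obtain ⟨h3, -⟩ := hmj w₁ hr1.symm h1.toIsFar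
      (by rintro rfl; exact hml k1 ⟨hrk1, hk1.2⟩ hk1.1)
    obtain ⟨h4, -⟩ := hmj w₂ hr2.symm h2.toIsFar
      (by rintro rfl; exact hml k2 ⟨hrk2, hk2.2⟩ hk2.1)
    exact C.isLocallyMoore.cliqueFree r m _ _ hm hr1.symm hr2.symm h3 h4 hadj

/-- A neighbour at distance four of a vertex `w` at distance three is its centre. -/
theorem adj_of_isFourth (C : G.PetersenChart x) (hw : G.IsThird x w)
    (hm : ∀ v, G.Adj m v → G.IsFar x v) (hmf : G.IsFar x m) (hwm : G.Adj w m)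
    {j : V} (hwj : G.Adj w j) (hj : G.IsFar x j) (hjm : j ≠ m) : G.Adj m j ∧ G.IsThird x j := by
  rcases C.ncard_lower hw.toIsFar hw.nonempty with h5 | h6
  · obtain ⟨r, hr, h3 | h3⟩ := C.exists_lower_of_pentagon hw.toIsFar h5 hwm
    · exact absurd hmf h3.2
    · exact absurd (hm r h3) hr.2
  · obtain ⟨m', hm', hmf', hml', hmj'⟩ := C.exists_centre hw.toIsFar h6
    obtain rfl : m = m' := by
      by_contra hne
      obtain ⟨-, k, hk, hmk⟩ := hmj' m hwm hmf hne
      exact hk.2 (hm k hmk)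
    obtain ⟨h1, k, hk, hjk⟩ := hmj' j hwj hj hjm
    exact ⟨h1, hj, k, hjk, hk.2⟩

/-- All neighbours of a vertex at distance four are at distance three, because the local graph is
connected. -/
theorem isThird_of_isFourth (C : G.PetersenChart x) (hm : G.IsFourth x m) (hmv : G.Adj m v) :
    G.IsThird x v := by
  have step : ∀ w v, G.IsThird x w → G.Adj m w → G.Adj m v → G.Adj w v → G.IsThird x v :=
    fun w v hw hmw hmv hwv => (C.adj_of_isFourth hw hm.lower_eq hm.toIsFar hmw.symm hwv
      (hm.lower_eq v hmv) hmv.ne').2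
  obtain ⟨w, hw, hwm⟩ := hm.exists_third
  by_cases hwv : w = v
  · exact hwv ▸ hw
  by_cases hwv' : G.Adj w v
  · exact step w v hw hwm.symm hmv hwv'
  · obtain ⟨q, hwq, hvq, hmq⟩ := C.isLocallyMoore.exists_second hwv hwv' hwm hmv.symm
    exact step q v (step w q hw hwm.symm hmq hwq) hmq hmv hvq.symm

end PetersenChart

end SimpleGraph

/-! ### The isomorphism -/

/-- A path of length three in the Petersen graph lies in at most one hexagon. -/
theorem petersenFin_hexagon_unique : ∀ a b, petersenFin.Adj a b → ∀ c, petersenFin.Adj b c →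
    a ≠ c → ∀ d, petersenFin.Adj c d → b ≠ d → ∀ e, petersenFin.Adj d e → c ≠ e →
    ∀ f, petersenFin.Adj e f → petersenFin.Adj f a → ∀ e', petersenFin.Adj d e' → c ≠ e' →
    ∀ f', petersenFin.Adj e' f' → petersenFin.Adj f' a → e = e' := by
  decide +kernel

namespace SimpleGraph

namespace PetersenChart

variable {V W : Type*} {G : SimpleGraph V} {H : SimpleGraph W} {x : V} {z : W}
  {C : G.PetersenChart x} {D : H.PetersenChart z} {a b c d e f : Fin 10} {i j : ZMod 2}

/-- The vertices `w` and `w'` have the same neighbours at distance two, with respect to the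
coordinates `C` and `D`. -/
def SameLower (C : G.PetersenChart x) (D : H.PetersenChart z) (w : V) (w' : W) : Prop :=
  ∀ a b i, petersenFin.Adj a b → (G.Adj w (C.u a b i) ↔ H.Adj w' (D.u a b i))

theorem SameLower.symm {w : V} {w' : W} (h : SameLower C D w w') : SameLower D C w' w :=
  fun a b i hab => (h a b i hab).symm

theorem adj_u_congr (hσ : D.σ = C.σ) (hab : petersenFin.Adj a b) (hcd : petersenFin.Adj c d)
    (h : G.Adj (C.u a b i) (C.u c d j)) : H.Adj (D.u a b i) (D.u c d j) := by
  have key : ∀ {a b d i j}, petersenFin.Adj a b → petersenFin.Adj b d →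
      G.Adj (C.u a b i) (C.u b d j) → H.Adj (D.u a b i) (D.u b d j) := by
    intro a b d i j hab hbd h
    have had : a ≠ d := by
      rintro rfl
      rw [C.u_comm a b i hab] at h
      exact C.not_adj_same hab.symm h
    rw [D.adj_u_iff a b d i j hab hbd had, hσ]
    exact (C.adj_u_iff a b d i j hab hbd had).1 h
  rcases C.eq_of_adj_u hab hcd h with rfl | rfl | rfl | rfl
  · rw [C.u_comm _ _ _ hab] at h
    rw [D.u_comm _ _ _ hab]
    exact key hab.symm hcd h
  · rw [C.u_comm _ _ _ hab, C.u_comm _ _ _ hcd] at h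
    rw [D.u_comm _ _ _ hab, D.u_comm _ _ _ hcd]
    exact key hab.symm hcd.symm h
  · exact key hab hcd h
  · rw [C.u_comm _ _ _ hcd] at h
    rw [D.u_comm _ _ _ hcd]
    exact key hab hcd.symm h

/-- The charts `C` and `D` have the same signs, and all vertices at distance three from the base
vertices have the same number of lower neighbours. -/
structure Similar (C : G.PetersenChart x) (D : H.PetersenChart z) (n : ℕ) : Prop where
  sigma_eq : D.σ = C.σ
  left : ∀ w, G.IsThird x w → (G.lower x w).ncard = n
  right : ∀ w, H.IsThird z w → (H.lower z w).ncard = n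

theorem Similar.symm {n : ℕ} (h : Similar C D n) : Similar D C n :=
  ⟨h.sigma_eq.symm, h.right, h.left⟩

variable {n : ℕ} {w w₁ w₂ m : V} {w' w₁' w₂' m' : W}

theorem SameLower.eq_left (h1 : G.IsThird x w₁) (h2 : G.IsThird x w₂)
    (hs1 : SameLower C D w₁ w') (hs2 : SameLower C D w₂ w') : w₁ = w₂ := by
  obtain ⟨a, b, c, d, i, hab, hbc, hcd, hac, hbd, h3, -, h4⟩ := C.exists_path h2
  exact C.eq_of_path h2.toIsFar h1.toIsFar hab hbc hcd hac hbd h3 h4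
    ((hs1 _ _ _ hab).2 ((hs2 _ _ _ hab).1 h3)) ((hs1 _ _ _ hcd).2 ((hs2 _ _ _ hcd).1 h4))

/-- The vertices `m` and `m'` at distance four have neighbours with the same lower neighbours. -/
structure SameThird (C : G.PetersenChart x) (D : H.PetersenChart z) (m : V) (m' : W) : Prop where
  left : G.IsFourth x m
  right : H.IsFourth z m'
  exists_third : ∃ w w', G.IsThird x w ∧ H.IsThird z w' ∧ G.Adj m w ∧ H.Adj m' w' ∧
    SameLower C D w w'

theorem SameThird.symm (hm : SameThird C D m m') : SameThird D C m' m := by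
  obtain ⟨h1, h2, w, w', h3, h4, h5, h6, h7⟩ := hm
  exact ⟨h2, h1, w', w, h4, h3, h6, h5, h7.symm⟩

/-- The correspondence between the vertices of two graphs with similar charts. -/
inductive Rel (C : G.PetersenChart x) (D : H.PetersenChart z) (v : V) (v' : W) : Prop
  | base (h : v = x) (h' : v' = z)
  | first (a : Fin 10) (h : v = C.y a) (h' : v' = D.y a)
  | second (a b : Fin 10) (i : ZMod 2) (hab : petersenFin.Adj a b) (h : v = C.u a b i)
    (h' : v' = D.u a b i)
  | third (h : G.IsThird x v) (h' : H.IsThird z v') (hs : SameLower C D v v')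
  | fourth (hs : SameThird C D v v')

variable [Finite V]

theorem Similar.adj_of_third (h : Similar C D n) (h1 : G.IsThird x w₁) (h2 : G.IsThird x w₂)
    (h1' : H.IsThird z w₁') (h2' : H.IsThird z w₂') (hs1 : SameLower C D w₁ w₁')
    (hs2 : SameLower C D w₂ w₂') (hadj : G.Adj w₁ w₂) : H.Adj w₁' w₂' := by
  obtain ⟨v, hv1, hv2, hvf⟩ := C.exists_common_lower h.left h1 h2 hadj
  obtain ⟨a, b, i, hab, rfl, -⟩ := (C.mem_lower h1.toIsFar).1 ⟨hv1, hvf⟩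
  refine D.adj_of_common_lower h1'.toIsFar h2'.toIsFar ?_ hab ((hs1 _ _ _ hab).1 hv1)
    ((hs2 _ _ _ hab).1 hv2) ?_
  · rintro rfl
    exact hadj.ne (hs1.eq_left h1 h2 hs2)
  · intro q hq1 hq2 hqf hadj'
    obtain ⟨c, d, j, hcd, rfl, -⟩ := (D.mem_lower h1'.toIsFar).1 ⟨hq1, hqf⟩
    exact C.isLocallyMoore.cliqueFree w₁ _ _ _ hadj hv1 ((hs1 _ _ _ hcd).2 hq1) hv2
      ((hs2 _ _ _ hcd).2 hq2) (adj_u_congr h.symm.sigma_eq hab hcd hadj')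

variable [Finite W]

/-- Vertices at distance three over the same path in the two graphs have the same lower
neighbours. -/
theorem sameLower_of_path (h : Similar C D n)
    (hw : G.IsThird x w) (hw' : H.IsThird z w')
    (hab : petersenFin.Adj a b) (hbc : petersenFin.Adj b c) (hcd : petersenFin.Adj c d)
    (hac : a ≠ c) (hbd : b ≠ d) (h0 : G.Adj w (C.u a b i))
    (h1 : G.Adj w (C.u b c (i + C.σ a b c)))
    (h2 : G.Adj w (C.u c d (i + C.σ a b c + C.σ b c d)))
    (h0' : H.Adj w' (D.u a b i)) (h1' : H.Adj w' (D.u b c (i + C.σ a b c)))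
    (h2' : H.Adj w' (D.u c d (i + C.σ a b c + C.σ b c d))) : SameLower C D w w' := by
  have had : a ≠ d := by
    rintro rfl
    exact petersenFin_no_triangle _ _ hab _ hbc hcd
  obtain ⟨hσ, hC, hD⟩ := h
  rw [← hσ] at h1' h2'
  intro a' b' i' hab'
  rw [← C.u_mem_lower hab', ← D.u_mem_lower hab']
  rcases C.ncard_lower hw.toIsFar hw.nonempty with h5 | h6
  · obtain ⟨e, hde, hea, -, hl⟩ := C.exists_pentagon hw.toIsFar h5 hab hbc hcd hac hbd h0 h1 h2
    obtain ⟨e', hde', hea', -, hl'⟩ := D.exists_pentagon hw'.toIsFar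
      ((hD _ hw').trans ((hC _ hw).symm.trans h5)) hab hbc hcd hac hbd h0' h1' h2'
    obtain rfl : e = e' := by
      by_contra hee
      exact petersenFin_no_square _ _ hde _ hea had.symm _ hea'.symm hee hde'.symm
    rw [hl, hl', hσ, C.u_eq_iff hab' hab, C.u_eq_iff hab' hbc, C.u_eq_iff hab' hcd,
      C.u_eq_iff hab' hde, C.u_eq_iff hab' hea, D.u_eq_iff hab' hab, D.u_eq_iff hab' hbc,
      D.u_eq_iff hab' hcd, D.u_eq_iff hab' hde, D.u_eq_iff hab' hea]
  · obtain ⟨e, f, hde, hef, hfa, hce, hdf, hea, hfb, -, hl⟩ :=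
      C.exists_hexagon hw.toIsFar h6 hab hbc hcd hac hbd h0 h1 h2
    obtain ⟨e', f', hde', hef', hfa', hce', hdf', hea', hfb', -, hl'⟩ :=
      D.exists_hexagon hw'.toIsFar ((hD _ hw').trans ((hC _ hw).symm.trans h6)) hab hbc hcd hac hbd
        h0' h1' h2'
    obtain rfl : e = e' := petersenFin_hexagon_unique a b hab c hbc hac d hcd hbd e hde hce f hef
      hfa e' hde' hce' f' hef' hfa'
    obtain rfl : f = f' := by
      by_contra hff
      exact petersenFin_no_square _ _ hef _ hfa hea _ hfa'.symm hff hef'.symm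
    rw [hl, hl', hσ, C.u_eq_iff hab' hab, C.u_eq_iff hab' hbc, C.u_eq_iff hab' hcd,
      C.u_eq_iff hab' hde, C.u_eq_iff hab' hef, C.u_eq_iff hab' hfa, D.u_eq_iff hab' hab,
      D.u_eq_iff hab' hbc, D.u_eq_iff hab' hcd, D.u_eq_iff hab' hde, D.u_eq_iff hab' hef,
      D.u_eq_iff hab' hfa]

theorem Similar.exists_third (h : Similar C D n) (hw : G.IsThird x w) :
    ∃ w', H.IsThird z w' ∧ SameLower C D w w' := by
  obtain ⟨a, b, c, d, i, hab, hbc, hcd, hac, hbd, h0, h1, h2⟩ := C.exists_path hw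
  obtain ⟨w', hw', h0', h1', h2'⟩ := D.exists_isFar hab hbc hcd hac hbd i
  rw [h.sigma_eq] at h1' h2'
  have hw'' := D.isThird_of_adj hw' hab h0'
  exact ⟨w', hw'', sameLower_of_path h hw hw'' hab hbc hcd hac hbd h0 h1 h2 h0' h1' h2'⟩

theorem Similar.exists_fourth (h : Similar C D n) (hm : G.IsFourth x m) :
    ∃ m', SameThird C D m m' := by
  obtain ⟨w, hw, hwm⟩ := hm.exists_third
  obtain ⟨w', hw', hs⟩ := h.exists_third hw
  have h6 : n = 6 := by
    rw [← h.left w hw]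
    refine (C.ncard_lower hw.toIsFar hw.nonempty).resolve_left fun h5 => ?_
    obtain ⟨r, hr, h3 | h3⟩ := C.exists_lower_of_pentagon hw.toIsFar h5 hwm
    · exact h3.2 hm.toIsFar
    · exact hr.2 (hm.lower_eq r h3)
  obtain ⟨m', hm', hmf', hml', -⟩ := D.exists_centre hw'.toIsFar ((h.right w' hw').trans h6)
  refine ⟨m', hm, ⟨hmf', fun v hv => ?_, w', hw', hm'⟩, w, w', hw, hw', hwm.symm, hm'.symm, hs⟩
  by_contra hvf
  obtain ⟨k, hk1, hk2, hkf⟩ := D.exists_common_lower h.right hw' ⟨hmf', v, hv, hvf⟩ hm'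
  exact hml' k ⟨hk1, hkf⟩ hk2

theorem Similar.adj_of_fourth (h : Similar C D n) (hm : SameThird C D m m') (h2 : G.IsThird x w₂)
    (h2' : H.IsThird z w₂') (hs2 : SameLower C D w₂ w₂') (hadj : G.Adj m w₂) : H.Adj m' w₂' := by
  have step : ∀ {w₁ w₂ w₁' w₂'}, G.IsThird x w₁ → G.IsThird x w₂ → H.IsThird z w₁' →
      H.IsThird z w₂' → SameLower C D w₁ w₁' → SameLower C D w₂ w₂' → G.Adj w₁ w₂ →
      H.Adj m' w₁' → H.Adj m' w₂' := by
    intro w₁ w₂ w₁' w₂' h1 h2 h1' h2' hs1 hs2 h12 hm1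
    refine (D.adj_of_isFourth h1' hm.right.lower_eq hm.right.toIsFar hm1.symm
      (h.adj_of_third h1 h2 h1' h2' hs1 hs2 h12) h2'.toIsFar ?_).1
    rintro rfl
    obtain ⟨v, hv⟩ := h2'.nonempty
    exact hv.2 (hm.right.lower_eq v hv.1)
  obtain ⟨w₁, w₁', h1, h1', hm1, hm1', hs1⟩ := hm.exists_third
  by_cases e : w₁ = w₂
  · subst e
    rwa [hs2.symm.eq_left h2' h1' hs1.symm]
  by_cases h12 : G.Adj w₁ w₂
  · exact step h1 h2 h1' h2' hs1 hs2 h12 hm1'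
  · obtain ⟨q, hq1, hq2, hqm⟩ := C.isLocallyMoore.exists_second e h12 hm1.symm hadj.symm
    have hq := C.isThird_of_isFourth hm.left hqm
    obtain ⟨q', hq', hqs⟩ := h.exists_third hq
    exact step hq h2 hq' h2' hqs hs2 hq2.symm (step h1 hq h1' hq' hs1 hqs hq1 hm1')

theorem Similar.eq_of_fourth (h : Similar C D n) {m₁ m₂ : V} (h1 : SameThird C D m₁ m')
    (h2 : SameThird C D m₂ m') : m₁ = m₂ := by
  by_contra hne
  obtain ⟨w, w', hw, hw', hm, hm', hs⟩ := h2.exists_third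
  have h3 := h.symm.adj_of_fourth h1.symm hw' hw hs.symm hm'
  obtain ⟨v, hv⟩ := (C.adj_of_isFourth hw h1.left.lower_eq h1.left.toIsFar h3.symm hm.symm
    h2.left.toIsFar (Ne.symm hne)).2.nonempty
  exact hv.2 (h2.left.lower_eq v hv.1)

theorem Similar.exists_rel (h : Similar C D n) (hc : G.Connected) (v : V) : ∃ v', Rel C D v v' := by
  -- The vertices at distance at most four are closed under adjacency.
  have step : ∀ v v', G.Adj v v' → (¬G.IsFar x v ∨ G.IsThird x v ∨ G.IsFourth x v) →
      (¬G.IsFar x v' ∨ G.IsThird x v' ∨ G.IsFourth x v') := by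
    intro v v' hvv hv
    by_cases hf : G.IsFar x v'
    swap
    · exact Or.inl hf
    refine Or.inr ?_
    rcases hv with hv | hv | hv
    · exact Or.inl ⟨hf, v, hvv.symm, hv⟩
    · by_cases hl : (G.lower x v').Nonempty
      · exact Or.inl ⟨hf, hl⟩
      · refine Or.inr ⟨hf, fun r hr => ?_, v, hv, hvv⟩
        by_contra hrf
        exact hl ⟨r, hr, hrf⟩
    · exact Or.inl (C.isThird_of_isFourth hv hvv)
  have hx : ¬G.IsFar x x := fun hf => hf.ne rfl
  obtain ⟨p⟩ := hc.preconnected x v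
  have hv : ¬G.IsFar x v ∨ G.IsThird x v ∨ G.IsFourth x v := by
    suffices H : ∀ {s t : V}, G.Walk s t → (¬G.IsFar x s ∨ G.IsThird x s ∨ G.IsFourth x s) →
        (¬G.IsFar x t ∨ G.IsThird x t ∨ G.IsFourth x t) from H p (Or.inl hx)
    intro s t q
    induction q with
    | nil => exact id
    | cons hadj _ ih => exact fun hs => ih (step _ _ hadj hs)
  rcases hv with hv | hv | hv
  · by_cases h0 : v = x
    · exact ⟨z, .base h0 rfl⟩
    by_cases h1 : ∃ a, v = C.y a
    · obtain ⟨a, ha⟩ := h1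
      exact ⟨_, .first a ha rfl⟩
    · obtain ⟨a, b, i, hab, hu⟩ := C.exists_u_of_not_isFar hv h0 (fun a ha => h1 ⟨a, ha⟩)
      exact ⟨_, .second a b i hab hu rfl⟩
  · obtain ⟨w', hw', hs⟩ := h.exists_third hv
    exact ⟨w', .third hv hw' hs⟩
  · obtain ⟨m', hm'⟩ := h.exists_fourth hv
    exact ⟨m', .fourth hm'⟩

theorem Similar.adj_of_rel (h : Similar C D n) {v₁ v₂ : V} {v₁' v₂' : W} (h1 : Rel C D v₁ v₁')
    (h2 : Rel C D v₂ v₂') (hadj : G.Adj v₁ v₂) : H.Adj v₁' v₂' := by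
  rcases h1 with ⟨rfl, rfl⟩ | ⟨a, rfl, rfl⟩ | ⟨a, b, i, hab, rfl, rfl⟩ | ⟨h1, h1', hs1⟩ | hm1 <;>
  rcases h2 with ⟨h3, h4⟩ | ⟨c, rfl, rfl⟩ | ⟨c, d, j, hcd, rfl, rfl⟩ | ⟨h2, h2', hs2⟩ | hm2
  · exact absurd h3.symm hadj.ne
  · exact D.adj_y c
  · exact absurd hadj (C.not_adj_u hcd j)
  · exact absurd hadj h2.not_adj
  · exact absurd hadj hm2.left.not_adj
  · exact h4 ▸ (D.adj_y a).symm
  · exact (D.y_adj_iff a c).2 ((C.y_adj_iff a c).1 hadj)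
  · exact (D.y_adj_u hcd).2 ((C.y_adj_u hcd).1 hadj)
  · exact absurd hadj (C.not_adj_y h2.toIsFar)
  · exact absurd hadj (C.not_adj_y hm2.left.toIsFar)
  · exact absurd (h3 ▸ hadj.symm) (C.not_adj_u hab i)
  · exact ((D.y_adj_u hab).2 ((C.y_adj_u hab).1 hadj.symm)).symm
  · exact adj_u_congr h.sigma_eq hab hcd hadj
  · exact ((hs2 _ _ _ hab).1 hadj.symm).symm
  · exact absurd (hm2.left.lower_eq _ hadj.symm) (C.not_isFar_u hab)
  · exact absurd (h3 ▸ hadj.symm) h1.not_adj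
  · exact absurd hadj.symm (C.not_adj_y h1.toIsFar)
  · exact (hs1 _ _ _ hcd).1 hadj
  · exact h.adj_of_third h1 h2 h1' h2' hs1 hs2 hadj
  · exact (h.adj_of_fourth hm2 h1 h1' hs1 hadj.symm).symm
  · exact absurd (h3 ▸ hadj.symm) hm1.left.not_adj
  · exact absurd hadj.symm (C.not_adj_y hm1.left.toIsFar)
  · exact absurd (hm1.left.lower_eq _ hadj) (C.not_isFar_u hcd)
  · exact h.adj_of_fourth hm1 h2 h2' hs2 hadj
  · obtain ⟨v, hv⟩ := (C.isThird_of_isFourth hm1.left hadj).nonempty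
    exact absurd (hm2.left.lower_eq v hv.1) hv.2

theorem Similar.eq_of_rel (h : Similar C D n) {v₁ v₂ : V} {v' : W} (h1 : Rel C D v₁ v')
    (h2 : Rel C D v₂ v') : v₁ = v₂ := by
  rcases h1 with ⟨rfl, rfl⟩ | ⟨a, rfl, rfl⟩ | ⟨a, b, i, hab, rfl, rfl⟩ | ⟨h1, h1', hs1⟩ | hm1 <;>
  rcases h2 with ⟨h3, h4⟩ | ⟨c, rfl, h4⟩ | ⟨c, d, j, hcd, rfl, h4⟩ | ⟨h2, h2', hs2⟩ | hm2
  · exact h3.symm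
  · exact absurd h4 (D.adj_y c).ne
  · exact absurd h4.symm (D.u_ne c d j hcd)
  · exact absurd rfl h2'.ne
  · exact absurd rfl hm2.right.ne
  · exact absurd h4 (D.adj_y a).ne'
  · rw [D.y_injective h4]
  · exact absurd h4 (D.y_ne_u hcd)
  · exact absurd (D.adj_y a) h2'.not_adj
  · exact absurd (D.adj_y a) hm2.right.not_adj
  · exact absurd h4 (D.u_ne a b i hab)
  · exact absurd h4.symm (D.y_ne_u hab)
  · exact (C.u_eq_iff hab hcd).2 ((D.u_eq_iff hab hcd).1 h4)
  · exact absurd h2'.toIsFar (D.not_isFar_u hab)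
  · exact absurd hm2.right.toIsFar (D.not_isFar_u hab)
  · exact absurd h4 h1'.ne
  · exact absurd (h4 ▸ D.adj_y c) h1'.not_adj
  · exact absurd (h4 ▸ h1'.toIsFar) (D.not_isFar_u hcd)
  · exact hs1.eq_left h1 h2 hs2
  · obtain ⟨v, hv⟩ := h1'.nonempty
    exact absurd (hm2.right.lower_eq v hv.1) hv.2
  · exact absurd h4 hm1.right.ne
  · exact absurd (h4 ▸ D.adj_y c) hm1.right.not_adj
  · exact absurd (h4 ▸ hm1.right.toIsFar) (D.not_isFar_u hcd)
  · obtain ⟨v, hv⟩ := h2'.nonempty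
    exact absurd (hm1.right.lower_eq v hv.1) hv.2
  · exact h.eq_of_fourth hm1 hm2

end PetersenChart

/-- Two connected locally Petersen graphs in which any two vertices at distance two have two,
adjacent common neighbours are isomorphic if they have the same intersection number `c 3`, with
respect to one vertex of each. -/
theorem IsLocallyMoore.nonempty_iso {V W : Type*} [Finite V] [Finite W] {G : SimpleGraph V}
    {H : SimpleGraph W} (hG : G.IsLocallyMoore 10 3) (hH : H.IsLocallyMoore 10 3)
    (cG : G.Connected) (cH : H.Connected) {x : V} {z : W} {n : ℕ} (hn : n = 5 ∨ n = 6)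
    (hx : ∀ w, G.IsThird x w → (G.lower x w).ncard = n)
    (hz : ∀ w, H.IsThird z w → (H.lower z w).ncard = n) : Nonempty (G ≃g H) := by
  have := cG.nonempty
  obtain ⟨C⟩ := hG.nonempty_petersenChart x
  obtain ⟨D⟩ := hH.nonempty_petersenChart z
  obtain ⟨D', hσ⟩ : ∃ D' : H.PetersenChart z, D'.σ = C.σ := by
    rcases hn with rfl | rfl
    · exact C.exists_sigma_eq D 0
        (fun a b c d e => C.pentagon_sum_eq_zero fun w h1 h2 => hx w ⟨h1, h2⟩)
        (fun a b c d e => D.pentagon_sum_eq_zero fun w h1 h2 => hz w ⟨h1, h2⟩)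
    · exact C.exists_sigma_eq D 1
        (fun a b c d e => C.pentagon_sum_eq_one fun w h1 h2 => hx w ⟨h1, h2⟩)
        (fun a b c d e => D.pentagon_sum_eq_one fun w h1 h2 => hz w ⟨h1, h2⟩)
  have h : PetersenChart.Similar C D' n := ⟨hσ, hx, hz⟩
  choose φ hφ using fun v => h.exists_rel cG v
  obtain ⟨e⟩ := nonempty_iso_of_injective (T := G) φ
    (fun v w hvw => h.adj_of_rel (hφ v) (hφ w) hvw)
    (fun v w e => h.eq_of_rel (hφ v) (e ▸ hφ w)) (d := 10) hG.ncard_neighborSet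
    hH.ncard_neighborSet cH
  exact ⟨e.symm⟩

end SimpleGraph

/-! ### Graphs given by the binary digits of a number -/

/-- The bits of the `i`-th row of the `n × n` matrix with entries the binary digits of `M`. -/
def bitRow (n M i : ℕ) : ℕ := (M >>> (n * i)) % 2 ^ n

/-- The entries of the `n × n` matrix with entries the binary digits of `M`. -/
def bitAdj (n M i j : ℕ) : Bool := (bitRow n M i).testBit j

/-- The positions of the highest `c` ones in the binary expansion of `B`. -/
def bitList : ℕ → ℕ → List ℕ
  | 0, _ => []
  | c + 1, B => bif B == 0 then [] else Nat.log2 B :: bitList c (B - 2 ^ Nat.log2 B)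

/-- The number with ones at the given positions. -/
def ofBits (L : List ℕ) : ℕ := L.foldr (fun p r => 2 ^ p ||| r) 0

/-- The number `B` has exactly `c` ones in its binary expansion. -/
def hasBits (c B : ℕ) : Bool :=
  (bitList c B).length == c && decide (bitList c B).Nodup && ofBits (bitList c B) == B

theorem testBit_ofBits (L : List ℕ) (k : ℕ) : (ofBits L).testBit k = true ↔ k ∈ L := by
  induction L with
  | nil => simp [ofBits]
  | cons p L ih =>
    have e : ofBits (p :: L) = 2 ^ p ||| ofBits L := rfl
    rw [e, Nat.testBit_or, Bool.or_eq_true, ih, Nat.testBit_two_pow, decide_eq_true_iff,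
      List.mem_cons, eq_comm]

theorem mem_bitList {c B : ℕ} (h : hasBits c B = true) (k : ℕ) :
    k ∈ bitList c B ↔ B.testBit k = true := by
  simp only [hasBits, Bool.and_eq_true, beq_iff_eq] at h
  rw [← testBit_ofBits, h.2]

theorem ncard_of_hasBits {c B : ℕ} (h : hasBits c B = true) :
    {k | B.testBit k = true}.ncard = c := by
  have e : {k | B.testBit k = true} = ((bitList c B).toFinset : Set ℕ) := by
    ext k
    simp [mem_bitList h]
  simp only [hasBits, Bool.and_eq_true, beq_iff_eq, decide_eq_true_iff] at h
  rw [e, Set.ncard_coe_finset, List.toFinset_card_of_nodup h.1.2, h.1.1]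

theorem lt_of_testBit_bitRow {n M i k : ℕ} (h : (bitRow n M i).testBit k = true) : k < n := by
  rw [bitRow, Nat.testBit_mod_two_pow, Bool.and_eq_true, decide_eq_true_iff] at h
  exact h.1

/-- A test on the number of common neighbours of the vertices `i` and `j`, and on the adjacencies
between these. -/
def checkPair (n M i j : ℕ) : Bool :=
  bif i == j then hasBits 10 (bitRow n M i)
  else bif bitAdj n M i j then
    hasBits 3 (bitRow n M i &&& bitRow n M j) &&
      (bitList 3 (bitRow n M i &&& bitRow n M j)).all fun p =>
        (bitList 3 (bitRow n M i &&& bitRow n M j)).all fun q => !bitAdj n M p q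
  else bitRow n M i &&& bitRow n M j == 0 ||
    (hasBits 2 (bitRow n M i &&& bitRow n M j) &&
      (bitList 2 (bitRow n M i &&& bitRow n M j)).all fun p =>
        (bitList 2 (bitRow n M i &&& bitRow n M j)).all fun q => p == q || bitAdj n M p q)

/-- A test on the distances to the vertex `0`: a vertex `j > 0` has a neighbour with a smaller
number, the vertices from `41 = 1 + 10 + 30` on are those at distance at least three from `0`, and
each of them has no or `c` neighbours at distance two from `0`. -/
def checkBase (n M c j : ℕ) : Bool :=
  (j == 0 || bitRow n M j % 2 ^ j != 0) &&
    (Nat.ble 41 j == (j != 0 && !bitAdj n M 0 j && (bitRow n M 0 &&& bitRow n M j == 0))) &&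
    (Nat.blt j 41 || bitRow n M j % 2 ^ 41 == 0 || hasBits c (bitRow n M j % 2 ^ 41))

/-- The two tests for all vertices. -/
def checkMatrix (n M c : ℕ) : Bool :=
  (List.range n).all fun i => checkBase n M c i && (List.range n).all fun j => checkPair n M i j

namespace SimpleGraph

/-- The vertices of `G` are numbered by `f`, and `M` encodes the adjacency matrix. -/
structure IsBitGraph {V : Type*} (G : SimpleGraph V) (n M : ℕ) (f : Fin n → V) : Prop where
  bijective : Function.Bijective f
  adj_iff : ∀ i j, G.Adj (f i) (f j) ↔ bitAdj n M i j = true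

namespace IsBitGraph

variable {V : Type*} {G : SimpleGraph V} {n M c : ℕ} {f : Fin n → V}

theorem ncard_eq (h : G.IsBitGraph n M f) {s : Set V} {B : ℕ}
    (hs : ∀ k : Fin n, f k ∈ s ↔ B.testBit k = true) (hB : ∀ k, B.testBit k = true → k < n)
    (hc : hasBits c B = true) : s.ncard = c := by
  have e : s = f '' {k | B.testBit k = true} := by
    ext v
    obtain ⟨k, rfl⟩ := h.bijective.2 v
    rw [h.bijective.1.mem_set_image, hs, Set.mem_ofPred_eq]
  have e' : {k | B.testBit k = true} = Fin.val '' {k : Fin n | B.testBit k = true} := by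
    ext k
    exact ⟨fun hk => ⟨⟨k, hB k hk⟩, hk, rfl⟩, by rintro ⟨k, hk, rfl⟩; exact hk⟩
  rw [e, Set.ncard_image_of_injective _ h.bijective.1, ← ncard_of_hasBits hc, e',
    Set.ncard_image_of_injective _ Fin.val_injective]

theorem mem_commonNeighbors_iff (h : G.IsBitGraph n M f) (i j k : Fin n) :
    f k ∈ G.commonNeighbors (f i) (f j) ↔
      (bitRow n M i &&& bitRow n M j).testBit k = true := by
  rw [mem_commonNeighbors, h.adj_iff, h.adj_iff, Nat.testBit_and, Bool.and_eq_true]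
  rfl

theorem lt_of_testBit_and {i j k : ℕ}
    (hk : (bitRow n M i &&& bitRow n M j).testBit k = true) : k < n := by
  rw [Nat.testBit_and, Bool.and_eq_true] at hk
  exact lt_of_testBit_bitRow hk.1

theorem checkPair_of_checkMatrix (hc : checkMatrix n M c = true) (i j : Fin n) :
    checkPair n M i j = true := by
  simp only [checkMatrix, List.all_eq_true, List.mem_range, Bool.and_eq_true] at hc
  exact (hc i i.2).2 j j.2

theorem checkBase_of_checkMatrix (hc : checkMatrix n M c = true) (i : Fin n) :
    checkBase n M c i = true := by
  simp only [checkMatrix, List.all_eq_true, List.mem_range, Bool.and_eq_true] at hc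
  exact (hc i i.2).1

theorem commonNeighbors_of_adj (h : G.IsBitGraph n M f) (hc : checkMatrix n M c = true) {i j : Fin n}
    (hij : G.Adj (f i) (f j)) : (G.commonNeighbors (f i) (f j)).ncard = 3 ∧
      ∀ p ∈ G.commonNeighbors (f i) (f j), ∀ q ∈ G.commonNeighbors (f i) (f j), ¬G.Adj p q := by
  have hne : (i : ℕ) ≠ j := fun e => hij.ne (by rw [Fin.ext e])
  have h1 := checkPair_of_checkMatrix hc i j
  rw [checkPair, beq_false_of_ne hne, (h.adj_iff i j).1 hij] at h1
  simp only [cond_false, cond_true, Bool.and_eq_true, List.all_eq_true] at h1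
  refine ⟨h.ncard_eq (h.mem_commonNeighbors_iff i j) (fun k => lt_of_testBit_and) h1.1, ?_⟩
  intro p hp q hq
  obtain ⟨p, rfl⟩ := h.bijective.2 p
  obtain ⟨q, rfl⟩ := h.bijective.2 q
  rw [h.mem_commonNeighbors_iff] at hp hq
  have h2 := h1.2 p ((mem_bitList h1.1 _).2 hp) q ((mem_bitList h1.1 _).2 hq)
  rw [h.adj_iff]
  simpa using h2

theorem commonNeighbors_of_not_adj (h : G.IsBitGraph n M f) (hc : checkMatrix n M c = true) {i j : Fin n}
    (hne : f i ≠ f j) (hij : ¬G.Adj (f i) (f j)) : G.IsClique (G.commonNeighbors (f i) (f j)) ∧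
      ((G.commonNeighbors (f i) (f j)).Nonempty → (G.commonNeighbors (f i) (f j)).ncard = 2) := by
  have hne' : (i : ℕ) ≠ j := fun e => hne (by rw [Fin.ext e])
  have h1 := checkPair_of_checkMatrix hc i j
  rw [h.adj_iff, Bool.not_eq_true] at hij
  rw [checkPair, beq_false_of_ne hne', hij] at h1
  simp only [cond_false, Bool.and_eq_true, Bool.or_eq_true, List.all_eq_true, beq_iff_eq] at h1
  rcases h1 with h1 | ⟨h1, h2⟩
  · have he : ∀ p, p ∉ G.commonNeighbors (f i) (f j) := by
      intro p hp
      obtain ⟨p, rfl⟩ := h.bijective.2 p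
      rw [h.mem_commonNeighbors_iff, h1] at hp
      simp at hp
    exact ⟨fun p hp => absurd hp (he p), fun ⟨p, hp⟩ => absurd hp (he p)⟩
  · refine ⟨fun p hp q hq hpq => ?_, fun _ =>
      h.ncard_eq (h.mem_commonNeighbors_iff i j) (fun k => lt_of_testBit_and) h1⟩
    obtain ⟨p, rfl⟩ := h.bijective.2 p
    obtain ⟨q, rfl⟩ := h.bijective.2 q
    rw [h.mem_commonNeighbors_iff] at hp hq
    rw [h.adj_iff]
    exact (h2 p ((mem_bitList h1 _).2 hp) q ((mem_bitList h1 _).2 hq)).resolve_left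
      fun e => hpq (by rw [Fin.ext e])

theorem isLocallyMoore (h : G.IsBitGraph n M f) (hc : checkMatrix n M c = true) :
    G.IsLocallyMoore 10 3 where
  ncard_neighborSet v := by
    obtain ⟨i, rfl⟩ := h.bijective.2 v
    have h1 := checkPair_of_checkMatrix hc i i
    rw [checkPair, beq_self_eq_true, cond_true] at h1
    exact h.ncard_eq (fun k => h.adj_iff i k) (fun k => lt_of_testBit_bitRow) h1
  ncard_of_adj v w hvw := by
    obtain ⟨i, rfl⟩ := h.bijective.2 v
    obtain ⟨j, rfl⟩ := h.bijective.2 w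
    exact (h.commonNeighbors_of_adj hc hvw).1
  isClique v w hne hvw := by
    obtain ⟨i, rfl⟩ := h.bijective.2 v
    obtain ⟨j, rfl⟩ := h.bijective.2 w
    exact (h.commonNeighbors_of_not_adj hc hne hvw).1
  ncard_of_mem v w p hne hvw h1 h2 := by
    obtain ⟨i, rfl⟩ := h.bijective.2 v
    obtain ⟨j, rfl⟩ := h.bijective.2 w
    exact (h.commonNeighbors_of_not_adj hc hne hvw).2 ⟨p, h1, h2⟩
  cliqueFree v w p q h1 h2 h3 h4 h5 h6 := by
    obtain ⟨i, rfl⟩ := h.bijective.2 v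
    obtain ⟨j, rfl⟩ := h.bijective.2 w
    exact (h.commonNeighbors_of_adj hc h1).2 p ⟨h2, h4⟩ q ⟨h3, h5⟩ h6

theorem connected (h : G.IsBitGraph n M f) (hc : checkMatrix n M c = true) (hn : 0 < n) :
    G.Connected := by
  have key : ∀ j : ℕ, ∀ hj : j < n, G.Reachable (f ⟨0, hn⟩) (f ⟨j, hj⟩) := by
    intro j
    induction j using Nat.strong_induction_on with
    | _ j ih =>
      intro hj
      have h1 := checkBase_of_checkMatrix hc ⟨j, hj⟩
      simp only [checkBase, Bool.and_eq_true, Bool.or_eq_true, beq_iff_eq, bne_iff_ne] at h1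
      rcases h1.1.1 with rfl | h2
      · exact .rfl
      · obtain ⟨i, hi⟩ := Nat.exists_testBit_of_ne_zero h2
        rw [Nat.testBit_mod_two_pow, Bool.and_eq_true, decide_eq_true_iff] at hi
        exact (ih i hi.1 (hi.1.trans hj)).trans
          ((h.adj_iff ⟨j, hj⟩ ⟨i, hi.1.trans hj⟩).2 hi.2).symm.reachable
  have : Nonempty V := ⟨f ⟨0, hn⟩⟩
  refine ⟨fun v w => ?_⟩
  obtain ⟨i, rfl⟩ := h.bijective.2 v
  obtain ⟨j, rfl⟩ := h.bijective.2 w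
  exact (key i i.2).symm.trans (key j j.2)

theorem isFar_iff (h : G.IsBitGraph n M f) (hc : checkMatrix n M c = true) (hn : 0 < n)
    (j : Fin n) : G.IsFar (f ⟨0, hn⟩) (f j) ↔ 41 ≤ (j : ℕ) := by
  have h1 := checkBase_of_checkMatrix hc j
  simp only [checkBase, Bool.and_eq_true, Bool.or_eq_true] at h1
  have h2 := beq_iff_eq.1 h1.1.2
  rw [← Nat.ble_eq, h2]
  simp only [Bool.and_eq_true, bne_iff_ne, Bool.not_eq_true', beq_iff_eq]
  constructor
  · rintro ⟨h3, h4, h5⟩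
    rw [h.adj_iff, Bool.not_eq_true] at h4
    refine ⟨⟨fun e => h3 (congrArg f (Fin.ext e)), h4⟩, ?_⟩
    by_contra h6
    obtain ⟨k, hk⟩ := Nat.exists_testBit_of_ne_zero h6
    have := (h.mem_commonNeighbors_iff ⟨0, hn⟩ j ⟨k, lt_of_testBit_and hk⟩).2 hk
    exact h5 _ this.1 this.2.symm
  · rintro ⟨⟨h3, h4⟩, h5⟩
    refine ⟨fun e => h3 (congrArg Fin.val (h.bijective.1 e)), ?_, fun p hp hpj => ?_⟩
    · rw [h.adj_iff, Bool.not_eq_true]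
      exact h4
    · obtain ⟨k, rfl⟩ := h.bijective.2 p
      have := (h.mem_commonNeighbors_iff ⟨0, hn⟩ j k).1 ⟨hp, hpj.symm⟩
      rw [show bitRow n M (⟨0, hn⟩ : Fin n) = bitRow n M 0 from rfl, h5] at this
      simp at this

theorem ncard_lower (h : G.IsBitGraph n M f) (hc : checkMatrix n M c = true) (hn : 0 < n) {w : V}
    (hw : G.IsThird (f ⟨0, hn⟩) w) : (G.lower (f ⟨0, hn⟩) w).ncard = c := by
  obtain ⟨j, rfl⟩ := h.bijective.2 w
  have hj := (h.isFar_iff hc hn j).1 hw.toIsFar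
  have hl : ∀ k : Fin n, f k ∈ G.lower (f ⟨0, hn⟩) (f j) ↔
      (bitRow n M j % 2 ^ 41).testBit k = true := by
    intro k
    rw [lower, Set.mem_ofPred_eq, h.adj_iff, h.isFar_iff hc hn, Nat.testBit_mod_two_pow,
      Bool.and_eq_true, decide_eq_true_iff, not_le, and_comm]
    rfl
  have h1 := checkBase_of_checkMatrix hc j
  simp only [checkBase, Bool.and_eq_true, Bool.or_eq_true, beq_iff_eq] at h1
  rcases h1.2 with (h2 | h2) | h2
  · simp only [Nat.blt, Nat.ble_eq] at h2
    omega
  · obtain ⟨v, hv⟩ := hw.nonempty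
    obtain ⟨k, rfl⟩ := h.bijective.2 v
    rw [hl, h2] at hv
    simp at hv
  · refine h.ncard_eq hl (fun k hk => ?_) h2
    rw [Nat.testBit_mod_two_pow, Bool.and_eq_true] at hk
    exact lt_of_testBit_bitRow hk.2

end IsBitGraph

end SimpleGraph

/-! ### The Doro graph and the Conway–Smith graph -/

/-- The coordinate vectors of the vertices of the Doro graph, as numbers in base five with the
coordinate `x 0` as the last digit, in the order of their distance to the first vertex. -/
def doroCode : List ℕ :=
  [25, 5, 255, 380, 1, 251, 376, 131, 506, 146, 521, 275, 400, 151, 526, 226, 601, 155, 230, 286,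
    361, 416, 491, 530, 605, 411, 486, 291, 366, 186, 211, 191, 216, 561, 586, 566, 591, 71, 96,
    56, 81, 306, 456, 321, 471, 431, 331, 446, 346, 111, 116, 36, 41, 86, 66, 61, 91, 356, 496,
    281, 421, 481, 371, 406, 296]

/-- The digits of the coordinate vectors of the vertices of the Doro graph. -/
def doroDigit (i t : ℕ) : ℕ := doroCode.getD i 0 / 5 ^ t % 5

/-- The vertices of the Doro graph. -/
def doroVec (i : Fin 65) (t : Fin 4) : ZMod 5 := (doroDigit i t : ZMod 5)

/-- The binary digits of this number form the adjacency matrix of the Doro graph. -/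
def doroMatrix : ℕ :=
  22602267477925125673403578431361040586725157973019373011200702815850583956211647464785246627869544812925538801139905878525383313409475454024853094553735800304398988536130987052350692436062677540409190854544556667899972263528519376214673416590006674886191174981241275012863714786995650758268122577410618406513430470166181772377905873135976036872532392703418650493364091473643439892954185304052548928400925877551593831001323626610457207021846149783253930400248015067049694370176461810667664772828318295824597582016911644931832654620483006008091795533232447150216517873975828173125151400310545242447829656590532322153446862242007906521569496150575227410418680112321577300415713107571335696137415856501910137837413394355359377506114499383385523707205005134375974045486553789406911985586012678335670530361802617535649908675330453775644216785880806265452722964141600579445216266195046627555700601565820099315749834408951432681140853352937516457312626638024020561978677295977476813238114002887291605003542737757704677102236330615022841233141795369686874254905082545772897098032399476916065111652971616781268772558313152982090604607477670057345804444809156395635203662497205305321093446874957454945708874667113947686491516680094128881348193196539056341596732672089601642827089918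

instance (x : Fin 4 → ZMod 5) : Decidable (IsNormalized x) :=
  inferInstanceAs (Decidable (∃ i : Fin 4, x i = 1 ∧ ∀ j : Fin 4, j < i → x j = 0))

theorem doroVec_mem : ∀ i : Fin 65, IsNormalized (doroVec i) ∧
    (ellipticForm (doroVec i) (doroVec i) = 1 ∨ ellipticForm (doroVec i) (doroVec i) = -1) := by
  decide +kernel

theorem exists_doroVec : ∀ a b c d : ZMod 5, IsNormalized ![a, b, c, d] →
    (ellipticForm ![a, b, c, d] ![a, b, c, d] = 1 ∨ ellipticForm ![a, b, c, d] ![a, b, c, d] = -1) →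
    ∃ i : Fin 65, doroVec i = ![a, b, c, d] := by
  decide +kernel

theorem doroVec_injective : ∀ i j : Fin 65, doroVec i = doroVec j → i = j := by
  decide +kernel

theorem doroDigit_adj : ((List.range 65).all fun i => (List.range 65).all fun j =>
    ((doroDigit i 0 * doroDigit j 0 + doroDigit i 1 * doroDigit j 1 + doroDigit i 2 * doroDigit j 2 +
      2 * (doroDigit i 3 * doroDigit j 3)) % 5 == 0) == bitAdj 65 doroMatrix i j) = true := by
  decide +kernel

theorem checkMatrix_doro : checkMatrix 65 doroMatrix 5 = true := by
  decide +kernel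

theorem isBitGraph_doroGraph :
    doroGraph.IsBitGraph 65 doroMatrix fun i => ⟨doroVec i, doroVec_mem i⟩ where
  bijective := by
    refine ⟨fun i j hij => doroVec_injective i j (congrArg Subtype.val hij), ?_⟩
    rintro ⟨x, hx1, hx2⟩
    have e : x = ![x 0, x 1, x 2, x 3] := by
      funext t
      fin_cases t <;> rfl
    obtain ⟨i, hi⟩ := exists_doroVec (x 0) (x 1) (x 2) (x 3) (e ▸ hx1) (e ▸ hx2)
    exact ⟨i, Subtype.ext (hi.trans e.symm)⟩
  adj_iff i j := by
    have h := doroDigit_adj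
    simp only [List.all_eq_true, List.mem_range] at h
    rw [← beq_iff_eq.1 (h i i.2 j j.2), beq_iff_eq, ← Nat.dvd_iff_mod_eq_zero,
      ← ZMod.natCast_eq_zero_iff]
    show ellipticForm (doroVec i) (doroVec j) = 0 ↔ _
    push_cast
    rfl

/-- The coordinate vectors of the vertices of the Conway–Smith graph, as numbers in base four with
the digits `0`, `1`, `2`, `3` for `0`, `1`, `ω`, `ω²`, in the order of their distance to the first
vertex. -/
def conwaySmithCode : List ℕ :=
  [1024, 1360, 1252, 1928, 1596, 1201, 1285, 1826, 1102, 1731, 1051, 256, 64, 16, 85, 286, 331,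
    192, 32, 4, 481, 966, 551, 768, 128, 8, 825, 170, 915, 512, 48, 12, 653, 626, 255, 1, 436, 2,
    876, 3, 728, 3368, 2508, 3458, 2355, 3652, 2168, 2881, 3171, 2836, 3228, 3601, 2258, 4080,
    3273, 2720, 2093, 3126, 2183, 3855, 2570, 3072, 2048]

/-- The vertices of the Conway–Smith graph. -/
def conwaySmithVec (i : Fin 63) (t : Fin 6) : GF4 :=
  ![0, 1, GF4.w, GF4.w2] (Fin.ofNat 4 (conwaySmithCode.getD i 0 / 4 ^ (t : ℕ)))

/-- The binary digits of this number form the adjacency matrix of the Conway–Smith graph. -/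
def conwaySmithMatrix : ℕ :=
  1034580725685506805989167821227507661168980498617940169427988062888000539949137574345133497074951964302341389475278937611507326094712923667822161488861737055391520749337686288200212884769326892657870639649592450135100002046255676843361151573992571161575038756881782183746417618576157193056770192812305963398124936929758641167080019255754910137998088995525692569158486131860171273080169168293779227297969487341739596739421953286585560022291329048778903831024226376268072561138092265732475772934324494021712681315660494138843048620582226636590606968812736671359448577903923718601793383094949477538363065438296369819550704572261457086410824227546277646317411276082544392920101195406715046275986295127869235511621958241002016307242839909142307325746760323426374958464533873021820843584103641579833354872943772006353032135652611167358500360419542718756481848691794485422384013007357813803510542957322684869495411357368332988241419856174944310099197778382420730556322583233270905928869324942627787529603598284985222270234174993300086041210232078303474301593468564138657507788250313478902198311260090016689090754116527199631959155265368008896870198319946472268194431867445384475033409618453518958462974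

theorem conwaySmithVec_mem : ∀ i : Fin 63, hexWeight (conwaySmithVec i) = 1 ∨
    (hexWeight (conwaySmithVec i) = 4 ∧ conwaySmithVec i =
      hexacodeWord (conwaySmithVec i 0) (conwaySmithVec i 1) (conwaySmithVec i 2)) := by
  decide +kernel

theorem exists_conwaySmithVec_single : ∀ (t : Fin 6) (g : GF4), g ≠ 0 →
    ∃ i : Fin 63, conwaySmithVec i = fun s => if s = t then g else 0 := by
  decide +kernel

theorem exists_conwaySmithVec_hexacodeWord : ∀ a b c : GF4, hexWeight (hexacodeWord a b c) = 4 →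
    ∃ i : Fin 63, conwaySmithVec i = hexacodeWord a b c := by
  decide +kernel

theorem conwaySmithVec_injective : ∀ i j : Fin 63, conwaySmithVec i = conwaySmithVec j → i = j := by
  decide +kernel

theorem conwaySmithVec_adj : ∀ i j : Fin 63, bitAdj 63 conwaySmithMatrix i j = true ↔ i ≠ j ∧
    (∃ t, conwaySmithVec i t ≠ 0 ∧ conwaySmithVec j t ≠ 0) ∧
    ∀ t, conwaySmithVec i t ≠ 0 → conwaySmithVec j t ≠ 0 →
      conwaySmithVec i t = conwaySmithVec j t := by
  decide +kernel

theorem checkMatrix_conwaySmith : checkMatrix 63 conwaySmithMatrix 6 = true := by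
  decide +kernel

theorem isBitGraph_conwaySmithGraph :
    conwaySmithGraph.IsBitGraph 63 conwaySmithMatrix fun i => ⟨conwaySmithVec i,
      (conwaySmithVec_mem i).imp_right fun h => ⟨h.1, _, _, _, h.2⟩⟩ where
  bijective := by
    refine ⟨fun i j hij => conwaySmithVec_injective i j (congrArg Subtype.val hij), ?_⟩
    rintro ⟨x, hx | ⟨hx, a, b, c, rfl⟩⟩
    · obtain ⟨t, ht⟩ := Finset.card_eq_one.1 hx
      have hs : ∀ s, x s ≠ 0 ↔ s = t := fun s => by
        have := Finset.ext_iff.1 ht s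
        simpa using this
      obtain ⟨i, hi⟩ := exists_conwaySmithVec_single t (x t) ((hs t).2 rfl)
      refine ⟨i, Subtype.ext (hi.trans ?_)⟩
      funext s
      split_ifs with h
      · rw [h]
      · exact (not_not.1 (mt (hs s).1 h)).symm
    · obtain ⟨i, hi⟩ := exists_conwaySmithVec_hexacodeWord a b c hx
      exact ⟨i, Subtype.ext hi⟩
  adj_iff i j := by
    rw [conwaySmithVec_adj]
    refine and_congr_left' (not_congr ?_)
    exact ⟨fun h => conwaySmithVec_injective i j (congrArg Subtype.val h), fun h => h ▸ rfl⟩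

/-! ### Distance-regular graphs that are locally Petersen graphs -/

namespace SimpleGraph

theorem isFar_iff_le_dist {V : Type*} {G : SimpleGraph V} (hc : G.Connected) {x w : V} :
    G.IsFar x w ↔ 3 ≤ G.dist x w := by
  constructor
  · rintro ⟨h1, h2, h3⟩
    have h4 : G.dist x w ≠ 0 := fun e => h1 ((hc.dist_eq_zero_iff).1 e).symm
    have h5 : G.dist x w ≠ 1 := fun e => h2 (dist_eq_one_iff_adj.1 e)
    have h6 : G.dist x w ≠ 2 := fun e => by
      obtain ⟨-, -, p, hp, hp'⟩ := dist_eq_two_iff.1 e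
      exact h3 p hp hp'.symm
    omega
  · intro h
    refine ⟨?_, fun h1 => ?_, fun p h1 h2 => ?_⟩
    · rintro rfl
      rw [dist_self] at h
      omega
    · rw [dist_eq_one_iff_adj.2 h1] at h
      omega
    · have h3 := hc.dist_triangle (u := x) (v := p) (w := w)
      rw [dist_eq_one_iff_adj.2 h1, dist_eq_one_iff_adj.2 h2] at h3
      omega

/-- In a distance-regular graph, all vertices at distance three from `x` have `c 3` neighbours at
distance two from `x`. -/
theorem IsDistanceRegularWith.ncard_lower {V : Type*} {G : SimpleGraph V} {b c : ℕ → ℕ}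
    (h : G.IsDistanceRegularWith b c) {x w : V} (hw : G.IsThird x w) :
    (G.lower x w).ncard = c 3 := by
  have hc := h.connected
  have hw3 := (isFar_iff_le_dist hc).1 hw.toIsFar
  obtain ⟨v, hv1, hv2⟩ := hw.nonempty
  rw [isFar_iff_le_dist hc] at hv2
  have h1 : G.dist x w = 3 := by
    have h2 := hc.dist_triangle (u := x) (v := v) (w := w)
    rw [dist_eq_one_iff_adj.2 hv1.symm] at h2
    omega
  rw [← h1, ← h.card_pred x w]
  congr 1
  ext z
  rw [lower, Set.mem_ofPred_eq, Set.mem_ofPred_eq, isFar_iff_le_dist hc]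
  refine and_congr_right fun hz => ?_
  have h2 := hc.dist_triangle (u := x) (v := z) (w := w)
  rw [dist_eq_one_iff_adj.2 hz.symm] at h2
  omega

/-- The Doro graph and the Conway–Smith graph are the distance-regular graphs that are locally
Petersen graphs and in which the common neighbours of two vertices at distance two are two adjacent
vertices. -/
theorem IsDistanceRegularWith.nonempty_iso_doroGraph_or {V : Type*} [Finite V] {G : SimpleGraph V}
    {b c : ℕ → ℕ} (h : G.IsDistanceRegularWith b c) (hG : G.IsLocallyMoore 10 3) :
    Nonempty (G ≃g doroGraph) ∨ Nonempty (G ≃g conwaySmithGraph) := by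
  obtain ⟨x⟩ := h.connected.nonempty
  obtain ⟨C⟩ := hG.nonempty_petersenChart x
  obtain ⟨w, hw, hwu, -⟩ := C.exists_isFar (a := 0) (b := 1) (c := 4) (d := 5) (by decide)
    (by decide) (by decide) (by decide) (by decide) 0
  have hw' := C.isThird_of_adj hw (by decide) hwu
  have hx : ∀ w, G.IsThird x w → (G.lower x w).ncard = c 3 := fun w hw => h.ncard_lower hw
  rcases C.ncard_lower hw'.toIsFar hw'.nonempty with h5 | h6
  · left
    rw [hx w hw'] at h5
    have hM := checkMatrix_doro
    exact hG.nonempty_iso (isBitGraph_doroGraph.isLocallyMoore hM) h.connected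
      (isBitGraph_doroGraph.connected hM (by norm_num)) (Or.inl rfl) (fun w hw => (hx w hw).trans h5)
      fun w hw => isBitGraph_doroGraph.ncard_lower hM (by norm_num) hw
  · right
    rw [hx w hw'] at h6
    have hM := checkMatrix_conwaySmith
    exact hG.nonempty_iso (isBitGraph_conwaySmithGraph.isLocallyMoore hM) h.connected
      (isBitGraph_conwaySmithGraph.connected hM (by norm_num)) (Or.inr rfl)
      (fun w hw => (hx w hw).trans h6)
      fun w hw => isBitGraph_conwaySmithGraph.ncard_lower hM (by norm_num) hw

/-- The strongly regular Terwilliger graphs with the parameters of the pentagon or of the Petersen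
graph. -/
theorem IsTerwilligerSRG.nonempty_iso_pentagon_or {V : Type*} [Finite V] {G : SimpleGraph V}
    {n k l : ℕ} (h : G.IsTerwilligerSRG n k l 1)
    (hp : n = 5 ∧ k = 2 ∧ l = 0 ∨ n = 10 ∧ k = 3 ∧ l = 0) :
    Nonempty (G ≃g pentagon) ∨ Nonempty (G ≃g petersenGraph) := by
  rcases hp with ⟨rfl, rfl, rfl⟩ | ⟨rfl, rfl, rfl⟩
  · exact Or.inl h.nonempty_iso_pentagon
  · obtain ⟨e⟩ := h.nonempty_iso_petersenFin
    obtain ⟨e'⟩ := nonempty_petersenFin_iso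
    exact Or.inr ⟨e.trans e'⟩

end SimpleGraph

theorem proposition6 :
    -- (i)
    (∀ {V : Type*} [Fintype V] (G : SimpleGraph V) [DecidableRel G.Adj] (v k a₁ c₂ : ℕ),
      G.IsSRGWith v k a₁ c₂ → G.Connected → G ≠ ⊤ →
      c₂ = 1 → k < 7 * (a₁ + 1) →
      Nonempty (G ≃g pentagon) ∨ Nonempty (G ≃g petersenGraph)) ∧
    -- (ii)
    (∀ {V : Type*} [Fintype V] (G : SimpleGraph V) [DecidableRel G.Adj] (v k a₁ c₂ : ℕ),
      G.IsSRGWith v k a₁ c₂ → G.IsTerwilliger →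
      v ≤ 7 * k →
      Nonempty (G ≃g pentagon) ∨ Nonempty (G ≃g petersenGraph)) ∧
    -- (iii)
    (∀ {V : Type*} [Fintype V] (G : SimpleGraph V) (b c : ℕ → ℕ),
      G.IsDistanceRegularWith b c → G.IsTerwilliger →
      (b 0 : ℚ) ≤ (6 + 8 / 57) * ((intersectionA b c 1 : ℚ) + 1) → 2 ≤ c 2 →
      Nonempty (G ≃g icosahedron) ∨ Nonempty (G ≃g doroGraph) ∨
        Nonempty (G ≃g conwaySmithGraph)) := by

  refine ⟨?_, ?_, ?_⟩
  · intro V _ G _ v k a₁ c₂ h _ ht hc hk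
    subst hc
    have h' := h.isTerwilligerSRG_of_one ht
    exact h'.nonempty_iso_pentagon_or (h'.eq_of_mu_one hk)
  · intro V _ G _ v k a₁ c₂ h hT hv
    have h' := h.isTerwilligerSRG_of_isTerwilliger hT
    obtain ⟨rfl, hp⟩ := h'.eq_of_card_le hv
    exact h'.nonempty_iso_pentagon_or hp
  · intro V _ G b c h hT hk hc2
    obtain ⟨l, hl, hlb, hA⟩ := h.isAmplyTerwilliger hT
    have := h.connected.nonempty
    have hk' : 57 * b 0 ≤ 350 * (l + 1) := by
      rw [hl] at hk
      push_cast at hk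
      have : (57 * b 0 : ℚ) ≤ 350 * (l + 1) := by linarith
      exact_mod_cast this
    obtain ⟨hm, hkl, hK⟩ := hA.params hc2 hlb hk'
    rw [hm] at hA
    rcases hkl with ⟨hb, rfl⟩ | ⟨hb, rfl⟩
    · rw [hb] at hA
      exact Or.inl (SimpleGraph.IsLocallyMoore.nonempty_iso_icosahedron ⟨hA, hK⟩ h.connected)
    · rw [hb] at hA
      exact Or.inr (h.nonempty_iso_doroGraph_or ⟨hA, hK⟩)
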